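/- There is a universal constant $c>0$ with the following property. Let $(X,g)$ be a smooth Riemannian four-manifold with Levi-Civita connection $\nabla$ and scalar curvature $\kappa_g$. Let $(\rho,W)$ be a spin$^c$ structure on $X$: a Hermitian rank-$4$ bundle $W=W^+\oplus W^-$ (orthogonal splitting) with a smooth Clifford multiplication $\rho:T^*X\to\operatorname{End}_{\mathbb C}(W)$ such that $\rho(\alpha)^\dagger=-\rho(\alpha)$, $\rho(\alpha)^2=-|\alpha|_g^2$, and $\rho(\alpha)$ exchanges $W^+$ and $W^-$. Let $A_d$ be a smooth unitary connection on $\det(W^+)=\Lambda^2W^+$, and give $W$ the spin connection induced by $A_d$ and $\nabla$, that is, the unitary connection $\nabla^W$ which satisfies $\nabla^W(\rho(\alpha)\psi)=\rho(\nabla\alpha)\psi+\rho(\alpha)\nabla^W\psi$ and induces $A_d$ on $\det(W^+)$. Let $E$ be a Hermitian bundle of finite rank over $X$ with a smooth unitary connection $A$, let $V=W\otimes E$ carry the tensor product metric and connection $\nabla_A$, and let $D_A=\sum_{i=1}^4\rho(e^i)\nabla_{A,e_i}$ be the Dirac operator on sections of $V$, where $\{e_i\}$ is a local orthonormal frame of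 $TX$ with dual coframe $\{e^i\}$. Let $\Delta=d^*d$ be the Laplacian on functions (so $\Delta=-\sum_i\partial^2/\partial x_i^2$ on Euclidean $\mathbb R^4$). Let $|F_A|$ and $|F_{A_d}|$ be the pointwise norms of the curvatures, $|F|^2=\sum_{i<j}|F(e_i,e_j)|^2$ with the Hilbert-Schmidt norm on endomorphisms. If $\mu\in\mathbb R$ and $\phi\in C^\infty(X,V)$ satisfies $D_A\phi=\mu\phi$ on $X$, then $$\Delta|\phi|^{2/3}\le c\,\bigl(\mu^2+|\kappa_g|+|F_A|+|F_{A_d}|\bigr)\,|\phi|^{2/3}.$$ The inequality holds pointwise on the open set $\{\phi\ne 0\}$, where $|\phi|^{2/3}$ is smooth, and it holds on all of $X$ in the sense of distributions: for every smooth $\eta\ge 0$ with compact support (contained in a chart of a fixed atlas, which is no restriction by a partition of unity), $$\int_X|\phi|^{2/3}\,\Delta\eta\,d\mathrm{vol}_g\le\int_X c\,\bigl(\mu^2+|\kappa_g|+|F_A|+|F_{A_d}|\bigr)\,|\phi|^{2/3}\,\eta\,d\mathrm{vol}_g.$$ -/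

import Mathlib

open scoped Manifold ContDiff Topology TensorProduct
open Bundle

noncomputable section

/-- The model space of a four-manifold. -/
abbrev R4 : Type := EuclideanSpace ℝ (Fin 4)

/-! ### Sections of bundles and curvature of a connection -/

/-- The section `σ` of the bundle `V`, with model fibre `F`, is smooth at `x`. -/
abbrev SmoothSectionAt {X : Type*} [TopologicalSpace X] [ChartedSpace R4 X]
    (F : Type*) [NormedAddCommGroup F] [NormedSpace ℝ F]
    {V : X → Type*} [TopologicalSpace (TotalSpace F V)] [∀ x, TopologicalSpace (V x)]
    [FiberBundle F V] (σ : Π x, V x) (x : X) : Prop :=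
  ContMDiffAt (𝓡 4) ((𝓡 4).prod 𝓘(ℝ, F)) ∞ (fun y ↦ TotalSpace.mk' F y (σ y)) x

/-- The section `σ` of the bundle `V`, with model fibre `F`, is differentiable at `x`. -/
abbrev DiffSectionAt {X : Type*} [TopologicalSpace X] [ChartedSpace R4 X]
    (F : Type*) [NormedAddCommGroup F] [NormedSpace ℝ F]
    {V : X → Type*} [TopologicalSpace (TotalSpace F V)] [∀ x, TopologicalSpace (V x)]
    [FiberBundle F V] (σ : Π x, V x) (x : X) : Prop :=
  MDifferentiableAt (𝓡 4) ((𝓡 4).prod 𝓘(ℝ, F)) (fun y ↦ TotalSpace.mk' F y (σ y)) x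

/-- The curvature `R(u, v) w = ∇_u ∇_v w - ∇_v ∇_u w - ∇_[u, v] w` of a connection at the point `x`,
computed with smooth extensions of the vectors `u v : T_x X` and `w : V_x` to a neighbourhood of `x`
(the result does not depend on the extensions). Mathlib writes `cov σ x v` for `(∇_v σ)(x)`. -/
def curvatureAt {X : Type*} [TopologicalSpace X] [ChartedSpace R4 X] [IsManifold (𝓡 4) ∞ X]
    {F : Type*} [NormedAddCommGroup F] [NormedSpace ℝ F]
    {V : X → Type*} [TopologicalSpace (TotalSpace F V)]
    [∀ x, AddCommGroup (V x)] [∀ x, Module ℝ (V x)] [∀ x, TopologicalSpace (V x)]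
    [∀ x, IsTopologicalAddGroup (V x)] [∀ x, ContinuousSMul ℝ (V x)] [FiberBundle F V]
    (cov : CovariantDerivative (𝓡 4) F V) (x : X) (u v : TangentSpace (𝓡 4) x) (w : V x) : V x :=
  cov (fun y ↦ cov (FiberBundle.extend F w) y (FiberBundle.extend R4 v y)) x u
    - cov (fun y ↦ cov (FiberBundle.extend F w) y (FiberBundle.extend R4 u y)) x v
    - cov (FiberBundle.extend F w) x
        (VectorField.mlieBracket (𝓡 4) (FiberBundle.extend R4 u) (FiberBundle.extend R4 v) x)

/-! ### Riemannian geometry of a four-manifold -/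

section Riemannian

variable {X : Type*} [TopologicalSpace X] [ChartedSpace R4 X] [IsManifold (𝓡 4) ∞ X]
  [RiemannianBundle (fun x : X ↦ TangentSpace (𝓡 4) x)]
  [IsContMDiffRiemannianBundle (𝓡 4) ∞ R4 (fun x : X ↦ TangentSpace (𝓡 4) x)]

/-- Some orthonormal basis of the tangent space `T_x X`. -/
def tangentFrame (x : X) :
    OrthonormalBasis (Fin 4) ℝ (TangentSpace (𝓡 4) x) :=
  haveI : FiniteDimensional ℝ (TangentSpace (𝓡 4) x) := inferInstanceAs (FiniteDimensional ℝ R4)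
  (stdOrthonormalBasis ℝ (TangentSpace (𝓡 4) x)).reindex
    (finCongr ((finrank_euclideanSpace_fin : Module.finrank ℝ R4 = 4)))

set_option synthInstance.maxHeartbeats 200000 in
/-- `cov` is the Levi-Civita connection: the (smooth) torsion-free connection on `TX` that is
compatible with the metric. -/
structure IsLeviCivita
    (cov : CovariantDerivative (𝓡 4) R4 (fun x : X ↦ TangentSpace (𝓡 4) x)) : Prop where
  smooth : CovariantDerivative.ContMDiffCovariantDerivative cov ∞
  metric : cov.IsMetricCompatible
  torsionFree : cov.torsion = 0

/-- The scalar curvature `κ_g = ∑_{i,j} ⟨R(e_i, e_j) e_j, e_i⟩` of the Levi-Civita connection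
(it is positive on round spheres). -/
def scalarCurvature
    (cov : CovariantDerivative (𝓡 4) R4 (fun x : X ↦ TangentSpace (𝓡 4) x)) (x : X) : ℝ :=
  ∑ i, ∑ j, inner ℝ
    (curvatureAt cov x (tangentFrame x i) (tangentFrame x j) (tangentFrame x j)) (tangentFrame x i)

/-- The second covariant derivative `(∇ df)(u, v) = u(v f) - (∇_u v) f` of a function at `x`. -/
def hessianAt
    (cov : CovariantDerivative (𝓡 4) R4 (fun x : X ↦ TangentSpace (𝓡 4) x)) (f : X → ℝ) (x : X)
    (u v : TangentSpace (𝓡 4) x) : ℝ :=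
  mvfderiv (𝓡 4) (fun y ↦ mvfderiv (𝓡 4) f y (FiberBundle.extend R4 v y)) x u
    - mvfderiv (𝓡 4) f x (cov (FiberBundle.extend R4 v) x u)

/-- The Laplacian with the geometers' sign, `Δ f = d^* d f = - tr (∇ df)`; on Euclidean space it is
`- ∑ ∂² f / ∂ x_i²`. -/
def laplacian
    (cov : CovariantDerivative (𝓡 4) R4 (fun x : X ↦ TangentSpace (𝓡 4) x)) (f : X → ℝ) (x : X) :
    ℝ :=
  - ∑ i, hessianAt cov f x (tangentFrame x i) (tangentFrame x i)

/-- The coordinate vector `∂/∂y_i` of the chart around `x₀`, at the point with coordinates `y`. -/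
def coordVector (x₀ : X) (y : R4) (i : Fin 4) :
    TangentSpace (𝓡 4) ((extChartAt (𝓡 4) x₀).symm y) :=
  mfderiv (𝓡 4) (𝓡 4) (extChartAt (𝓡 4) x₀).symm y (EuclideanSpace.single i (1 : ℝ) : R4)

/-- The integral of a function over the domain of the chart around `x₀`, with respect to the
Riemannian measure `√(det g_ij) dy₁ dy₂ dy₃ dy₄`. -/
def chartIntegral (x₀ : X) (f : X → ℝ) : ℝ :=
  ∫ y in (extChartAt (𝓡 4) x₀).target,
    f ((extChartAt (𝓡 4) x₀).symm y) *
      √(Matrix.det (Matrix.of fun i j ↦ inner ℝ (coordVector x₀ y i) (coordVector x₀ y j)))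

/-- `Δ u ≤ f` in the sense of distributions: `∫ u Δη ≤ ∫ f η` for all smooth `η ≥ 0` with compact
support. The test functions are supported in charts, which suffices by a partition of unity. -/
def WeakLaplacianLE
    (cov : CovariantDerivative (𝓡 4) R4 (fun x : X ↦ TangentSpace (𝓡 4) x)) (u f : X → ℝ) : Prop :=
  ∀ (x₀ : X) (η : X → ℝ), ContMDiff (𝓡 4) 𝓘(ℝ, ℝ) ∞ η → HasCompactSupport η →
    tsupport η ⊆ (chartAt R4 x₀).source → (∀ x, 0 ≤ η x) →
      chartIntegral x₀ (fun x ↦ u x * laplacian cov η x) ≤ chartIntegral x₀ (fun x ↦ f x * η x)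

end Riemannian

/-! ### Hermitian bundles and unitary connections

A smooth complex vector bundle is given by a bundle with complex linear trivializations which is smooth
as a real vector bundle. -/

section Hermitian

theorem finiteDimensional_fiber {X : Type*} [TopologicalSpace X]
    (F : Type*) [NormedAddCommGroup F] [NormedSpace ℂ F]
    [FiniteDimensional ℂ F] (V : X → Type*) [∀ x, NormedAddCommGroup (V x)]
    [∀ x, InnerProductSpace ℂ (V x)]
    [TopologicalSpace (TotalSpace F V)] [FiberBundle F V] [VectorBundle ℂ F V] (x : X) :
    FiniteDimensional ℂ (V x) :=
  Module.Finite.equiv ((trivializationAt F V x).linearEquivAt ℂ x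
    (FiberBundle.mem_baseSet_trivializationAt' x)).symm

variable {X : Type*} [TopologicalSpace X] [ChartedSpace R4 X]
  (F : Type*) [NormedAddCommGroup F] [NormedSpace ℂ F]
  (V : X → Type*) [∀ x, NormedAddCommGroup (V x)] [∀ x, InnerProductSpace ℂ (V x)]
  [TopologicalSpace (TotalSpace F V)] [FiberBundle F V]

/-- The Hermitian inner products on the fibres of `V` vary smoothly with the base point. -/
class IsSmoothHermitianBundle : Prop where
  smooth_inner : ∀ (σ τ : Π x, V x) (x : X), SmoothSectionAt F σ x → SmoothSectionAt F τ x →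
    ContMDiffAt (𝓡 4) 𝓘(ℝ, ℂ) ∞ (fun y ↦ inner ℂ (σ y) (τ y)) x

variable [IsManifold (𝓡 4) ∞ X]

variable {F V} in
/-- `cov` is a smooth unitary connection: it is complex linear and satisfies
`d⟨σ, τ⟩ = ⟨∇σ, τ⟩ + ⟨σ, ∇τ⟩` for the Hermitian metric. -/
structure IsUnitaryConnection [VectorBundle ℝ F V] (cov : CovariantDerivative (𝓡 4) F V) :
    Prop where
  smooth : CovariantDerivative.ContMDiffCovariantDerivative cov ∞
  complexLinear : ∀ (σ : Π x, V x) (x : X), DiffSectionAt F σ x → ∀ v : TangentSpace (𝓡 4) x,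
    cov (fun y ↦ Complex.I • σ y) x v = Complex.I • cov σ x v
  metric : ∀ (σ τ : Π x, V x) (x : X), DiffSectionAt F σ x → DiffSectionAt F τ x →
    ∀ v : TangentSpace (𝓡 4) x,
      mvfderiv (𝓡 4) (fun y ↦ inner ℂ (σ y) (τ y)) x v
        = inner ℂ (cov σ x v) (τ x) + inner ℂ (σ x) (cov τ x v)

variable {F V} in
/-- The pointwise norm `|F_A|` of the curvature, an `End(V)`-valued two-form:
`|F_A|² = ∑_{i<j} |F_A(e_i, e_j)|²` with the Hilbert-Schmidt norm on endomorphisms. -/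
def curvatureNorm [RiemannianBundle (fun x : X ↦ TangentSpace (𝓡 4) x)]
    [FiniteDimensional ℂ F] [VectorBundle ℂ F V]
    (cov : CovariantDerivative (𝓡 4) F V) (x : X) : ℝ :=
  haveI : FiniteDimensional ℂ (V x) := finiteDimensional_fiber F V x
  √(∑ i, ∑ j ∈ Finset.Ioi i, ∑ a, ‖curvatureAt cov x (tangentFrame x i) (tangentFrame x j)
    (stdOrthonormalBasis ℂ (V x) a)‖ ^ 2)

end Hermitian

/-! ### Spin^c structures and Dirac operators -/

section Spinc

variable {X : Type*} [TopologicalSpace X] [ChartedSpace R4 X] [IsManifold (𝓡 4) ∞ X]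
  [RiemannianBundle (fun x : X ↦ TangentSpace (𝓡 4) x)]
  (FW : Type*) [NormedAddCommGroup FW] [NormedSpace ℂ FW]
  (W : X → Type*) [∀ x, NormedAddCommGroup (W x)] [∀ x, InnerProductSpace ℂ (W x)]
  [TopologicalSpace (TotalSpace FW W)] [FiberBundle FW W] [VectorBundle ℝ FW W]

/-- A spin^c structure `(ρ, W)` on a Riemannian four-manifold: a Hermitian bundle `W` of rank four
with a smooth Clifford multiplication `ρ` by (co)tangent vectors, where `T^*X` is identified with
`TX` by the metric, and the splitting `W = W⁺ ⊕ W⁻` into two orthogonal subbundles that are exchanged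
by `ρ`. The splitting is recorded by the involution `ε` that is `1` on `W⁺` and `-1` on `W⁻`; it
amounts to a choice of orientation of `X`. -/
structure SpincStructure where
  /-- Clifford multiplication `ρ`. -/
  ρ : ∀ x, TangentSpace (𝓡 4) x →ₗ[ℝ] W x →ₗ[ℂ] W x
  /-- The grading involution. -/
  ε : ∀ x, W x →ₗ[ℂ] W x
  rank_eq_four : Module.finrank ℂ FW = 4
  ρ_skew : ∀ x v (a b : W x), inner ℂ (ρ x v a) b = - inner ℂ a (ρ x v b)
  ρ_sq : ∀ x v (a : W x), ρ x v (ρ x v a) = - ((‖v‖ ^ 2 : ℝ) : ℂ) • a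
  ρ_smooth : ∀ (Y : Π x : X, TangentSpace (𝓡 4) x) (σ : Π x, W x) (x : X),
    SmoothSectionAt R4 Y x → SmoothSectionAt FW σ x → SmoothSectionAt FW (fun y ↦ ρ y (Y y) (σ y)) x
  ε_sq : ∀ x (a : W x), ε x (ε x a) = a
  ε_symm : ∀ x (a b : W x), inner ℂ (ε x a) b = inner ℂ a (ε x b)
  ε_ρ : ∀ x v (a : W x), ε x (ρ x v a) = - ρ x v (ε x a)
  ε_smooth : ∀ (σ : Π x, W x) (x : X),
    SmoothSectionAt FW σ x → SmoothSectionAt FW (fun y ↦ ε y (σ y)) x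

variable {FW W}
  {FL : Type*} [NormedAddCommGroup FL] [NormedSpace ℂ FL]
  {L : X → Type*} [∀ x, NormedAddCommGroup (L x)] [∀ x, InnerProductSpace ℂ (L x)]
  [TopologicalSpace (TotalSpace FL L)] [FiberBundle FL L] [VectorBundle ℝ FL L]

variable (FL L) in
/-- The Hermitian line bundle `L` is the determinant line `det(W⁺) = Λ² W⁺`: the smooth alternating
map `wedge : W⁺ × W⁺ → L` induces isometries `Λ² W⁺_x → L_x` between complex lines. It is extended by
zero to `W`, that is, it vanishes if one of its arguments lies in `W⁻`. -/
structure DeterminantLine (S : SpincStructure FW W) where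
  /-- The map `(a, b) ↦ a ∧ b`. -/
  wedge : ∀ x, W x →ₗ[ℂ] W x →ₗ[ℂ] L x
  rank_eq_one : Module.finrank ℂ FL = 1
  wedge_self : ∀ x (a : W x), wedge x a a = 0
  wedge_ε : ∀ x (a b : W x), wedge x (S.ε x a) b = wedge x a b
  norm_wedge : ∀ x (a b : W x), S.ε x a = a → S.ε x b = b →
    ‖wedge x a b‖ ^ 2 = ‖a‖ ^ 2 * ‖b‖ ^ 2 - ‖(inner ℂ a b : ℂ)‖ ^ 2
  wedge_smooth : ∀ (σ τ : Π x, W x) (x : X), SmoothSectionAt FW σ x → SmoothSectionAt FW τ x →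
    SmoothSectionAt FL (fun y ↦ wedge y (σ y) (τ y)) x

/-- `covW` is the spin connection on `W` induced by the Levi-Civita connection `covX` and the unitary
connection `Ad` on `det(W⁺)`: the unitary connection for which `ρ` is parallel and which induces
`Ad` on `det(W⁺)`. -/
structure IsSpinConnection {S : SpincStructure FW W} (δ : DeterminantLine FL L S)
    (covX : CovariantDerivative (𝓡 4) R4 (fun x : X ↦ TangentSpace (𝓡 4) x))
    (Ad : CovariantDerivative (𝓡 4) FL L) (covW : CovariantDerivative (𝓡 4) FW W) : Prop where
  unitary : IsUnitaryConnection covW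
  clifford : ∀ (Y : Π x : X, TangentSpace (𝓡 4) x) (σ : Π x, W x) (x : X),
    DiffSectionAt R4 Y x → DiffSectionAt FW σ x → ∀ v : TangentSpace (𝓡 4) x,
      covW (fun y ↦ S.ρ y (Y y) (σ y)) x v = S.ρ x (covX Y x v) (σ x) + S.ρ x (Y x) (covW σ x v)
  det : ∀ (σ τ : Π x, W x) (x : X), DiffSectionAt FW σ x → DiffSectionAt FW τ x →
    ∀ v : TangentSpace (𝓡 4) x,
      Ad (fun y ↦ δ.wedge y (σ y) (τ y)) x v
        = δ.wedge x (covW σ x v) (τ x) + δ.wedge x (σ x) (covW τ x v)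

variable {FE : Type*} [NormedAddCommGroup FE] [NormedSpace ℂ FE]
  {E : X → Type*} [∀ x, NormedAddCommGroup (E x)] [∀ x, InnerProductSpace ℂ (E x)]
  [TopologicalSpace (TotalSpace FE E)] [FiberBundle FE E]

variable (FW FE) in
/-- An expression `φ = ∑ σ_i ⊗ τ_i` of a section of `V = W ⊗ E` near `x`, with smooth sections `σ_i`
of `W` and `τ_i` of `E`. -/
structure TensorExpression (φ : Π x, W x ⊗[ℂ] E x) (x : X) where
  n : ℕ
  σ : Fin n → Π y, W y
  τ : Fin n → Π y, E y
  smooth_left : ∀ i, ∀ y, SmoothSectionAt FW (σ i) y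
  smooth_right : ∀ i, ∀ y, SmoothSectionAt FE (τ i) y
  eq_sum : ∀ᶠ y in 𝓝 x, φ y = ∑ i, σ i y ⊗ₜ[ℂ] τ i y

variable (FW FE) in
/-- Smooth sections of `V = W ⊗ E`, that is, elements of `C^∞(X, V)`. -/
def IsSmoothTensorSection (φ : Π x, W x ⊗[ℂ] E x) : Prop :=
  ∀ x, Nonempty (TensorExpression FW FE φ x)

open Classical in
/-- The tensor product connection on `V = W ⊗ E`,
`∇_v (∑ σ_i ⊗ τ_i) = ∑ (∇_v σ_i ⊗ τ_i + σ_i ⊗ ∇_v τ_i)`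
for any local expression of the section (all of them give the same value). -/
def tensorCov (covW : CovariantDerivative (𝓡 4) FW W) (A : CovariantDerivative (𝓡 4) FE E)
    (φ : Π x, W x ⊗[ℂ] E x) (x : X) (v : TangentSpace (𝓡 4) x) : W x ⊗[ℂ] E x :=
  if h : Nonempty (TensorExpression FW FE φ x) then
    ∑ i, (covW (h.some.σ i) x v ⊗ₜ[ℂ] h.some.τ i x + h.some.σ i x ⊗ₜ[ℂ] A (h.some.τ i) x v)
  else 0

/-- The Dirac operator `D_A φ = ∑ ρ(e_i) ∇_{e_i} φ` on sections of `V = W ⊗ E`, where `ρ` acts on the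
factor `W`. -/
def dirac (S : SpincStructure FW W)
    (covW : CovariantDerivative (𝓡 4) FW W) (A : CovariantDerivative (𝓡 4) FE E)
    (φ : Π x, W x ⊗[ℂ] E x) (x : X) : W x ⊗[ℂ] E x :=
  ∑ i, (S.ρ x (tangentFrame x i)).rTensor (E x) (tensorCov covW A φ x (tangentFrame x i))

end Spinc

end

/-!
The estimate comes from a Bochner argument for `u = |φ|²`, in which the exponent `2/3` is the one that
the refined Kato inequality for Dirac eigensections in dimension four allows.

**Weitzenböck.** Squaring `D_A φ = μ φ` expresses the rough Laplacian of `φ` through `μ²` and the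
Clifford action of the curvature of `W ⊗ E` (`IsSpinConnection.weitzenbock`). The commutator of the
curvature of `W` with Clifford multiplication is the Riemann tensor, so by Schur's lemma for the
rank-four Clifford module it is `¼ ∑ R_{ab} ρ_a ρ_b` plus a scalar, and the scalar is half the curvature
of `det W⁺` because the products `ρ_a ρ_b` are traceless on `W⁺`
(`IsCliffordFamily.exists_spin_curvature`). By the first Bianchi identity the quadratic Clifford
expression in the Riemann tensor collapses to the scalar curvature
(`IsCliffordFamily.re_inner_sum_curvature`), and the remaining terms are bounded by
`|F_A| + |F_{A_d}|`. With `q = μ² + |κ_g| + |F_A| + |F_{A_d}|` this gives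
`Δu ≤ 16 q u - 2 |∇_A φ|²` (`IsSpinConnection.laplacian_norm_sq_le`).

**Refined Kato.** The equation `∑ ρ_i ∇_i φ = μ φ` is one linear constraint on `∇_A φ`, and it improves
`|du|² ≤ 4 u |∇_A φ|²` to `|du|² ≤ 3 u |∇_A φ|²` (`IsCliffordFamily.kato`; the term `μ φ` does not
contribute because Clifford multiplication is skew). Hence the gradient terms cancel in
`Δ (u + s)^{1/3} ≤ 6 q (u + s)^{1/3}`, for all `s ≥ 0` (`IsSpinConnection.laplacian_rpow_le`). The
pointwise inequality is the case `s = 0`.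

**Weak form.** For `s = t³ > 0` the function `(u + s)^{1/3}` is smooth and within `t` of `|φ|^{2/3}`.
Green's formula in a chart (`chartIntegral_mul_laplacian`), which rests on
`√g div Z = ∑ ∂_k (√g Z^k)` (`sum_fderiv_chartDensity_mul`), moves the Laplacian to the test function,
and `t → 0` is a uniform limit against compactly supported integrands
(`WeakLaplacianLE.of_uniform_limit`).

Connections are only known to preserve smoothness of global sections, so all local computations are
made with globally smooth sections, obtained by cutting off. The curvature and the Hessian are defined
through fixed extensions of vectors; their independence of the extension follows from tensoriality
in the vector fields and, for the section argument, from pairing with a second section by the metric.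
-/

set_option linter.unusedSectionVars false

/-! ### Smooth sections and covariant derivatives -/

section SectionCalculus

variable {X : Type*} [TopologicalSpace X] [ChartedSpace R4 X]
  {F : Type*} [NormedAddCommGroup F] [NormedSpace ℝ F]
  {V : X → Type*} [TopologicalSpace (TotalSpace F V)]
  [∀ x, AddCommGroup (V x)] [∀ x, Module ℝ (V x)] [∀ x, TopologicalSpace (V x)]
  [FiberBundle F V]

/-- The section `σ` is smooth on the whole manifold. -/
abbrev SmoothSec (F : Type*) [NormedAddCommGroup F] [NormedSpace ℝ F]
    {V : X → Type*} [TopologicalSpace (TotalSpace F V)] [∀ x, TopologicalSpace (V x)]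
    [FiberBundle F V] (σ : Π x, V x) : Prop :=
  ∀ x, SmoothSectionAt F σ x

theorem SmoothSectionAt.diffSectionAt {V : X → Type*} [TopologicalSpace (TotalSpace F V)]
    [∀ x, TopologicalSpace (V x)] [FiberBundle F V] {σ : Π x, V x} {x : X}
    (h : SmoothSectionAt F σ x) : DiffSectionAt F σ x :=
  ContMDiffAt.mdifferentiableAt h (by simp)

section Algebra

variable [VectorBundle ℝ F V]

theorem SmoothSec.add {σ τ : Π x, V x} (hσ : SmoothSec F σ) (hτ : SmoothSec F τ) :
    SmoothSec F (fun y ↦ σ y + τ y) := fun x ↦ ContMDiffAt.add_section (hσ x) (hτ x)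

theorem SmoothSec.sub {σ τ : Π x, V x} (hσ : SmoothSec F σ) (hτ : SmoothSec F τ) :
    SmoothSec F (fun y ↦ σ y - τ y) := fun x ↦ ContMDiffAt.sub_section (hσ x) (hτ x)

theorem SmoothSec.smul {f : X → ℝ} {σ : Π x, V x} (hf : ContMDiff (𝓡 4) 𝓘(ℝ, ℝ) ∞ f)
    (hσ : SmoothSec F σ) : SmoothSec F (fun y ↦ f y • σ y) :=
  fun x ↦ ContMDiffAt.smul_section (hf x) (hσ x)

theorem SmoothSec.sum {ι : Type*} {s : Finset ι} {σ : ι → Π x, V x}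
    (hσ : ∀ i ∈ s, SmoothSec F (σ i)) : SmoothSec F (fun y ↦ ∑ i ∈ s, σ i y) :=
  fun x ↦ ContMDiffAt.sum_section fun i hi ↦ hσ i hi x

theorem SmoothSec.zero : SmoothSec F (fun y : X ↦ (0 : V y)) :=
  fun x ↦ contMDiff_zeroSection ℝ V x

end Algebra

section CutOff

variable [T2Space X] [IsManifold (𝓡 4) ∞ X] [VectorBundle ℝ F V]

/-- A section that is smooth on a neighbourhood of `x` agrees near `x` with a section that is smooth
on the whole manifold: multiply it by a bump function. -/
theorem exists_smoothSec_eventuallyEq {σ : Π x, V x} {x : X}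
    (h : ∀ᶠ y in 𝓝 x, SmoothSectionAt F σ y) :
    ∃ τ : Π x, V x, SmoothSec F τ ∧ ∀ᶠ y in 𝓝 x, τ y = σ y := by
  obtain ⟨u, hu, huo, hxu⟩ := eventually_nhds_iff.1 h
  obtain ⟨f, hf⟩ := ((SmoothBumpFunction.nhds_basis_tsupport (I := 𝓡 4) x).mem_iff).1
    (huo.mem_nhds hxu)
  refine ⟨(f : X → ℝ) • σ, ?_, ?_⟩
  · exact fun y ↦ ContMDiffOn.smul_section_of_tsupport (f.contMDiff.contMDiffOn) huo hf.2
      (fun y hy ↦ (hu y hy).contMDiffWithinAt) y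
  · filter_upwards [f.eventuallyEq_one] with y hy
    simp [hy]

theorem exists_smoothSec_extend [ContMDiffVectorBundle ∞ F V (𝓡 4)] {x : X} (v : V x) :
    ∃ σ : Π x, V x, SmoothSec F σ ∧ (∀ᶠ y in 𝓝 x, σ y = FiberBundle.extend F v y) ∧ σ x = v := by
  obtain ⟨s, hs, h⟩ := FiberBundle.exists_contMDiffOn_extend (k := ∞) (𝓡 4) F v
  have : ∀ᶠ y in 𝓝 x, SmoothSectionAt F (FiberBundle.extend F v) y := by
    filter_upwards [eventually_mem_nhds_iff.2 hs] with y hy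
    exact h.contMDiffAt hy
  obtain ⟨τ, hτ, hτ'⟩ := exists_smoothSec_eventuallyEq this
  exact ⟨τ, hτ, hτ', by simpa using hτ'.self_of_nhds⟩

theorem exists_smoothSec_eq [ContMDiffVectorBundle ∞ F V (𝓡 4)] {x : X} (v : V x) :
    ∃ σ : Π x, V x, SmoothSec F σ ∧ σ x = v :=
  let ⟨σ, h, _, h'⟩ := exists_smoothSec_extend (F := F) v
  ⟨σ, h, h'⟩

end CutOff

section Connection

variable [IsManifold (𝓡 4) ∞ X]
  [∀ x, IsTopologicalAddGroup (V x)] [∀ x, ContinuousSMul ℝ (V x)] [VectorBundle ℝ F V]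
  {cov : CovariantDerivative (𝓡 4) F V}

theorem SmoothSec.covDeriv (hcov : CovariantDerivative.ContMDiffCovariantDerivative cov ∞)
    {σ : Π x, V x} (hσ : SmoothSec F σ) {Y : Π x : X, TangentSpace (𝓡 4) x} (hY : SmoothSec R4 Y) :
    SmoothSec F (fun y ↦ cov σ y (Y y)) := fun x ↦ by
  have h := hcov.contMDiff.contMDiff (σ := σ) (fun y _ ↦ (hσ y).contMDiffWithinAt) x trivial
  exact ContMDiffAt.clm_bundle_apply (F₁ := R4) (h.contMDiffAt Filter.univ_mem) (hY x)

theorem DiffSectionAt.covDeriv (hcov : CovariantDerivative.ContMDiffCovariantDerivative cov ∞)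
    {σ : Π x, V x} (hσ : SmoothSec F σ) {Y : Π x : X, TangentSpace (𝓡 4) x} {x : X}
    (hY : DiffSectionAt R4 Y x) : DiffSectionAt F (fun y ↦ cov σ y (Y y)) x := by
  have h := hcov.contMDiff.contMDiff (σ := σ) (fun y _ ↦ (hσ y).contMDiffWithinAt) x trivial
  exact MDifferentiableAt.clm_bundle_apply (F₁ := R4)
    ((h.contMDiffAt Filter.univ_mem).mdifferentiableAt (by simp)) hY

theorem cov_congr {σ τ : Π x, V x} {x : X} (hσ : DiffSectionAt F σ x) (hτ : DiffSectionAt F τ x)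
    (h : ∀ᶠ y in 𝓝 x, σ y = τ y) : cov σ x = cov τ x :=
  (cov.isCovariantDerivativeOn (s := Set.univ)).congr_of_eventuallyEq hσ hτ Filter.univ_mem h

theorem cov_add {σ τ : Π x, V x} {x : X} (hσ : DiffSectionAt F σ x) (hτ : DiffSectionAt F τ x)
    (v : TangentSpace (𝓡 4) x) : cov (fun y ↦ σ y + τ y) x v = cov σ x v + cov τ x v :=
  congrArg (fun f ↦ f v) (cov.isCovariantDerivativeOnUniv.add hσ hτ)

theorem cov_smul {f : X → ℝ} {σ : Π x, V x} {x : X} (hf : MDifferentiableAt (𝓡 4) 𝓘(ℝ, ℝ) f x)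
    (hσ : DiffSectionAt F σ x) (v : TangentSpace (𝓡 4) x) :
    cov (fun y ↦ f y • σ y) x v = f x • cov σ x v + mvfderiv (𝓡 4) f x v • σ x :=
  congrArg (fun f ↦ f v) (cov.isCovariantDerivativeOnUniv.leibniz hσ hf)

theorem cov_const_smul (c : ℝ) {σ : Π x, V x} {x : X}
    (hσ : DiffSectionAt F σ x) (v : TangentSpace (𝓡 4) x) :
    cov (fun y ↦ c • σ y) x v = c • cov σ x v :=
  congrArg (fun f ↦ f v) (cov.isCovariantDerivativeOnUniv.smul_const c hσ)

theorem cov_sub {σ τ : Π x, V x} {x : X} (hσ : DiffSectionAt F σ x) (hτ : DiffSectionAt F τ x)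
    (v : TangentSpace (𝓡 4) x) : cov (fun y ↦ σ y - τ y) x v = cov σ x v - cov τ x v := by
  have h1 : DiffSectionAt F (fun y ↦ (-1 : ℝ) • τ y) x :=
    MDifferentiableAt.smul_section (f := fun _ ↦ (-1 : ℝ)) mdifferentiableAt_const hτ
  have h := cov_add (cov := cov) hσ h1 v
  rw [cov_const_smul _ hτ] at h
  simpa [sub_eq_add_neg] using h

end Connection

section Functions

variable {G : Type*} [NormedAddCommGroup G] [NormedSpace ℝ G]

theorem mvfderiv_congr {f g : X → G} {x : X} (h : f =ᶠ[𝓝 x] g) :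
    mvfderiv (𝓡 4) f x = mvfderiv (𝓡 4) g x := by
  unfold mvfderiv
  rw [h.mfderiv_eq, h.self_of_nhds]

variable [IsManifold (𝓡 4) ∞ X]

theorem contMDiff_mvfderiv {f : X → G} (hf : ContMDiff (𝓡 4) 𝓘(ℝ, G) ∞ f)
    {Y : Π x : X, TangentSpace (𝓡 4) x} (hY : SmoothSec R4 Y) :
    ContMDiff (𝓡 4) 𝓘(ℝ, G) ∞ (fun y ↦ mvfderiv (𝓡 4) f y (Y y)) := by
  have h1 := (hf.contMDiff_tangentMap (m := ∞) (by simp)).comp (f := fun y ↦ TotalSpace.mk' R4 y (Y y)) hY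
  exact (contMDiff_snd_tangentBundle_modelSpace G 𝓘(ℝ, G)).comp h1

theorem mdifferentiableAt_mvfderiv {f : X → G} (hf : ContMDiff (𝓡 4) 𝓘(ℝ, G) ∞ f)
    {Y : Π x : X, TangentSpace (𝓡 4) x} {x : X} (hY : DiffSectionAt R4 Y x) :
    MDifferentiableAt (𝓡 4) 𝓘(ℝ, G) (fun y ↦ mvfderiv (𝓡 4) f y (Y y)) x := by
  have h1 := ((hf.contMDiff_tangentMap (m := ∞) (by simp)).contMDiffAt.mdifferentiableAt
    (by simp)).comp (f := fun y ↦ TotalSpace.mk' R4 y (Y y)) x hY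
  exact ((contMDiff_snd_tangentBundle_modelSpace G 𝓘(ℝ, G) (n := ∞)).contMDiffAt.mdifferentiableAt
    (by simp)).comp x h1

end Functions

end SectionCalculus

/-! ### Charts and brackets of vector fields -/

section Charts

variable {X : Type*} [TopologicalSpace X] [ChartedSpace R4 X] [IsManifold (𝓡 4) ∞ X]
variable {G : Type*} [NormedAddCommGroup G] [NormedSpace ℝ G]

theorem two_le_infty : (2 : ℕ∞ω) ≤ ∞ :=
  WithTop.coe_le_coe.2 (le_top : (2 : ℕ∞) ≤ ⊤)

theorem hasMFDerivAt_extChartAt_symm (x₀ : X) {y : R4} (hy : y ∈ (extChartAt (𝓡 4) x₀).target) :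
    HasMFDerivAt (𝓡 4) (𝓡 4) (extChartAt (𝓡 4) x₀).symm y
      (mfderiv (𝓡 4) (𝓡 4) (extChartAt (𝓡 4) x₀).symm y) := by
  have h := (contMDiffOn_extChartAt_symm (I := 𝓡 4) (n := ∞) x₀).contMDiffAt
    ((isOpen_extChartAt_target x₀).mem_nhds hy)
  exact (h.mdifferentiableAt (by simp)).hasMFDerivAt

/-- The chain rule for a function read in the chart around `x₀`. -/
theorem fderiv_comp_extChartAt_symm (x₀ : X) {y : R4} (hy : y ∈ (extChartAt (𝓡 4) x₀).target)
    {g : X → G} (hg : MDifferentiableAt (𝓡 4) 𝓘(ℝ, G) g ((extChartAt (𝓡 4) x₀).symm y)) (w : R4) :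
    fderiv ℝ (fun z ↦ g ((extChartAt (𝓡 4) x₀).symm z)) y w
      = mvfderiv (𝓡 4) g ((extChartAt (𝓡 4) x₀).symm y)
          (mfderiv (𝓡 4) (𝓡 4) (extChartAt (𝓡 4) x₀).symm y w) := by
  have h := (hg.hasMFDerivAt.comp y (hasMFDerivAt_extChartAt_symm x₀ hy)).mfderiv
  rw [← mfderiv_eq_fderiv]
  exact congrArg (fun L ↦ L w) h

/-- The coordinates of a tangent vector in the chart around `x₀`. -/
noncomputable def chartCoords (x₀ : X) (y : R4) :
    TangentSpace (𝓡 4) ((extChartAt (𝓡 4) x₀).symm y) →L[ℝ] R4 :=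
  (mfderiv (𝓡 4) (𝓡 4) (extChartAt (𝓡 4) x₀).symm y).inverse

theorem isInvertible_mfderiv_symm (x₀ : X) {y : R4} (hy : y ∈ (extChartAt (𝓡 4) x₀).target) :
    (mfderiv (𝓡 4) (𝓡 4) (extChartAt (𝓡 4) x₀).symm y).IsInvertible := by
  have h := isInvertible_mfderivWithin_extChartAt_symm (I := 𝓡 4) hy
  rwa [show Set.range (𝓡 4) = Set.univ from Set.range_id, mfderivWithin_univ] at h

theorem mfderiv_symm_chartCoords (x₀ : X) {y : R4} (hy : y ∈ (extChartAt (𝓡 4) x₀).target)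
    (v : TangentSpace (𝓡 4) ((extChartAt (𝓡 4) x₀).symm y)) :
    mfderiv (𝓡 4) (𝓡 4) (extChartAt (𝓡 4) x₀).symm y (chartCoords x₀ y v) = v :=
  congrArg (fun L ↦ L v) (isInvertible_mfderiv_symm x₀ hy).self_comp_inverse

theorem chartCoords_mfderiv_symm (x₀ : X) {y : R4} (hy : y ∈ (extChartAt (𝓡 4) x₀).target)
    (w : R4) : chartCoords x₀ y (mfderiv (𝓡 4) (𝓡 4) (extChartAt (𝓡 4) x₀).symm y w) = w :=
  congrArg (fun L ↦ L w) (isInvertible_mfderiv_symm x₀ hy).inverse_comp_self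

theorem fderiv_chartCoords (x₀ : X) {y : R4} (hy : y ∈ (extChartAt (𝓡 4) x₀).target)
    {g : X → G} (hg : MDifferentiableAt (𝓡 4) 𝓘(ℝ, G) g ((extChartAt (𝓡 4) x₀).symm y))
    (v : TangentSpace (𝓡 4) ((extChartAt (𝓡 4) x₀).symm y)) :
    fderiv ℝ (fun z ↦ g ((extChartAt (𝓡 4) x₀).symm z)) y (chartCoords x₀ y v)
      = mvfderiv (𝓡 4) g ((extChartAt (𝓡 4) x₀).symm y) v := by
  rw [fderiv_comp_extChartAt_symm x₀ hy hg, mfderiv_symm_chartCoords x₀ hy]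

theorem mvfderiv_eq_fderiv_chart {g : X → G} {x : X} (hg : MDifferentiableAt (𝓡 4) 𝓘(ℝ, G) g x)
    (w : R4) :
    mvfderiv (𝓡 4) g x ((mfderiv (𝓡 4) (𝓡 4) (extChartAt (𝓡 4) x) x).inverse w)
      = fderiv ℝ (fun z ↦ g ((extChartAt (𝓡 4) x).symm z)) (extChartAt (𝓡 4) x x) w := by
  have hinv := isInvertible_mfderiv_extChartAt (I := 𝓡 4) (mem_extChartAt_source (I := 𝓡 4) x)
  have hev : g =ᶠ[𝓝 x] (fun z ↦ g ((extChartAt (𝓡 4) x).symm z)) ∘ extChartAt (𝓡 4) x := by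
    filter_upwards [extChartAt_source_mem_nhds (I := 𝓡 4) x] with z hz
    simp only [Function.comp, (extChartAt (𝓡 4) x).left_inv hz]
  have hsx : (extChartAt (𝓡 4) x).symm (extChartAt (𝓡 4) x x) = x := extChartAt_to_inv x
  have hm : MDifferentiableAt (𝓡 4) 𝓘(ℝ, G) (fun z ↦ g ((extChartAt (𝓡 4) x).symm z))
      (extChartAt (𝓡 4) x x) := by
    refine MDifferentiableAt.comp (g := g) _ ?_
      (hasMFDerivAt_extChartAt_symm x (mem_extChartAt_target x)).mdifferentiableAt
    rwa [hsx]
  have hc := (hm.hasMFDerivAt.comp x (mdifferentiableAt_extChartAt (I := 𝓡 4)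
    (mem_chart_source R4 x)).hasMFDerivAt).mfderiv
  rw [mvfderiv_congr hev]
  have h2 := congrArg (fun L ↦ L ((mfderiv (𝓡 4) (𝓡 4) (extChartAt (𝓡 4) x) x).inverse w)) hc
  refine h2.trans ?_
  have h3 : mfderiv (𝓡 4) (𝓡 4) (extChartAt (𝓡 4) x) x
      ((mfderiv (𝓡 4) (𝓡 4) (extChartAt (𝓡 4) x) x).inverse w) = w :=
    congrArg (fun L ↦ L w) hinv.self_comp_inverse
  refine (congrArg (fun v ↦ mfderiv (𝓡 4) 𝓘(ℝ, G)
    (fun z ↦ g ((extChartAt (𝓡 4) x).symm z)) (extChartAt (𝓡 4) x x) v) h3).trans ?_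
  rw [mfderiv_eq_fderiv]
  rfl

/-- The bracket acts on functions as the commutator of derivations, `[U, Y] f = U (Y f) - Y (U f)`. -/
theorem mvfderiv_mlieBracket {f : X → ℝ} (hf : ContMDiff (𝓡 4) 𝓘(ℝ, ℝ) ∞ f)
    {U V : Π x : X, TangentSpace (𝓡 4) x} {x : X} (hU : DiffSectionAt R4 U x)
    (hV : DiffSectionAt R4 V x) :
    mvfderiv (𝓡 4) f x (VectorField.mlieBracket (𝓡 4) U V x)
      = mvfderiv (𝓡 4) (fun y ↦ mvfderiv (𝓡 4) f y (V y)) x (U x)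
        - mvfderiv (𝓡 4) (fun y ↦ mvfderiv (𝓡 4) f y (U y)) x (V x) := by
  have : IsManifold (𝓡 4) 2 X := IsManifold.of_le (n := ∞) two_le_infty
  have hx : extChartAt (𝓡 4) x x ∈ (extChartAt (𝓡 4) x).target := mem_extChartAt_target x
  have hsx : (extChartAt (𝓡 4) x).symm (extChartAt (𝓡 4) x x) = x := extChartAt_to_inv x
  have hr : Set.range (𝓡 4) = Set.univ := Set.range_id
  let P : (Π x : X, TangentSpace (𝓡 4) x) → R4 → R4 :=
    fun Z y ↦ chartCoords x y (Z ((extChartAt (𝓡 4) x).symm y))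
  have hP : ∀ Z : Π x : X, TangentSpace (𝓡 4) x,
      VectorField.mpullbackWithin 𝓘(ℝ, R4) (𝓡 4) (extChartAt (𝓡 4) x).symm Z (Set.range (𝓡 4))
        = P Z := fun Z ↦ by
    rw [hr, VectorField.mpullbackWithin_univ]; rfl
  have hd : ∀ Z : Π x : X, TangentSpace (𝓡 4) x, DiffSectionAt R4 Z x →
      DifferentiableAt ℝ (P Z) (extChartAt (𝓡 4) x x) := fun Z hZ ↦ by
    have := MDifferentiableWithinAt.differentiableWithinAt_mpullbackWithin_vectorField
      (I := 𝓡 4) (x := x) (V := Z) (s := Set.univ) hZ.mdifferentiableWithinAt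
    rw [hP Z, hr, Set.preimage_univ, Set.univ_inter] at this
    exact differentiableWithinAt_univ.1 this
  have hbr : VectorField.mlieBracket (𝓡 4) U V x
      = (mfderiv (𝓡 4) (𝓡 4) (extChartAt (𝓡 4) x) x).inverse
        (VectorField.lieBracket ℝ (P U) (P V) (extChartAt (𝓡 4) x x)) := by
    rw [← VectorField.mlieBracketWithin_univ, VectorField.mlieBracketWithin_apply, hP, hP, hr,
      Set.preimage_univ, Set.univ_inter, VectorField.lieBracketWithin_univ]
    rfl
  have hC : ContDiffAt ℝ ∞ (fun z ↦ f ((extChartAt (𝓡 4) x).symm z)) (extChartAt (𝓡 4) x x) := by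
    have h := hf.contMDiffAt.comp (extChartAt (𝓡 4) x x)
      ((contMDiffOn_extChartAt_symm (I := 𝓡 4) (n := ∞) x).contMDiffAt
      ((isOpen_extChartAt_target x).mem_nhds hx))
    exact h.contDiffAt
  have key := VectorField.fderiv_apply_lieBracket_of_isSymmSndFDerivAt
    (hC.of_le two_le_infty)
    (hC.isSymmSndFDerivAt (by simpa using two_le_infty))
    (hd V hV) (hd U hU)
  have h2 : ∀ Z W : Π x : X, TangentSpace (𝓡 4) x, DiffSectionAt R4 Z x →
      fderiv ℝ (fun y ↦ fderiv ℝ (fun z ↦ f ((extChartAt (𝓡 4) x).symm z)) y (P Z y))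
        (extChartAt (𝓡 4) x x) (P W (extChartAt (𝓡 4) x x))
        = mvfderiv (𝓡 4) (fun y ↦ mvfderiv (𝓡 4) f y (Z y)) x (W x) := fun Z W hZ ↦ by
    have : (fun y ↦ fderiv ℝ (fun z ↦ f ((extChartAt (𝓡 4) x).symm z)) y (P Z y))
        =ᶠ[𝓝 (extChartAt (𝓡 4) x x)]
        fun y ↦ mvfderiv (𝓡 4) f ((extChartAt (𝓡 4) x).symm y)
          (Z ((extChartAt (𝓡 4) x).symm y)) := by
      filter_upwards [(isOpen_extChartAt_target x).mem_nhds hx] with y hy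
      exact fderiv_chartCoords x hy (hf.contMDiffAt.mdifferentiableAt (by simp)) _
    have hm := mdifferentiableAt_mvfderiv hf hZ
    rw [← hsx] at hm
    rw [this.fderiv_eq]
    refine (fderiv_chartCoords x hx (g := fun y ↦ mvfderiv (𝓡 4) f y (Z y)) hm _).trans ?_
    rw [hsx]
  exact (congrArg (fun v ↦ mvfderiv (𝓡 4) f x v) hbr).trans
    ((mvfderiv_eq_fderiv_chart (hf.contMDiffAt.mdifferentiableAt (by simp)) _).trans
      (key.trans (congrArg₂ (· - ·) (h2 V U hV) (h2 U V hU))))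

end Charts

/-! ### Curvature of metric connections -/

section Curvature

variable {X : Type*} [TopologicalSpace X] [ChartedSpace R4 X] [IsManifold (𝓡 4) ∞ X]
  {F : Type*} [NormedAddCommGroup F] [NormedSpace ℝ F]
  {V : X → Type*} [TopologicalSpace (TotalSpace F V)]
  [∀ x, AddCommGroup (V x)] [∀ x, Module ℝ (V x)] [∀ x, TopologicalSpace (V x)]
  [∀ x, IsTopologicalAddGroup (V x)] [∀ x, ContinuousSMul ℝ (V x)]
  [FiberBundle F V] [VectorBundle ℝ F V]
  {cov : CovariantDerivative (𝓡 4) F V}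

variable (cov) in
/-- The expression `∇_U ∇_Y σ - ∇_Y ∇_U σ - ∇_[U, Y] σ` for vector fields `U`, `Y` and a section. -/
noncomputable def sectionCurvature (U Y : Π x : X, TangentSpace (𝓡 4) x) (σ : Π x, V x) (x : X) : V x :=
  cov (fun y ↦ cov σ y (Y y)) x (U x) - cov (fun y ↦ cov σ y (U y)) x (Y x)
    - cov σ x (VectorField.mlieBracket (𝓡 4) U Y x)

/-- The connection `cov` is compatible with a smooth nondegenerate family `B` of bilinear forms. This
covers Riemannian metrics as well as the real parts of Hermitian ones. -/
structure IsCompatibleWith (cov : CovariantDerivative (𝓡 4) F V)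
    (B : ∀ x, V x →ₗ[ℝ] V x →ₗ[ℝ] ℝ) : Prop where
  smooth : CovariantDerivative.ContMDiffCovariantDerivative cov ∞
  nondegenerate : ∀ x v, (∀ w, B x v w = 0) → v = 0
  smooth_form : ∀ σ τ : Π x, V x, SmoothSec F σ → SmoothSec F τ →
    ContMDiff (𝓡 4) 𝓘(ℝ, ℝ) ∞ (fun y ↦ B y (σ y) (τ y))
  metric : ∀ σ τ : Π x, V x, SmoothSec F σ → SmoothSec F τ → ∀ x (v : TangentSpace (𝓡 4) x),
    mvfderiv (𝓡 4) (fun y ↦ B y (σ y) (τ y)) x v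
      = B x (cov σ x v) (τ x) + B x (σ x) (cov τ x v)

variable {B : ∀ x, V x →ₗ[ℝ] V x →ₗ[ℝ] ℝ}

/-- The product rule applied twice to `U (Y (B(σ, τ)))`. -/
theorem IsCompatibleWith.second_derivative (h : IsCompatibleWith cov B) {σ τ : Π x, V x}
    (hσ : SmoothSec F σ) (hτ : SmoothSec F τ) {U Y : Π x : X, TangentSpace (𝓡 4) x}
    (hY : SmoothSec R4 Y) (x : X) :
    mvfderiv (𝓡 4) (fun y ↦ mvfderiv (𝓡 4) (fun z ↦ B z (σ z) (τ z)) y (Y y)) x (U x)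
      = (B x (cov (fun y ↦ cov σ y (Y y)) x (U x)) (τ x) + B x (cov σ x (Y x)) (cov τ x (U x)))
        + (B x (cov σ x (U x)) (cov τ x (Y x)) +
          B x (σ x) (cov (fun y ↦ cov τ y (Y y)) x (U x))) := by
  have h1 : (fun y ↦ mvfderiv (𝓡 4) (fun z ↦ B z (σ z) (τ z)) y (Y y))
      = (fun y ↦ B y (cov σ y (Y y)) (τ y)) + fun y ↦ B y (σ y) (cov τ y (Y y)) :=
    funext fun y ↦ h.metric σ τ hσ hτ y (Y y)
  have hσ' := hσ.covDeriv h.smooth hY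
  have hτ' := hτ.covDeriv h.smooth hY
  rw [h1, mvfderiv_add ((h.smooth_form _ _ hσ' hτ).contMDiffAt.mdifferentiableAt (by simp))
    ((h.smooth_form _ _ hσ hτ').contMDiffAt.mdifferentiableAt (by simp))]
  rw [_root_.add_apply, h.metric _ _ hσ' hτ, h.metric _ _ hσ hτ']

/-- The curvature of a metric connection is skew. -/
theorem IsCompatibleWith.sectionCurvature_skew (h : IsCompatibleWith cov B) {σ τ : Π x, V x}
    (hσ : SmoothSec F σ) (hτ : SmoothSec F τ) {U Y : Π x : X, TangentSpace (𝓡 4) x}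
    (hU : SmoothSec R4 U) (hY : SmoothSec R4 Y) (x : X) :
    B x (sectionCurvature cov U Y σ x) (τ x) = - B x (σ x) (sectionCurvature cov U Y τ x) := by
  have hbr := mvfderiv_mlieBracket (h.smooth_form σ τ hσ hτ) (hU x).diffSectionAt
    (hY x).diffSectionAt
  rw [h.second_derivative hσ hτ hY, h.second_derivative hσ hτ hU, h.metric σ τ hσ hτ] at hbr
  simp only [sectionCurvature, map_sub, LinearMap.sub_apply]
  linarith

variable [T2Space X] [ContMDiffVectorBundle ∞ F V (𝓡 4)] [FiniteDimensional ℝ F]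

/-- The value of the curvature depends only on the value of the section at the point: pair with
another section and move the curvature to it. -/
theorem IsCompatibleWith.sectionCurvature_congr (h : IsCompatibleWith cov B) {σ τ : Π x, V x}
    (hσ : SmoothSec F σ) (hτ : SmoothSec F τ) {U Y : Π x : X, TangentSpace (𝓡 4) x}
    (hU : SmoothSec R4 U) (hY : SmoothSec R4 Y) {x : X} (hx : σ x = τ x) :
    sectionCurvature cov U Y σ x = sectionCurvature cov U Y τ x := by
  refine sub_eq_zero.1 (h.nondegenerate x _ fun w ↦ ?_)
  obtain ⟨σ', hσ', rfl⟩ := exists_smoothSec_eq (F := F) w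
  rw [map_sub, LinearMap.sub_apply, h.sectionCurvature_skew hσ hσ' hU hY,
    h.sectionCurvature_skew hτ hσ' hU hY, hx, sub_self]

theorem tensorialAt_sectionCurvature_left
    (hcov : CovariantDerivative.ContMDiffCovariantDerivative cov ∞) {σ : Π x, V x}
    (hσ : SmoothSec F σ) (Y : Π x : X, TangentSpace (𝓡 4) x) (x : X) :
    TensorialAt (𝓡 4) R4 (fun U ↦ sectionCurvature cov U Y σ x) x := by
  have : IsManifold (𝓡 4) 2 X := IsManifold.of_le (n := ∞) two_le_infty
  constructor
  · intro f U hf hU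
    have hb := VectorField.mlieBracket_smul_left (W := Y) hf hU
    have hc := cov_smul (cov := cov) hf (DiffSectionAt.covDeriv hcov hσ hU) (Y x)
    simp only [sectionCurvature, hc, hb, map_add, map_smul, Pi.smul_apply']
    module
  · intro U U' hU hU'
    have hb := VectorField.mlieBracket_add_left (W := Y) hU hU'
    have hc := cov_add (cov := cov) (DiffSectionAt.covDeriv hcov hσ hU)
      (DiffSectionAt.covDeriv hcov hσ hU') (Y x)
    simp only [sectionCurvature, hc, hb, map_add, Pi.add_apply]
    module

theorem sectionCurvature_swap (U Y : Π x : X, TangentSpace (𝓡 4) x) (σ : Π x, V x) (x : X) :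
    sectionCurvature cov U Y σ x = - sectionCurvature cov Y U σ x := by
  simp only [sectionCurvature]
  rw [VectorField.mlieBracket_swap_apply, map_neg]
  abel

/-- The curvature tensor may be computed with any smooth extensions. -/
theorem IsCompatibleWith.curvatureAt_eq (h : IsCompatibleWith cov B) {σ : Π x, V x}
    (hσ : SmoothSec F σ) {U Y : Π x : X, TangentSpace (𝓡 4) x}
    (hU : SmoothSec R4 U) (hY : SmoothSec R4 Y) (x : X) :
    curvatureAt cov x (U x) (Y x) (σ x) = sectionCurvature cov U Y σ x := by
  have : IsManifold (𝓡 4) 2 X := IsManifold.of_le (n := ∞) two_le_infty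
  obtain ⟨τ, hτ, hτe, hτx⟩ := exists_smoothSec_extend (F := F) (σ x)
  rw [h.sectionCurvature_congr hσ hτ hU hY hτx.symm]
  have hD : ∀ w : TangentSpace (𝓡 4) x, DiffSectionAt R4 (FiberBundle.extend R4 w) x :=
    fun w ↦ FiberBundle.mdifferentiableAt_extend (𝓡 4) R4 w
  have h1 : sectionCurvature cov U Y τ x
      = sectionCurvature cov (FiberBundle.extend R4 (U x)) Y τ x :=
    (tensorialAt_sectionCurvature_left h.smooth hτ Y x).pointwise (hU x).diffSectionAt (hD _)
      (by simp)
  have h2 : sectionCurvature cov Y (FiberBundle.extend R4 (U x)) τ x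
      = sectionCurvature cov (FiberBundle.extend R4 (Y x)) (FiberBundle.extend R4 (U x)) τ x :=
    (tensorialAt_sectionCurvature_left h.smooth hτ _ x).pointwise (hY x).diffSectionAt (hD _)
      (by simp)
  rw [h1, sectionCurvature_swap, h2, ← sectionCurvature_swap]
  have hext : ∀ᶠ y in 𝓝 x, DiffSectionAt F (FiberBundle.extend F (σ x)) y := by
    obtain ⟨s, hs, hs'⟩ := FiberBundle.exists_contMDiffOn_extend (k := ∞) (𝓡 4) F (σ x)
    filter_upwards [eventually_mem_nhds_iff.2 hs] with y hy
    exact (hs'.contMDiffAt hy).mdifferentiableAt (by simp)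
  have hc : ∀ᶠ y in 𝓝 x, cov (FiberBundle.extend F (σ x)) y = cov τ y := by
    filter_upwards [hext, hτe.eventually_nhds] with y hy hy'
    exact cov_congr hy (hτ y).diffSectionAt (hy'.mono fun z hz ↦ hz.symm)
  have key : ∀ w : TangentSpace (𝓡 4) x,
      cov (fun y ↦ cov (FiberBundle.extend F (σ x)) y (FiberBundle.extend R4 w y)) x
        = cov (fun y ↦ cov τ y (FiberBundle.extend R4 w y)) x := fun w ↦ by
    have h3 := DiffSectionAt.covDeriv h.smooth hτ (hD w)
    have he : ∀ᶠ y in 𝓝 x, cov (FiberBundle.extend F (σ x)) y (FiberBundle.extend R4 w y)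
        = cov τ y (FiberBundle.extend R4 w y) := hc.mono fun y hy ↦ by rw [hy]
    refine cov_congr (h3.congr_of_eventuallyEq ?_) h3 he
    exact he.mono fun y hy ↦ congrArg (TotalSpace.mk' F y) hy
  simp only [curvatureAt, sectionCurvature, key, hc.self_of_nhds, FiberBundle.extend_apply_self]

theorem IsCompatibleWith.curvatureAt_swap (h : IsCompatibleWith cov B) (x : X)
    (u v : TangentSpace (𝓡 4) x) (w : V x) :
    curvatureAt cov x u v w = - curvatureAt cov x v u w := by
  obtain ⟨σ, hσ, rfl⟩ := exists_smoothSec_eq (F := F) w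
  obtain ⟨U, hU, rfl⟩ := exists_smoothSec_eq (F := R4) u
  obtain ⟨Y, hY, rfl⟩ := exists_smoothSec_eq (F := R4) v
  rw [h.curvatureAt_eq hσ hU hY, h.curvatureAt_eq hσ hY hU, sectionCurvature_swap]

theorem IsCompatibleWith.curvatureAt_skew (h : IsCompatibleWith cov B) (x : X)
    (u v : TangentSpace (𝓡 4) x) (w w' : V x) :
    B x (curvatureAt cov x u v w) w' = - B x w (curvatureAt cov x u v w') := by
  obtain ⟨σ, hσ, rfl⟩ := exists_smoothSec_eq (F := F) w
  obtain ⟨τ, hτ, rfl⟩ := exists_smoothSec_eq (F := F) w'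
  obtain ⟨U, hU, rfl⟩ := exists_smoothSec_eq (F := R4) u
  obtain ⟨Y, hY, rfl⟩ := exists_smoothSec_eq (F := R4) v
  rw [h.curvatureAt_eq hσ hU hY, h.curvatureAt_eq hτ hU hY, h.sectionCurvature_skew hσ hτ hU hY]

/-- The curvature tensor of a metric connection as a multilinear map. -/
noncomputable def IsCompatibleWith.curvature (h : IsCompatibleWith cov B) (x : X) :
    TangentSpace (𝓡 4) x →ₗ[ℝ] TangentSpace (𝓡 4) x →ₗ[ℝ] V x →ₗ[ℝ] V x := by
  have : IsManifold (𝓡 4) 2 X := IsManifold.of_le (n := ∞) two_le_infty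
  have add_left : ∀ (u u' v : TangentSpace (𝓡 4) x) (w : V x),
      curvatureAt cov x (u + u') v w = curvatureAt cov x u v w + curvatureAt cov x u' v w := by
    intro u u' v w
    obtain ⟨σ, hσ, rfl⟩ := exists_smoothSec_eq (F := F) w
    obtain ⟨U, hU, rfl⟩ := exists_smoothSec_eq (F := R4) u
    obtain ⟨U', hU', rfl⟩ := exists_smoothSec_eq (F := R4) u'
    obtain ⟨Y, hY, rfl⟩ := exists_smoothSec_eq (F := R4) v
    rw [h.curvatureAt_eq hσ hU hY, h.curvatureAt_eq hσ hU' hY,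
      ← (tensorialAt_sectionCurvature_left h.smooth hσ Y x).add (hU x).diffSectionAt
        (hU' x).diffSectionAt]
    exact h.curvatureAt_eq hσ (hU.add hU') hY x
  have smul_left : ∀ (c : ℝ) (u v : TangentSpace (𝓡 4) x) (w : V x),
      curvatureAt cov x (c • u) v w = c • curvatureAt cov x u v w := by
    intro c u v w
    obtain ⟨σ, hσ, rfl⟩ := exists_smoothSec_eq (F := F) w
    obtain ⟨U, hU, rfl⟩ := exists_smoothSec_eq (F := R4) u
    obtain ⟨Y, hY, rfl⟩ := exists_smoothSec_eq (F := R4) v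
    rw [h.curvatureAt_eq hσ hU hY]
    refine Eq.trans ?_ ((tensorialAt_sectionCurvature_left h.smooth hσ Y x).smul
      (f := fun _ ↦ c) mdifferentiableAt_const (hU x).diffSectionAt)
    exact h.curvatureAt_eq hσ (SmoothSec.smul (f := fun _ ↦ c) contMDiff_const hU) hY x
  have add_sec : ∀ (u v : TangentSpace (𝓡 4) x) (w w' : V x),
      curvatureAt cov x u v (w + w') = curvatureAt cov x u v w + curvatureAt cov x u v w' := by
    intro u v w w'
    refine sub_eq_zero.1 (h.nondegenerate x _ fun z ↦ ?_)
    simp only [map_sub, map_add, LinearMap.sub_apply, LinearMap.add_apply, h.curvatureAt_skew]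
    ring
  have smul_sec : ∀ (u v : TangentSpace (𝓡 4) x) (c : ℝ) (w : V x),
      curvatureAt cov x u v (c • w) = c • curvatureAt cov x u v w := by
    intro u v c w
    refine sub_eq_zero.1 (h.nondegenerate x _ fun z ↦ ?_)
    simp only [map_sub, map_smul, LinearMap.sub_apply, LinearMap.smul_apply, h.curvatureAt_skew,
      smul_eq_mul]
    ring
  exact LinearMap.mk₂ ℝ
    (fun u v ↦ ({ toFun := curvatureAt cov x u v
                  map_add' := add_sec u v
                  map_smul' := smul_sec u v } : V x →ₗ[ℝ] V x))
    (fun u u' v ↦ LinearMap.ext fun w ↦ add_left u u' v w)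
    (fun c u v ↦ LinearMap.ext fun w ↦ smul_left c u v w)
    (fun u v v' ↦ LinearMap.ext fun w ↦ by
      change curvatureAt cov x u (v + v') w = curvatureAt cov x u v w + curvatureAt cov x u v' w
      rw [h.curvatureAt_swap, add_left, h.curvatureAt_swap x u v, h.curvatureAt_swap x u v']
      abel)
    (fun c u v ↦ LinearMap.ext fun w ↦ by
      change curvatureAt cov x u (c • v) w = c • curvatureAt cov x u v w
      rw [h.curvatureAt_swap, smul_left, h.curvatureAt_swap x u v, smul_neg])

end Curvature

/-! ### The Levi-Civita connection and the Hessian -/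

section LeviCivita

variable {X : Type*} [TopologicalSpace X] [ChartedSpace R4 X] [IsManifold (𝓡 4) ∞ X]
  [RiemannianBundle (fun x : X ↦ TangentSpace (𝓡 4) x)]
  [IsContMDiffRiemannianBundle (𝓡 4) ∞ R4 (fun x : X ↦ TangentSpace (𝓡 4) x)]
  {cov : CovariantDerivative (𝓡 4) R4 (fun x : X ↦ TangentSpace (𝓡 4) x)}

theorem SmoothSec.contMDiff_inner {U Y : Π x : X, TangentSpace (𝓡 4) x} (hU : SmoothSec R4 U)
    (hY : SmoothSec R4 Y) : ContMDiff (𝓡 4) 𝓘(ℝ, ℝ) ∞ (fun y ↦ inner ℝ (U y) (Y y)) :=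
  ContMDiff.inner_bundle hU hY

theorem IsLeviCivita.isCompatibleWith (h : IsLeviCivita cov) :
    IsCompatibleWith cov (fun x : X ↦ innerₗ (TangentSpace (𝓡 4) x)) where
  smooth := h.smooth
  nondegenerate x v hv := inner_self_eq_zero.1 (hv v)
  smooth_form _ _ hσ hτ := hσ.contMDiff_inner hτ
  metric σ τ hσ hτ x v := by
    have := IsContMDiffRiemannianBundle.of_le (n := ∞) (n' := 1) (IB := 𝓡 4) (F := R4)
      (E := fun x : X ↦ TangentSpace (𝓡 4) x) (by simp)
    have := h.metric.mvfderiv_inner_eq (FiberBundle.extend R4 v) (hσ x).diffSectionAt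
      (hτ x).diffSectionAt
    simpa using this

theorem IsLeviCivita.mlieBracket_eq (h : IsLeviCivita cov) {U Y : Π x : X, TangentSpace (𝓡 4) x}
    {x : X} (hU : DiffSectionAt R4 U x) (hY : DiffSectionAt R4 Y x) :
    VectorField.mlieBracket (𝓡 4) U Y x = cov Y x (U x) - cov U x (Y x) := by
  have : IsManifold (𝓡 4) 2 X := IsManifold.of_le (n := ∞) two_le_infty
  exact ((CovariantDerivative.torsion_eq_zero_iff cov).1 h.torsionFree hU hY).symm

theorem IsLeviCivita.smooth_mlieBracket (h : IsLeviCivita cov)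
    {U Y : Π x : X, TangentSpace (𝓡 4) x} (hU : SmoothSec R4 U) (hY : SmoothSec R4 Y) :
    SmoothSec R4 (VectorField.mlieBracket (𝓡 4) U Y) := by
  have e : VectorField.mlieBracket (𝓡 4) U Y = fun x ↦ cov Y x (U x) - cov U x (Y x) :=
    funext fun x ↦ h.mlieBracket_eq (hU x).diffSectionAt (hY x).diffSectionAt
  rw [e]
  exact (hY.covDeriv h.smooth hU).sub (hU.covDeriv h.smooth hY)

/-- The first Bianchi identity: for a torsion-free connection it is the Jacobi identity for brackets. -/
theorem IsLeviCivita.bianchi_sectionCurvature (h : IsLeviCivita cov)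
    {U Y Z : Π x : X, TangentSpace (𝓡 4) x} (hU : SmoothSec R4 U) (hY : SmoothSec R4 Y)
    (hZ : SmoothSec R4 Z) (x : X) :
    sectionCurvature cov U Y Z x + sectionCurvature cov Y Z U x + sectionCurvature cov Z U Y x
      = 0 := by
  have i3 : IsManifold (𝓡 4) (minSmoothness ℝ 3) X := by
    simp only [minSmoothness_of_isRCLikeNormedField]
    exact IsManifold.of_le (n := ∞) (WithTop.coe_le_coe.2 (le_top : (3 : ℕ∞) ≤ ⊤))
  have hs : ∀ {W : Π x : X, TangentSpace (𝓡 4) x}, SmoothSec R4 W →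
      ContMDiff (𝓡 4) (𝓡 4).tangent (minSmoothness ℝ 2) fun x ↦ TotalSpace.mk' R4 x (W x) := by
    intro W hW
    have : minSmoothness ℝ 2 ≤ ∞ := by simpa using two_le_infty
    exact ContMDiff.of_le (n := ∞) hW this
  have jac := congrFun (VectorField.leibniz_identity_mlieBracket (hs hU) (hs hY) (hs hZ)) x
  -- `∇_U (∇_Y Z - ∇_Z Y) - ∇_[Y, Z] U = [U, [Y, Z]]`
  have key : ∀ {A C D : Π x : X, TangentSpace (𝓡 4) x}, SmoothSec R4 A → SmoothSec R4 C →
      SmoothSec R4 D →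
      VectorField.mlieBracket (𝓡 4) A (VectorField.mlieBracket (𝓡 4) C D) x
        = cov (fun y ↦ cov D y (C y)) x (A x) - cov (fun y ↦ cov C y (D y)) x (A x)
          - cov A x (VectorField.mlieBracket (𝓡 4) C D x) := by
    intro A C D hA hC hD
    have e : VectorField.mlieBracket (𝓡 4) C D = fun x ↦ cov D x (C x) - cov C x (D x) :=
      funext fun x ↦ h.mlieBracket_eq (hC x).diffSectionAt (hD x).diffSectionAt
    rw [h.mlieBracket_eq (hA x).diffSectionAt (h.smooth_mlieBracket hC hD x).diffSectionAt]
    congr 1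
    rw [e]
    exact cov_sub (hD.covDeriv h.smooth hC x).diffSectionAt
      (hC.covDeriv h.smooth hD x).diffSectionAt (A x)
  rw [Pi.add_apply, VectorField.mlieBracket_swap_apply (V := VectorField.mlieBracket (𝓡 4) U Y),
    key hU hY hZ, key hZ hU hY, key hY hU hZ] at jac
  have hsw := congrArg (cov Y x)
    (VectorField.mlieBracket_swap_apply (I := 𝓡 4) (V := Z) (W := U) (x := x))
  rw [map_neg] at hsw
  simp only [sectionCurvature]
  rw [hsw]
  rw [← sub_eq_zero] at jac
  rw [← jac]
  abel

section Hessian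

variable [T2Space X] {f : X → ℝ}

theorem tensorialAt_hessian (hf : ContMDiff (𝓡 4) 𝓘(ℝ, ℝ) ∞ f) (x : X)
    (u : TangentSpace (𝓡 4) x) :
    TensorialAt (𝓡 4) R4 (fun Y ↦ mvfderiv (𝓡 4) (fun y ↦ mvfderiv (𝓡 4) f y (Y y)) x u
      - mvfderiv (𝓡 4) f x (cov Y x u)) x := by
  constructor
  · intro g Y hg hY
    have h1 : (fun y ↦ mvfderiv (𝓡 4) f y ((g • Y) y))
        = g * fun y ↦ mvfderiv (𝓡 4) f y (Y y) := funext fun y ↦ map_smul (mvfderiv (𝓡 4) f y) (g y) (Y y)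
    have h2 := cov_smul (cov := cov) hg hY u
    change mvfderiv (𝓡 4) (fun y ↦ mvfderiv (𝓡 4) f y ((g • Y) y)) x u
      - mvfderiv (𝓡 4) f x (cov (fun y ↦ g y • Y y) x u) = _
    rw [h1, h2, mvfderiv_mul hg (mdifferentiableAt_mvfderiv hf hY)]
    simp
    ring
  · intro Y Y' hY hY'
    have h1 : (fun y ↦ mvfderiv (𝓡 4) f y ((Y + Y') y))
        = (fun y ↦ mvfderiv (𝓡 4) f y (Y y)) + fun y ↦ mvfderiv (𝓡 4) f y (Y' y) :=
      funext fun y ↦ map_add _ _ _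
    have h2 := cov_add (cov := cov) hY hY' u
    change mvfderiv (𝓡 4) (fun y ↦ mvfderiv (𝓡 4) f y ((Y + Y') y)) x u
      - mvfderiv (𝓡 4) f x (cov (fun y ↦ Y y + Y' y) x u) = _
    rw [h1, h2, mvfderiv_add (mdifferentiableAt_mvfderiv hf hY) (mdifferentiableAt_mvfderiv hf hY')]
    simp
    ring

/-- The Hessian may be computed with any differentiable extension of the second vector. -/
theorem hessianAt_eq (hf : ContMDiff (𝓡 4) 𝓘(ℝ, ℝ) ∞ f) {Y : Π x : X, TangentSpace (𝓡 4) x}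
    {x : X} (hY : DiffSectionAt R4 Y x) (u : TangentSpace (𝓡 4) x) :
    hessianAt cov f x u (Y x) = mvfderiv (𝓡 4) (fun y ↦ mvfderiv (𝓡 4) f y (Y y)) x u
      - mvfderiv (𝓡 4) f x (cov Y x u) := by
  have : IsManifold (𝓡 4) 2 X := IsManifold.of_le (n := ∞) two_le_infty
  exact (tensorialAt_hessian (cov := cov) hf x u).pointwise
    (FiberBundle.mdifferentiableAt_extend (𝓡 4) R4 (Y x)) hY (by simp)

/-- The Hessian of a composition `g ∘ f`. -/
theorem hessianAt_comp (hf : ContMDiff (𝓡 4) 𝓘(ℝ, ℝ) ∞ f) {g g' : ℝ → ℝ} {g'' : ℝ} {x : X}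
    (hg : ∀ᶠ t in 𝓝 (f x), HasDerivAt g (g' t) t) (hg' : HasDerivAt g' g'' (f x))
    (u v : TangentSpace (𝓡 4) x) :
    hessianAt cov (fun y ↦ g (f y)) x u v = g' (f x) * hessianAt cov f x u v
      + g'' * (mvfderiv (𝓡 4) f x u * mvfderiv (𝓡 4) f x v) := by
  have chain : ∀ {p : ℝ → ℝ} {p' : ℝ} {y : X}, HasDerivAt p p' (f y) → ∀ w,
      mvfderiv (𝓡 4) (fun z ↦ p (f z)) y w = p' * mvfderiv (𝓡 4) f y w := by
    intro p p' y hp w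
    have h1 := (hp.hasFDerivAt.hasMFDerivAt.comp y
      (hf.contMDiffAt (x := y) |>.mdifferentiableAt (by simp)).hasMFDerivAt).mfderiv
    have h2 := congrArg (fun L ↦ L w) h1
    refine h2.trans ?_
    change mvfderiv (𝓡 4) f y w • p' = _
    rw [smul_eq_mul, mul_comm]
  have hev : ∀ᶠ y in 𝓝 x, HasDerivAt g (g' (f y)) (f y) :=
    (hf.continuous.continuousAt (x := x)).eventually hg
  have e1 : (fun y ↦ mvfderiv (𝓡 4) (fun z ↦ g (f z)) y (FiberBundle.extend R4 v y)) =ᶠ[𝓝 x]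
      (fun y ↦ g' (f y)) * fun y ↦ mvfderiv (𝓡 4) f y (FiberBundle.extend R4 v y) := by
    filter_upwards [hev] with y hy
    exact chain hy _
  have hm : MDifferentiableAt (𝓡 4) 𝓘(ℝ, ℝ) (fun y ↦ g' (f y)) x :=
    hg'.differentiableAt.comp_mdifferentiableAt (hf.contMDiffAt.mdifferentiableAt (by simp))
  have : IsManifold (𝓡 4) 2 X := IsManifold.of_le (n := ∞) two_le_infty
  simp only [hessianAt]
  rw [mvfderiv_congr e1, mvfderiv_mul hm (mdifferentiableAt_mvfderiv hf
    (FiberBundle.mdifferentiableAt_extend (𝓡 4) R4 v)), chain hev.self_of_nhds]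
  simp [chain hg']
  ring

end Hessian

end LeviCivita

/-! ### Unitary connections on Hermitian bundles -/

section Hermitian

variable {X : Type*} [TopologicalSpace X] [ChartedSpace R4 X] [IsManifold (𝓡 4) ∞ X]
  {F : Type*} [NormedAddCommGroup F] [NormedSpace ℂ F]
  {V : X → Type*} [∀ x, NormedAddCommGroup (V x)] [∀ x, InnerProductSpace ℂ (V x)]
  [TopologicalSpace (TotalSpace F V)] [FiberBundle F V]

/-- The real part of the Hermitian metric, as a real bilinear form. -/
noncomputable def reInner (E : Type*) [NormedAddCommGroup E] [InnerProductSpace ℂ E] :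
    E →ₗ[ℝ] E →ₗ[ℝ] ℝ :=
  LinearMap.mk₂ ℝ (fun a b ↦ (inner ℂ a b).re)
    (fun a b c ↦ by simp)
    (fun r a b ↦ by
      rw [← Complex.coe_smul, inner_smul_left]; simp)
    (fun a b c ↦ by simp)
    (fun r a b ↦ by
      rw [← Complex.coe_smul, inner_smul_right]; simp)

theorem reInner_apply {E : Type*} [NormedAddCommGroup E] [InnerProductSpace ℂ E] (a b : E) :
    reInner E a b = (inner ℂ a b).re := rfl

theorem SmoothSec.contMDiff_hermitian [IsSmoothHermitianBundle F V] {σ τ : Π x, V x}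
    (hσ : SmoothSec F σ) (hτ : SmoothSec F τ) :
    ContMDiff (𝓡 4) 𝓘(ℝ, ℂ) ∞ (fun y ↦ inner ℂ (σ y) (τ y)) := fun x ↦
  IsSmoothHermitianBundle.smooth_inner σ τ x (hσ x) (hτ x)

theorem contMDiff_re {f : X → ℂ} (hf : ContMDiff (𝓡 4) 𝓘(ℝ, ℂ) ∞ f) :
    ContMDiff (𝓡 4) 𝓘(ℝ, ℝ) ∞ (fun y ↦ (f y).re) :=
  Complex.reCLM.contMDiff.comp hf

theorem mvfderiv_re {f : X → ℂ} {x : X} (hf : MDifferentiableAt (𝓡 4) 𝓘(ℝ, ℂ) f x)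
    (v : TangentSpace (𝓡 4) x) :
    mvfderiv (𝓡 4) (fun y ↦ (f y).re) x v = (mvfderiv (𝓡 4) f x v).re := by
  have h := (Complex.reCLM.hasMFDerivAt (x := f x)).comp x hf.hasMFDerivAt
  exact congrArg (fun L ↦ L v) h.mfderiv

theorem IsUnitaryConnection.isCompatibleWith [VectorBundle ℝ F V] [IsSmoothHermitianBundle F V]
    {cov : CovariantDerivative (𝓡 4) F V} (h : IsUnitaryConnection cov) :
    IsCompatibleWith cov (fun x ↦ reInner (V x)) where
  smooth := h.smooth
  nondegenerate x v hv := by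
    have := hv v
    rw [reInner_apply] at this
    have h2 : ‖v‖ ^ 2 = 0 := (inner_self_eq_norm_sq (𝕜 := ℂ) v).symm.trans this
    simpa using h2
  smooth_form σ τ hσ hτ := contMDiff_re (hσ.contMDiff_hermitian hτ)
  metric σ τ hσ hτ x v := by
    simp only [reInner_apply]
    rw [mvfderiv_re ((hσ.contMDiff_hermitian hτ).contMDiffAt.mdifferentiableAt (by simp)),
      h.metric σ τ x (hσ x).diffSectionAt (hτ x).diffSectionAt, Complex.add_re]

theorem SmoothSectionAt.I_smul [VectorBundle ℂ F V] {σ : Π x, V x} {x : X}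
    (hσ : SmoothSectionAt F σ x) : SmoothSectionAt F (fun y ↦ Complex.I • σ y) x := by
  have h := (contMDiffAt_section x).1 hσ
  refine (contMDiffAt_section x).2 ?_
  have h1 : ContMDiffAt (𝓡 4) 𝓘(ℝ, F) ∞
      (fun y ↦ Complex.I • ((trivializationAt F V x) ⟨y, σ y⟩).2) x :=
    (((Complex.I • ContinuousLinearMap.id ℂ F).restrictScalars ℝ).contMDiff).contMDiffAt.comp x h
  refine h1.congr_of_eventuallyEq ?_
  filter_upwards [(trivializationAt F V x).open_baseSet.mem_nhds
    (FiberBundle.mem_baseSet_trivializationAt' x)] with y hy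
  exact ((trivializationAt F V x).linear ℂ hy).map_smul Complex.I (σ y)

theorem SmoothSec.I_smul [VectorBundle ℂ F V] {σ : Π x, V x} (hσ : SmoothSec F σ) :
    SmoothSec F (fun y ↦ Complex.I • σ y) := fun x ↦ SmoothSectionAt.I_smul (hσ x)

variable [T2Space X] [VectorBundle ℂ F V] [VectorBundle ℝ F V] [ContMDiffVectorBundle ∞ F V (𝓡 4)]
  [IsSmoothHermitianBundle F V] [FiniteDimensional ℂ F] {cov : CovariantDerivative (𝓡 4) F V}

/-- The curvature of a unitary connection is complex linear. -/
theorem IsUnitaryConnection.curvatureAt_I_smul (h : IsUnitaryConnection cov) (x : X)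
    (u v : TangentSpace (𝓡 4) x) (w : V x) :
    curvatureAt cov x u v (Complex.I • w) = Complex.I • curvatureAt cov x u v w := by
  obtain ⟨σ, hσ, rfl⟩ := exists_smoothSec_eq (F := F) w
  obtain ⟨U, hU, rfl⟩ := exists_smoothSec_eq (F := R4) u
  obtain ⟨Y, hY, rfl⟩ := exists_smoothSec_eq (F := R4) v
  rw [h.isCompatibleWith.curvatureAt_eq hσ hU hY]
  refine (h.isCompatibleWith.curvatureAt_eq hσ.I_smul hU hY x).trans ?_
  have e : ∀ Z : Π x : X, TangentSpace (𝓡 4) x, (fun y ↦ cov (fun z ↦ Complex.I • σ z) y (Z y))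
      = fun y ↦ Complex.I • cov σ y (Z y) :=
    fun Z ↦ funext fun y ↦ h.complexLinear σ y (hσ y).diffSectionAt (Z y)
  simp only [sectionCurvature, e]
  rw [h.complexLinear _ x (hσ.covDeriv h.smooth hY x).diffSectionAt,
    h.complexLinear _ x (hσ.covDeriv h.smooth hU x).diffSectionAt,
    h.complexLinear _ x (hσ x).diffSectionAt, smul_sub, smul_sub]

/-- The curvature endomorphism `F(u, v)` of a unitary connection. -/
noncomputable def IsUnitaryConnection.curvatureEnd (h : IsUnitaryConnection cov) (x : X)
    (u v : TangentSpace (𝓡 4) x) : V x →ₗ[ℂ] V x where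
  toFun := curvatureAt cov x u v
  map_add' w w' := map_add (h.isCompatibleWith.curvature x u v) w w'
  map_smul' c w := by
    have hr : ∀ (r : ℝ) (z : V x), curvatureAt cov x u v ((r : ℂ) • z)
        = (r : ℂ) • curvatureAt cov x u v z :=
      fun r z ↦ map_smul (h.isCompatibleWith.curvature x u v) r z
    have ha : ∀ z z' : V x, curvatureAt cov x u v (z + z')
        = curvatureAt cov x u v z + curvatureAt cov x u v z' :=
      fun z z' ↦ map_add (h.isCompatibleWith.curvature x u v) z z'
    conv_lhs => rw [← Complex.re_add_im c, add_smul, mul_smul, ha, hr, hr, h.curvatureAt_I_smul]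
    rw [← mul_smul, ← add_smul, Complex.re_add_im, RingHom.id_apply]

theorem IsUnitaryConnection.curvatureEnd_apply (h : IsUnitaryConnection cov) (x : X)
    (u v : TangentSpace (𝓡 4) x) (w : V x) :
    h.curvatureEnd x u v w = curvatureAt cov x u v w := rfl

end Hermitian

/-! ### Smooth orthonormal frames -/

section OrthonormalFrames

variable {X : Type*} [TopologicalSpace X] [ChartedSpace R4 X]
  {F : Type*} [NormedAddCommGroup F] [NormedSpace ℝ F]
  {𝕜 : Type*} [RCLike 𝕜]
  {V : X → Type*} [∀ x, NormedAddCommGroup (V x)] [∀ x, InnerProductSpace 𝕜 (V x)]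
  [∀ x, Module ℝ (V x)] [TopologicalSpace (TotalSpace F V)] [FiberBundle F V] [VectorBundle ℝ F V]
  {ι : Type*} [LinearOrder ι] [LocallyFiniteOrderBot ι] [WellFoundedLT ι]

open InnerProductSpace in
/-- The Gram-Schmidt process preserves smoothness, and it is nondegenerate near a point where the
sections are orthonormal. -/
theorem eventually_smooth_gramSchmidt {x : X}
    (hinner : ∀ (σ τ : Π x, V x) (y : X), SmoothSectionAt F σ y → SmoothSectionAt F τ y →
      ContMDiffAt (𝓡 4) 𝓘(ℝ, 𝕜) ∞ (fun z ↦ inner 𝕜 (σ z) (τ z)) y)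
    (hsmul : ∀ (f : X → 𝕜) (σ : Π x, V x) (y : X), ContMDiffAt (𝓡 4) 𝓘(ℝ, 𝕜) ∞ f y →
      SmoothSectionAt F σ y → SmoothSectionAt F (fun z ↦ f z • σ z) y)
    {s : ι → Π x, V x} (hs : ∀ i, SmoothSec F (s i)) (hx : Orthonormal 𝕜 fun i ↦ s i x) (i : ι) :
    ∀ᶠ y in 𝓝 x, SmoothSectionAt F (fun z ↦ gramSchmidt 𝕜 (fun j ↦ s j z) i) y ∧
      gramSchmidt 𝕜 (fun j ↦ s j y) i ≠ 0 := by
  induction i using WellFoundedLT.induction with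
  | ind i ih =>
    have h1 : ∀ᶠ y in 𝓝 x, ∀ j ∈ Finset.Iio i,
        SmoothSectionAt F (fun z ↦ gramSchmidt 𝕜 (fun j ↦ s j z) j) y ∧
        gramSchmidt 𝕜 (fun j ↦ s j y) j ≠ 0 :=
      (Filter.eventually_all_finset _).2 fun j hj ↦ ih j (Finset.mem_Iio.1 hj)
    have h2 : ∀ᶠ y in 𝓝 x, SmoothSectionAt F (fun z ↦ gramSchmidt 𝕜 (fun j ↦ s j z) i) y := by
      filter_upwards [h1] with y hy
      have e : (fun z ↦ gramSchmidt 𝕜 (fun j ↦ s j z) i) = fun z ↦ s i z -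
          ∑ j ∈ Finset.Iio i, (inner 𝕜 (gramSchmidt 𝕜 (fun j ↦ s j z) j) (s i z) *
            (inner 𝕜 (gramSchmidt 𝕜 (fun j ↦ s j z) j) (gramSchmidt 𝕜 (fun j ↦ s j z) j))⁻¹) •
            gramSchmidt 𝕜 (fun j ↦ s j z) j := by
        funext z
        rw [gramSchmidt_def]
        congr 1
        refine Finset.sum_congr rfl fun j _ ↦ ?_
        rw [Submodule.starProjection_singleton, inner_self_eq_norm_sq_to_K, div_eq_mul_inv]
        norm_cast
      rw [e]
      refine ContMDiffAt.sub_section (hs i y) (ContMDiffAt.sum_section fun j hj ↦ ?_)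
      obtain ⟨hj1, hj2⟩ := hy j hj
      refine hsmul _ _ y ?_ hj1
      have hi := hinner _ _ y hj1 hj1
      have hi' : ContMDiffAt (𝓡 4) 𝓘(ℝ, 𝕜) ∞ (fun z ↦ (inner 𝕜 (gramSchmidt 𝕜 (fun j ↦ s j z) j)
          (gramSchmidt 𝕜 (fun j ↦ s j z) j))⁻¹) y :=
        ((contDiffAt_inv ℝ (inner_self_ne_zero.2 hj2)).contMDiffAt (n := ∞)).comp y hi
      have hm : ContDiff ℝ ∞ (fun p : 𝕜 × 𝕜 ↦ p.1 * p.2) := contDiff_mul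
      exact hm.contMDiff.contMDiffAt.comp y ((hinner _ _ y hj1 (hs i y)).prodMk_space hi')
    have h3 : gramSchmidt 𝕜 (fun j ↦ s j x) i ≠ 0 := gramSchmidt_ne_zero i hx.linearIndependent
    have h4 : ∀ᶠ y in 𝓝 x, inner 𝕜 (gramSchmidt 𝕜 (fun j ↦ s j y) i)
        (gramSchmidt 𝕜 (fun j ↦ s j y) i) ≠ 0 :=
      (hinner _ _ x h2.self_of_nhds h2.self_of_nhds).continuousAt.eventually_ne
        (inner_self_ne_zero.2 h3)
    filter_upwards [h2, h4] with y hy hy'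
    exact ⟨hy, inner_self_ne_zero.1 hy'⟩

variable [T2Space X] [IsManifold (𝓡 4) ∞ X] [ContMDiffVectorBundle ∞ F V (𝓡 4)] [Finite ι]

open InnerProductSpace in
/-- Every orthonormal family of vectors at a point extends to smooth sections that are orthonormal near
the point. -/
theorem exists_orthonormal_smoothSec {x : X}
    (hinner : ∀ (σ τ : Π x, V x) (y : X), SmoothSectionAt F σ y → SmoothSectionAt F τ y →
      ContMDiffAt (𝓡 4) 𝓘(ℝ, 𝕜) ∞ (fun z ↦ inner 𝕜 (σ z) (τ z)) y)
    (hsmul : ∀ (f : X → 𝕜) (σ : Π x, V x) (y : X), ContMDiffAt (𝓡 4) 𝓘(ℝ, 𝕜) ∞ f y →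
      SmoothSectionAt F σ y → SmoothSectionAt F (fun z ↦ f z • σ z) y)
    {b : ι → V x} (hb : Orthonormal 𝕜 b) :
    ∃ e : ι → Π x, V x, (∀ i, SmoothSec F (e i)) ∧ (∀ᶠ y in 𝓝 x, Orthonormal 𝕜 fun i ↦ e i y) ∧
      ∀ i, e i x = b i := by
  choose s hs hsx using fun i ↦ exists_smoothSec_eq (F := F) (b i)
  have hx : Orthonormal 𝕜 fun i ↦ s i x := by simpa only [hsx] using hb
  have h := eventually_smooth_gramSchmidt hinner hsmul hs hx
  have hn : ∀ i, ∀ᶠ y in 𝓝 x,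
      SmoothSectionAt F (fun z ↦ gramSchmidtNormed 𝕜 (fun j ↦ s j z) i) y := fun i ↦ by
    filter_upwards [h i] with y hy
    refine hsmul _ _ y ?_ hy.1
    have h1 := hinner _ _ y hy.1 hy.1
    have h2 : ContMDiffAt (𝓡 4) 𝓘(ℝ, ℝ) ∞ (fun z ↦ ‖gramSchmidt 𝕜 (fun j ↦ s j z) i‖ ^ 2) y := by
      have h3 := (RCLike.reCLM (K := 𝕜)).contMDiff (n := ∞) |>.contMDiffAt.comp y h1
      refine h3.congr_of_eventuallyEq (Filter.Eventually.of_forall fun z ↦ ?_)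
      exact (inner_self_eq_norm_sq (𝕜 := 𝕜) _).symm
    have h0 : ‖gramSchmidt 𝕜 (fun j ↦ s j y) i‖ ^ 2 ≠ 0 := by
      simpa using hy.2
    have h4 : ContMDiffAt (𝓡 4) 𝓘(ℝ, ℝ) ∞
        (fun z ↦ (√(‖gramSchmidt 𝕜 (fun j ↦ s j z) i‖ ^ 2))⁻¹) y := by
      have hc : ContDiffAt ℝ ∞ (fun t : ℝ ↦ (√t)⁻¹) (‖gramSchmidt 𝕜 (fun j ↦ s j y) i‖ ^ 2) :=
        (Real.contDiffAt_sqrt h0).inv (by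
          rw [Real.sqrt_ne_zero']
          positivity)
      exact ContMDiffAt.comp (g := fun t : ℝ ↦ (√t)⁻¹) y hc.contMDiffAt h2
    have h5 := (RCLike.ofRealCLM (K := 𝕜)).contMDiff (n := ∞) |>.contMDiffAt.comp y h4
    refine h5.congr_of_eventuallyEq (Filter.Eventually.of_forall fun z ↦ ?_)
    simp
  choose e he hee using fun i ↦ exists_smoothSec_eventuallyEq (hn i)
  refine ⟨e, he, ?_, fun i ↦ ?_⟩
  · filter_upwards [Filter.eventually_all.2 hee, Filter.eventually_all.2 h] with y hy hy'
    have e1 : (fun i ↦ e i y) = fun i ↦ gramSchmidtNormed 𝕜 (fun j ↦ s j y) i := funext hy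
    rw [e1]
    refine ⟨fun i ↦ ?_, fun i j hij ↦ ?_⟩
    · simp [gramSchmidtNormed, norm_smul, (hy' i).2]
    · simp [gramSchmidtNormed, inner_smul_left, inner_smul_right,
        gramSchmidt_orthogonal 𝕜 (fun j ↦ s j y) hij]
  · rw [(hee i).self_of_nhds]
    simp only [hsx]
    rw [gramSchmidtNormed, gramSchmidt_of_orthogonal 𝕜 hb.2]
    simp [hb.1 i]

end OrthonormalFrames

/-! ### Sums over orthonormal bases -/

section FrameIndependence

/-- The trace of a bilinear map does not depend on the orthonormal basis. -/
theorem sum_bilin_orthonormalBasis {ι T M : Type*} [Fintype ι] [NormedAddCommGroup T]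
    [InnerProductSpace ℝ T] [AddCommGroup M] [Module ℝ M] (B : T →ₗ[ℝ] T →ₗ[ℝ] M)
    (e e' : OrthonormalBasis ι ℝ T) : ∑ i, B (e i) (e i) = ∑ i, B (e' i) (e' i) := by
  have h : ∀ i, B (e' i) (e' i)
      = ∑ j, ∑ k, (inner ℝ (e j) (e' i) * inner ℝ (e' i) (e k)) • B (e j) (e k) := fun i ↦ by
    conv_lhs => rw [← e.sum_repr' (e' i)]
    simp only [map_sum, map_smul, LinearMap.sum_apply, LinearMap.smul_apply, Finset.smul_sum,
      smul_smul]
    rw [Finset.sum_comm]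
    refine Finset.sum_congr rfl fun j _ ↦ Finset.sum_congr rfl fun k _ ↦ ?_
    congr 1
    rw [real_inner_comm (e' i) (e k)]
    ring
  simp only [h]
  rw [Finset.sum_comm]
  refine Finset.sum_congr rfl fun j _ ↦ ?_
  rw [Finset.sum_comm]
  simp only [← Finset.sum_smul, e'.sum_inner_mul_inner]
  classical
  simp [orthonormal_iff_ite.1 e.orthonormal]

theorem sum_norm_sq_eq_trace {ι E E' : Type*} [Fintype ι]
    [NormedAddCommGroup E] [InnerProductSpace ℂ E] [NormedAddCommGroup E'] [InnerProductSpace ℂ E']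
    [FiniteDimensional ℂ E] [FiniteDimensional ℂ E'] (T : E →ₗ[ℂ] E')
    (b : OrthonormalBasis ι ℂ E) :
    ((∑ i, ‖T (b i)‖ ^ 2 : ℝ) : ℂ) = LinearMap.trace ℂ E (LinearMap.adjoint T ∘ₗ T) := by
  rw [LinearMap.trace_eq_sum_inner _ b]
  push_cast
  refine Finset.sum_congr rfl fun i _ ↦ ?_
  change _ = inner ℂ (b i) (LinearMap.adjoint T (T (b i)))
  rw [LinearMap.adjoint_inner_right, inner_self_eq_norm_sq_to_K]
  norm_cast

/-- The Hilbert-Schmidt norm does not depend on the orthonormal basis. -/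
theorem sum_norm_sq_orthonormalBasis {ι κ E E' : Type*} [Fintype ι] [Fintype κ]
    [NormedAddCommGroup E] [InnerProductSpace ℂ E] [NormedAddCommGroup E'] [InnerProductSpace ℂ E']
    [FiniteDimensional ℂ E] [FiniteDimensional ℂ E'] (T : E →ₗ[ℂ] E')
    (e : OrthonormalBasis ι ℂ E) (e' : OrthonormalBasis κ ℂ E) :
    ∑ i, ‖T (e i)‖ ^ 2 = ∑ i, ‖T (e' i)‖ ^ 2 := by
  exact_mod_cast (sum_norm_sq_eq_trace T e).trans (sum_norm_sq_eq_trace T e').symm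

theorem sum_lt_eq_half_sum {f : Fin 4 → Fin 4 → ℝ} (hs : ∀ i j, f i j = f j i)
    (h0 : ∀ i, f i i = 0) : ∑ i, ∑ j ∈ Finset.Ioi i, f i j = 2⁻¹ * ∑ i, ∑ j, f i j := by
  have h : ∀ i : Fin 4, ∑ j ∈ Finset.Ioi i, f i j = ∑ j, if i < j then f i j else 0 := fun i ↦ by
    rw [← Finset.sum_filter]
    congr 1
    ext j
    simp
  simp only [h, Fin.sum_univ_four, h0]
  rw [hs 1 0, hs 2 0, hs 3 0, hs 2 1, hs 3 1, hs 3 2]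
  simp
  ring

end FrameIndependence

/-! ### Frame independence and continuity of curvature quantities -/

section Continuity

variable {X : Type*} [TopologicalSpace X] [ChartedSpace R4 X] [IsManifold (𝓡 4) ∞ X]
  [RiemannianBundle (fun x : X ↦ TangentSpace (𝓡 4) x)]

instance finiteDimensional_tangentSpace (x : X) : FiniteDimensional ℝ (TangentSpace (𝓡 4) x) :=
  inferInstanceAs (FiniteDimensional ℝ R4)

theorem finrank_tangentSpace (x : X) : Module.finrank ℝ (TangentSpace (𝓡 4) x) = 4 :=
  (finrank_euclideanSpace_fin : Module.finrank ℝ R4 = 4)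

variable [IsContMDiffRiemannianBundle (𝓡 4) ∞ R4 (fun x : X ↦ TangentSpace (𝓡 4) x)] [T2Space X]

/-- A smooth local orthonormal frame of the tangent bundle with prescribed value at `x`. -/
theorem exists_tangent_frame {x : X} (b : OrthonormalBasis (Fin 4) ℝ (TangentSpace (𝓡 4) x)) :
    ∃ e : Fin 4 → Π y : X, TangentSpace (𝓡 4) y, (∀ i, SmoothSec R4 (e i)) ∧
      (∀ᶠ y in 𝓝 x, ∃ b' : OrthonormalBasis (Fin 4) ℝ (TangentSpace (𝓡 4) y), ∀ i, b' i = e i y) ∧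
      ∀ i, e i x = b i := by
  obtain ⟨e, he, heo, hex⟩ := exists_orthonormal_smoothSec (𝕜 := ℝ) (F := R4)
    (V := fun x : X ↦ TangentSpace (𝓡 4) x)
    (fun σ τ y hσ hτ ↦ ContMDiffAt.inner_bundle hσ hτ)
    (fun f σ y hf hσ ↦ ContMDiffAt.smul_section hf hσ) b.orthonormal
  refine ⟨e, he, ?_, hex⟩
  filter_upwards [heo] with y hy
  refine ⟨OrthonormalBasis.mk hy ?_, fun i ↦ congrFun (OrthonormalBasis.coe_mk hy _) i⟩
  rw [hy.linearIndependent.span_eq_top_of_card_eq_finrank' (by simp [finrank_tangentSpace])]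

/-- A smooth local unitary frame of a Hermitian bundle. -/
theorem exists_unitary_frame {F : Type*} [NormedAddCommGroup F] [NormedSpace ℂ F]
    {V : X → Type*} [∀ x, NormedAddCommGroup (V x)] [∀ x, InnerProductSpace ℂ (V x)]
    [TopologicalSpace (TotalSpace F V)] [FiberBundle F V] [VectorBundle ℂ F V] [VectorBundle ℝ F V]
    [ContMDiffVectorBundle ∞ F V (𝓡 4)] [IsSmoothHermitianBundle F V] [FiniteDimensional ℂ F]
    (x : X) :
    ∃ e : Fin (Module.finrank ℂ F) → Π y : X, V y, (∀ i, SmoothSec F (e i)) ∧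
      ∀ᶠ y in 𝓝 x, ∃ b : OrthonormalBasis (Fin (Module.finrank ℂ F)) ℂ (V y), ∀ i, b i = e i y := by
  have hfin : ∀ y, FiniteDimensional ℂ (V y) := fun y ↦ finiteDimensional_fiber F V y
  have hrank : ∀ y, Module.finrank ℂ (V y) = Module.finrank ℂ F := fun y ↦
    ((trivializationAt F V y).linearEquivAt ℂ y
      (FiberBundle.mem_baseSet_trivializationAt' y)).finrank_eq
  obtain ⟨e, he, heo, -⟩ := exists_orthonormal_smoothSec (𝕜 := ℂ) (F := F) (V := V)
    (fun σ τ y hσ hτ ↦ IsSmoothHermitianBundle.smooth_inner σ τ y hσ hτ)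
    (fun f σ y hf hσ ↦ by
      have h1 : ContMDiffAt (𝓡 4) 𝓘(ℝ, ℝ) ∞ (fun z ↦ (f z).re) y :=
        Complex.reCLM.contMDiff.contMDiffAt.comp y hf
      have h2 : ContMDiffAt (𝓡 4) 𝓘(ℝ, ℝ) ∞ (fun z ↦ (f z).im) y :=
        Complex.imCLM.contMDiff.contMDiffAt.comp y hf
      have h3 := (h1.smul_section hσ).add_section (h2.smul_section (SmoothSectionAt.I_smul hσ))
      refine h3.congr_of_eventuallyEq (Filter.Eventually.of_forall fun z ↦ ?_)
      refine congrArg (TotalSpace.mk' F z) ?_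
      change f z • σ z = (f z).re • σ z + (f z).im • (Complex.I • σ z)
      conv_lhs => rw [← Complex.re_add_im (f z), add_smul, mul_smul]
      rfl)
    (((stdOrthonormalBasis ℂ (V x)).reindex (finCongr (hrank x))).orthonormal)
  refine ⟨e, he, ?_⟩
  filter_upwards [heo] with y hy
  refine ⟨OrthonormalBasis.mk hy ?_, fun i ↦ congrFun (OrthonormalBasis.coe_mk hy _) i⟩
  rw [hy.linearIndependent.span_eq_top_of_card_eq_finrank' (by simp [hrank])]

section CurvatureNorm

variable {F : Type*} [NormedAddCommGroup F] [NormedSpace ℂ F] [FiniteDimensional ℂ F]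
  {V : X → Type*} [∀ x, NormedAddCommGroup (V x)] [∀ x, InnerProductSpace ℂ (V x)]
  [TopologicalSpace (TotalSpace F V)] [FiberBundle F V] [VectorBundle ℂ F V] [VectorBundle ℝ F V]
  [ContMDiffVectorBundle ∞ F V (𝓡 4)] [IsSmoothHermitianBundle F V]
  {cov : CovariantDerivative (𝓡 4) F V}

/-- The norm of the curvature may be computed in any orthonormal frames. -/
theorem IsUnitaryConnection.curvatureNorm_sq (h : IsUnitaryConnection cov) {ι : Type*} [Fintype ι]
    (x : X) (e : OrthonormalBasis (Fin 4) ℝ (TangentSpace (𝓡 4) x)) (b : OrthonormalBasis ι ℂ (V x)) :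
    curvatureNorm cov x ^ 2 = 2⁻¹ * ∑ i, ∑ j, ∑ a, ‖curvatureAt cov x (e i) (e j) (b a)‖ ^ 2 := by
  have hfin : FiniteDimensional ℂ (V x) := finiteDimensional_fiber F V x
  have hswap : ∀ u v w, ‖curvatureAt cov x u v w‖ ^ 2 = ‖curvatureAt cov x v u w‖ ^ 2 :=
    fun u v w ↦ by rw [h.isCompatibleWith.curvatureAt_swap, norm_neg]
  have hself : ∀ u w, curvatureAt cov x u u w = 0 := fun u w ↦ by
    have h1 := h.isCompatibleWith.curvatureAt_swap x u u w
    have h2 : (2 : ℝ) • curvatureAt cov x u u w = 0 := by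
      rw [two_smul]
      nth_rewrite 1 [h1]
      exact neg_add_cancel _
    simpa using h2
  have hb : ∀ u v, ∑ a, ‖curvatureAt cov x u v (stdOrthonormalBasis ℂ (V x) a)‖ ^ 2
      = ∑ a, ‖curvatureAt cov x u v (b a)‖ ^ 2 := fun u v ↦
    sum_norm_sq_orthonormalBasis (h.curvatureEnd x u v) _ _
  have hq : ∀ f f' : OrthonormalBasis (Fin 4) ℝ (TangentSpace (𝓡 4) x), ∀ v a,
      ∑ i, ‖curvatureAt cov x (f i) v (b a)‖ ^ 2 = ∑ i, ‖curvatureAt cov x (f' i) v (b a)‖ ^ 2 := by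
    intro f f' v a
    let L : TangentSpace (𝓡 4) x →ₗ[ℝ] V x :=
      ((h.isCompatibleWith.curvature x).flip v).flip (b a)
    have := sum_bilin_orthonormalBasis ((reInner (V x)).compl₁₂ L L) f f'
    have hn : ∀ u, (reInner (V x)).compl₁₂ L L u u = ‖curvatureAt cov x u v (b a)‖ ^ 2 := fun u ↦
      inner_self_eq_norm_sq (𝕜 := ℂ) (curvatureAt cov x u v (b a))
    simpa only [hn] using this
  rw [curvatureNorm, Real.sq_sqrt (by positivity),
    sum_lt_eq_half_sum (fun i j ↦ by simp only [hswap]) (fun i ↦ by simp [hself])]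
  congr 1
  simp only [hb]
  calc ∑ i, ∑ j, ∑ a, ‖curvatureAt cov x (tangentFrame x i) (tangentFrame x j) (b a)‖ ^ 2
      = ∑ j, ∑ a, ∑ i, ‖curvatureAt cov x (tangentFrame x i) (tangentFrame x j) (b a)‖ ^ 2 := by
        rw [Finset.sum_comm]
        exact Finset.sum_congr rfl fun j _ ↦ Finset.sum_comm
    _ = ∑ j, ∑ a, ∑ i, ‖curvatureAt cov x (e i) (tangentFrame x j) (b a)‖ ^ 2 := by
        simp only [hq (tangentFrame x) e]
    _ = ∑ i, ∑ a, ∑ j, ‖curvatureAt cov x (tangentFrame x j) (e i) (b a)‖ ^ 2 := by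
        simp only [hswap (tangentFrame x _) (e _)]
        refine Eq.trans (Finset.sum_congr rfl fun j _ ↦ Finset.sum_comm) ?_
        exact Finset.sum_comm.trans (Finset.sum_congr rfl fun i _ ↦ Finset.sum_comm)
    _ = ∑ i, ∑ j, ∑ a, ‖curvatureAt cov x (e i) (e j) (b a)‖ ^ 2 := by
        simp only [hq (tangentFrame x) e]
        simp only [hswap (e _) (e _)]
        exact Finset.sum_congr rfl fun i _ ↦ Finset.sum_comm

theorem IsUnitaryConnection.continuous_curvatureNorm
    {covX : CovariantDerivative (𝓡 4) R4 (fun x : X ↦ TangentSpace (𝓡 4) x)}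
    (hX : IsLeviCivita covX) (h : IsUnitaryConnection cov) :
    Continuous (curvatureNorm cov) := by
  refine continuous_iff_continuousAt.2 fun x ↦ ?_
  obtain ⟨e, he, hex, -⟩ := exists_tangent_frame (tangentFrame x)
  obtain ⟨b, hb, hbx⟩ := exists_unitary_frame (F := F) (V := V) x
  have hs : ∀ i j a, SmoothSec F (sectionCurvature cov (e i) (e j) (b a)) := fun i j a ↦
    SmoothSec.sub (SmoothSec.sub (((hb a).covDeriv h.smooth (he j)).covDeriv h.smooth (he i))
      (((hb a).covDeriv h.smooth (he i)).covDeriv h.smooth (he j)))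
      ((hb a).covDeriv h.smooth (hX.smooth_mlieBracket (he i) (he j)))
  have hc : ContinuousAt (fun y ↦ √(2⁻¹ * ∑ i, ∑ j, ∑ a,
      (inner ℂ (sectionCurvature cov (e i) (e j) (b a) y)
        (sectionCurvature cov (e i) (e j) (b a) y)).re)) x := by
    refine Continuous.continuousAt ?_
    refine Real.continuous_sqrt.comp (continuous_const.mul ?_)
    refine continuous_finsetSum _ fun i _ ↦ continuous_finsetSum _ fun j _ ↦
      continuous_finsetSum _ fun a _ ↦ ?_
    exact (contMDiff_re ((hs i j a).contMDiff_hermitian (hs i j a))).continuous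
  refine hc.congr ?_
  filter_upwards [hex, hbx] with y ⟨e', he'⟩ ⟨b', hb'⟩
  have hn := h.curvatureNorm_sq y e' b'
  rw [← Real.sqrt_sq (show 0 ≤ curvatureNorm cov y from Real.sqrt_nonneg _), hn]
  congr 2
  refine Finset.sum_congr rfl fun i _ ↦ Finset.sum_congr rfl fun j _ ↦
    Finset.sum_congr rfl fun a _ ↦ ?_
  rw [he', he', hb', h.isCompatibleWith.curvatureAt_eq (hb a) (he i) (he j)]
  exact inner_self_eq_norm_sq (𝕜 := ℂ) _

end CurvatureNorm

variable {cov : CovariantDerivative (𝓡 4) R4 (fun x : X ↦ TangentSpace (𝓡 4) x)}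

/-- The scalar curvature may be computed in any orthonormal frame. -/
theorem IsLeviCivita.scalarCurvature_eq (h : IsLeviCivita cov) (x : X)
    (e : OrthonormalBasis (Fin 4) ℝ (TangentSpace (𝓡 4) x)) :
    scalarCurvature cov x = ∑ i, ∑ j, inner ℝ (curvatureAt cov x (e i) (e j) (e j)) (e i) := by
  have h1 : ∀ f : OrthonormalBasis (Fin 4) ℝ (TangentSpace (𝓡 4) x), ∀ u,
      ∑ j, inner ℝ (curvatureAt cov x u (f j) (f j)) u
        = ∑ j, inner ℝ (curvatureAt cov x u (e j) (e j)) u := fun f u ↦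
    sum_bilin_orthonormalBasis
      ((h.isCompatibleWith.curvature x u).compr₂ ((innerₗ (TangentSpace (𝓡 4) x)).flip u)) f e
  have h2 : ∀ f : OrthonormalBasis (Fin 4) ℝ (TangentSpace (𝓡 4) x), ∀ w,
      ∑ i, inner ℝ (curvatureAt cov x (f i) w w) (f i)
        = ∑ i, inner ℝ (curvatureAt cov x (e i) w w) (e i) := fun f w ↦
    sum_bilin_orthonormalBasis
      ((innerₗ (TangentSpace (𝓡 4) x)).comp (((h.isCompatibleWith.curvature x).flip w).flip w)) f e
  rw [scalarCurvature]
  simp only [h1 (tangentFrame x)]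
  rw [Finset.sum_comm]
  simp only [h2 (tangentFrame x)]
  exact Finset.sum_comm

theorem IsLeviCivita.continuous_scalarCurvature (h : IsLeviCivita cov) :
    Continuous (scalarCurvature cov) := by
  refine continuous_iff_continuousAt.2 fun x ↦ ?_
  obtain ⟨e, he, hex, -⟩ := exists_tangent_frame (tangentFrame x)
  have hs : ∀ i j, SmoothSec R4 (sectionCurvature cov (e i) (e j) (e j)) := fun i j ↦
    SmoothSec.sub (SmoothSec.sub (((he j).covDeriv h.smooth (he j)).covDeriv h.smooth (he i))
      (((he j).covDeriv h.smooth (he i)).covDeriv h.smooth (he j)))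
      ((he j).covDeriv h.smooth (h.smooth_mlieBracket (he i) (he j)))
  have hc : ContinuousAt (fun y ↦ ∑ i, ∑ j,
      inner ℝ (sectionCurvature cov (e i) (e j) (e j) y) (e i y)) x :=
    (continuous_finsetSum _ fun i _ ↦ continuous_finsetSum _ fun j _ ↦
      ((hs i j).contMDiff_inner (he i)).continuous).continuousAt
  refine hc.congr ?_
  filter_upwards [hex] with y ⟨e', he'⟩
  rw [h.scalarCurvature_eq y e']
  refine Finset.sum_congr rfl fun i _ ↦ Finset.sum_congr rfl fun j _ ↦ ?_
  rw [he', he', h.isCompatibleWith.curvatureAt_eq (he j) (he i) (he j)]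

end Continuity

/-! ### Derivatives of complex functions and sums -/

section ComplexFunctions

variable {X : Type*} [TopologicalSpace X] [ChartedSpace R4 X]

theorem mvfderiv_complex_mul {f g : X → ℂ} {x : X} (hf : MDifferentiableAt (𝓡 4) 𝓘(ℝ, ℂ) f x)
    (hg : MDifferentiableAt (𝓡 4) 𝓘(ℝ, ℂ) g x) (v : TangentSpace (𝓡 4) x) :
    mvfderiv (𝓡 4) (fun y ↦ f y * g y) x v
      = mvfderiv (𝓡 4) f x v * g x + f x * mvfderiv (𝓡 4) g x v := by
  have h := congrArg (fun L ↦ L v) (hf.hasMFDerivAt.mul hg.hasMFDerivAt).mfderiv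
  refine Eq.trans h ?_
  change f x * mvfderiv (𝓡 4) g x v + g x * mvfderiv (𝓡 4) f x v = _
  ring

theorem mdifferentiableAt_finset_sum {ι G : Type*} [NormedAddCommGroup G] [NormedSpace ℝ G]
    {s : Finset ι} {f : ι → X → G} {x : X}
    (hf : ∀ i ∈ s, MDifferentiableAt (𝓡 4) 𝓘(ℝ, G) (f i) x) :
    MDifferentiableAt (𝓡 4) 𝓘(ℝ, G) (fun y ↦ ∑ i ∈ s, f i y) x := by
  classical
  induction s using Finset.induction_on with
  | empty =>
    simp only [Finset.sum_empty]
    exact mdifferentiableAt_const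
  | insert a s ha ih =>
    simp only [Finset.sum_insert ha]
    exact (hf a (Finset.mem_insert_self a s)).add
      (ih fun i hi ↦ hf i (Finset.mem_insert_of_mem hi))

theorem mvfderiv_finset_sum {ι G : Type*} [NormedAddCommGroup G] [NormedSpace ℝ G]
    (s : Finset ι) {f : ι → X → G} {x : X}
    (hf : ∀ i ∈ s, MDifferentiableAt (𝓡 4) 𝓘(ℝ, G) (f i) x) (v : TangentSpace (𝓡 4) x) :
    mvfderiv (𝓡 4) (fun y ↦ ∑ i ∈ s, f i y) x v = ∑ i ∈ s, mvfderiv (𝓡 4) (f i) x v := by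
  classical
  induction s using Finset.induction_on with
  | empty =>
    simp only [Finset.sum_empty]
    exact congrArg (fun L ↦ L v) (mvfderiv_const (I := 𝓡 4) (M := X) (0 : G))
  | insert a s ha ih =>
    simp only [Finset.sum_insert ha]
    have h1 := hf a (Finset.mem_insert_self a s)
    have h2 : MDifferentiableAt (𝓡 4) 𝓘(ℝ, G) (fun y ↦ ∑ i ∈ s, f i y) x :=
      mdifferentiableAt_finset_sum fun i hi ↦ hf i (Finset.mem_insert_of_mem hi)
    have h3 := mvfderiv_add h1 h2
    rw [← ih fun i hi ↦ hf i (Finset.mem_insert_of_mem hi)]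
    exact congrArg (fun L ↦ L v) h3

end ComplexFunctions

/-! ### Sections of a tensor product and the product connection -/

section TensorSections

theorem inner_sum_sum {ι κ H : Type*} [NormedAddCommGroup H] [InnerProductSpace ℂ H]
    [Fintype ι] [Fintype κ] (f : ι → H) (g : κ → H) :
    inner ℂ (∑ i, f i) (∑ k, g k) = ∑ i, ∑ k, inner ℂ (f i) (g k) := by
  rw [sum_inner]
  exact Finset.sum_congr rfl fun i _ ↦ inner_sum _ _ _

variable {X : Type*} [TopologicalSpace X] [ChartedSpace R4 X] [IsManifold (𝓡 4) ∞ X] [T2Space X]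
  {FW : Type*} [NormedAddCommGroup FW] [NormedSpace ℂ FW]
  {W : X → Type*} [∀ x, NormedAddCommGroup (W x)] [∀ x, InnerProductSpace ℂ (W x)]
  [TopologicalSpace (TotalSpace FW W)] [FiberBundle FW W] [VectorBundle ℂ FW W]
  [VectorBundle ℝ FW W] [ContMDiffVectorBundle ∞ FW W (𝓡 4)] [IsSmoothHermitianBundle FW W]
  {FE : Type*} [NormedAddCommGroup FE] [NormedSpace ℂ FE]
  {E : X → Type*} [∀ x, NormedAddCommGroup (E x)] [∀ x, InnerProductSpace ℂ (E x)]
  [TopologicalSpace (TotalSpace FE E)] [FiberBundle FE E] [VectorBundle ℂ FE E]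
  [VectorBundle ℝ FE E] [ContMDiffVectorBundle ∞ FE E (𝓡 4)] [IsSmoothHermitianBundle FE E]
  {covW : CovariantDerivative (𝓡 4) FW W} {A : CovariantDerivative (𝓡 4) FE E}

theorem TensorExpression.nonempty_of_sum {φ : Π x, W x ⊗[ℂ] E x} {x : X} {ι : Type*} [Fintype ι]
    {σ : ι → Π y, W y} {τ : ι → Π y, E y} (hσ : ∀ i, SmoothSec FW (σ i))
    (hτ : ∀ i, SmoothSec FE (τ i)) (h : ∀ᶠ y in 𝓝 x, φ y = ∑ i, σ i y ⊗ₜ[ℂ] τ i y) :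
    Nonempty (TensorExpression FW FE φ x) := by
  let e := Fintype.equivFin ι
  exact ⟨{ n := Fintype.card ι
           σ := fun i ↦ σ (e.symm i)
           τ := fun i ↦ τ (e.symm i)
           smooth_left := fun i ↦ hσ _
           smooth_right := fun i ↦ hτ _
           eq_sum := h.mono fun y hy ↦ by
            rw [hy]
            exact (Equiv.sum_comp e.symm fun i ↦ σ i y ⊗ₜ[ℂ] τ i y).symm }⟩

/-- The Leibniz rule for the pairing of two local expressions. -/
theorem mvfderiv_inner_sum_tmul (hW : IsUnitaryConnection covW) (hA : IsUnitaryConnection A)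
    {ι κ : Type*} [Fintype ι] [Fintype κ] {σ : ι → Π y, W y} {τ : ι → Π y, E y}
    {s : κ → Π y, W y} {t : κ → Π y, E y}
    (hσ : ∀ i, SmoothSec FW (σ i)) (hτ : ∀ i, SmoothSec FE (τ i))
    (hs : ∀ i, SmoothSec FW (s i)) (ht : ∀ i, SmoothSec FE (t i)) (x : X)
    (v : TangentSpace (𝓡 4) x) :
    mvfderiv (𝓡 4) (fun y ↦ inner ℂ (∑ i, σ i y ⊗ₜ[ℂ] τ i y) (∑ k, s k y ⊗ₜ[ℂ] t k y)) x v
      = inner ℂ (∑ i, (covW (σ i) x v ⊗ₜ[ℂ] τ i x + σ i x ⊗ₜ[ℂ] A (τ i) x v))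
          (∑ k, s k x ⊗ₜ[ℂ] t k x)
        + inner ℂ (∑ i, σ i x ⊗ₜ[ℂ] τ i x)
          (∑ k, (covW (s k) x v ⊗ₜ[ℂ] t k x + s k x ⊗ₜ[ℂ] A (t k) x v)) := by
  have e : (fun y ↦ inner ℂ (∑ i, σ i y ⊗ₜ[ℂ] τ i y) (∑ k, s k y ⊗ₜ[ℂ] t k y))
      = fun y ↦ ∑ i, ∑ k, inner ℂ (σ i y) (s k y) * inner ℂ (τ i y) (t k y) := by
    funext y
    simp only [inner_sum_sum, TensorProduct.inner_tmul]
  have d1 : ∀ i k, MDifferentiableAt (𝓡 4) 𝓘(ℝ, ℂ) (fun y ↦ inner ℂ (σ i y) (s k y)) x :=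
    fun i k ↦ ((hσ i).contMDiff_hermitian (hs k)).contMDiffAt.mdifferentiableAt (by simp)
  have d2 : ∀ i k, MDifferentiableAt (𝓡 4) 𝓘(ℝ, ℂ) (fun y ↦ inner ℂ (τ i y) (t k y)) x :=
    fun i k ↦ ((hτ i).contMDiff_hermitian (ht k)).contMDiffAt.mdifferentiableAt (by simp)
  have d3 : ∀ i k, MDifferentiableAt (𝓡 4) 𝓘(ℝ, ℂ)
      (fun y ↦ inner ℂ (σ i y) (s k y) * inner ℂ (τ i y) (t k y)) x := fun i k ↦
    ((d1 i k).hasMFDerivAt.mul (d2 i k).hasMFDerivAt).mdifferentiableAt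
  have d4 : ∀ i, MDifferentiableAt (𝓡 4) 𝓘(ℝ, ℂ)
      (fun y ↦ ∑ k, inner ℂ (σ i y) (s k y) * inner ℂ (τ i y) (t k y)) x := fun i ↦
    mdifferentiableAt_finset_sum fun k _ ↦ d3 i k
  rw [e, mvfderiv_finset_sum _ fun i _ ↦ d4 i]
  simp only [inner_sum_sum, inner_add_left, inner_add_right, TensorProduct.inner_tmul]
  rw [← Finset.sum_add_distrib]
  refine Finset.sum_congr rfl fun i _ ↦ ?_
  rw [mvfderiv_finset_sum _ fun k _ ↦ d3 i k, ← Finset.sum_add_distrib]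
  refine Finset.sum_congr rfl fun k _ ↦ ?_
  rw [mvfderiv_complex_mul (d1 i k) (d2 i k),
    hW.metric _ _ x (hσ i x).diffSectionAt (hs k x).diffSectionAt,
    hA.metric _ _ x (hτ i x).diffSectionAt (ht k x).diffSectionAt]
  ring

/-- The tensor product connection may be computed with any local expression: the inner product with
a pure tensor is determined by the Leibniz rule. -/
theorem tensorCov_eq (hW : IsUnitaryConnection covW) (hA : IsUnitaryConnection A)
    {φ : Π x, W x ⊗[ℂ] E x} {x : X} {ι : Type*} [Fintype ι] {σ : ι → Π y, W y} {τ : ι → Π y, E y}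
    (hσ : ∀ i, SmoothSec FW (σ i)) (hτ : ∀ i, SmoothSec FE (τ i))
    (h : ∀ᶠ y in 𝓝 x, φ y = ∑ i, σ i y ⊗ₜ[ℂ] τ i y) (v : TangentSpace (𝓡 4) x) :
    tensorCov covW A φ x v = ∑ i, (covW (σ i) x v ⊗ₜ[ℂ] τ i x + σ i x ⊗ₜ[ℂ] A (τ i) x v) := by
  have hne := TensorExpression.nonempty_of_sum hσ hτ h
  rw [tensorCov, dif_pos hne]
  refine TensorProduct.ext_iff_inner_right.2 fun a b ↦ ?_
  obtain ⟨s, hs, rfl⟩ := exists_smoothSec_eq (F := FW) a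
  obtain ⟨t, ht, rfl⟩ := exists_smoothSec_eq (F := FE) b
  have h1 := mvfderiv_inner_sum_tmul hW hA hne.some.smooth_left hne.some.smooth_right
    (s := fun _ : Unit ↦ s) (t := fun _ : Unit ↦ t) (fun _ ↦ hs) (fun _ ↦ ht) x v
  have h2 := mvfderiv_inner_sum_tmul hW hA hσ hτ
    (s := fun _ : Unit ↦ s) (t := fun _ : Unit ↦ t) (fun _ ↦ hs) (fun _ ↦ ht) x v
  have he : (fun y ↦ inner ℂ (∑ i, hne.some.σ i y ⊗ₜ[ℂ] hne.some.τ i y)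
        (∑ _k : Unit, s y ⊗ₜ[ℂ] t y))
      =ᶠ[𝓝 x] fun y ↦ inner ℂ (∑ i, σ i y ⊗ₜ[ℂ] τ i y) (∑ _k : Unit, s y ⊗ₜ[ℂ] t y) := by
    filter_upwards [h, hne.some.eq_sum] with y hy hy'
    rw [← hy, ← hy']
  rw [mvfderiv_congr he, h2, ← h.self_of_nhds, ← hne.some.eq_sum.self_of_nhds] at h1
  simpa using (add_right_cancel h1).symm

theorem tensorCov_congr (hW : IsUnitaryConnection covW) (hA : IsUnitaryConnection A)
    {φ ψ : Π x, W x ⊗[ℂ] E x} {x : X} (hφ : Nonempty (TensorExpression FW FE φ x))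
    (he : ∀ᶠ y in 𝓝 x, ψ y = φ y) (v : TangentSpace (𝓡 4) x) :
    tensorCov covW A ψ x v = tensorCov covW A φ x v := by
  obtain ⟨t⟩ := hφ
  rw [tensorCov_eq hW hA t.smooth_left t.smooth_right t.eq_sum,
    tensorCov_eq hW hA t.smooth_left t.smooth_right
      (he.and t.eq_sum |>.mono fun _ hy ↦ hy.1.trans hy.2)]

variable (covW A) in
/-- The covariant derivative of a section at a point, as a linear map in the direction. -/
noncomputable def tensorCovLinear (φ : Π x, W x ⊗[ℂ] E x) (x : X) :
    TangentSpace (𝓡 4) x →ₗ[ℝ] W x ⊗[ℂ] E x where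
  toFun := tensorCov covW A φ x
  map_add' u v := by
    unfold tensorCov
    split_ifs
    · rw [← Finset.sum_add_distrib]
      refine Finset.sum_congr rfl fun i _ ↦ ?_
      rw [map_add, map_add, TensorProduct.add_tmul, TensorProduct.tmul_add]
      abel
    · simp
  map_smul' c v := by
    unfold tensorCov
    split_ifs
    · rw [Finset.smul_sum]
      refine Finset.sum_congr rfl fun i _ ↦ ?_
      rw [map_smul, map_smul, ← TensorProduct.smul_tmul', TensorProduct.tmul_smul, ← smul_add]
      rfl
    · simp

theorem IsSmoothTensorSection.inner_smooth {φ ψ : Π x, W x ⊗[ℂ] E x}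
    (hφ : IsSmoothTensorSection FW FE φ) (hψ : IsSmoothTensorSection FW FE ψ) :
    ContMDiff (𝓡 4) 𝓘(ℝ, ℂ) ∞ (fun y ↦ inner ℂ (φ y) (ψ y)) := fun x ↦ by
  obtain ⟨t⟩ := hφ x
  obtain ⟨t'⟩ := hψ x
  have h : ContMDiff (𝓡 4) 𝓘(ℝ, ℂ) ∞
      (fun y ↦ ∑ i, ∑ k, inner ℂ (t.σ i y) (t'.σ k y) * inner ℂ (t.τ i y) (t'.τ k y)) := by
    refine contMDiff_finsetSum fun i _ ↦ contMDiff_finsetSum fun k _ ↦ ?_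
    have hm : ContDiff ℝ ∞ (fun p : ℂ × ℂ ↦ p.1 * p.2) := contDiff_mul
    exact hm.contMDiff.comp ((SmoothSec.contMDiff_hermitian (t.smooth_left i)
      (t'.smooth_left k)).prodMk_space
      (SmoothSec.contMDiff_hermitian (t.smooth_right i) (t'.smooth_right k)))
  refine h.contMDiffAt.congr_of_eventuallyEq ?_
  filter_upwards [t.eq_sum, t'.eq_sum] with y hy hy'
  rw [hy, hy']
  simp only [inner_sum_sum, TensorProduct.inner_tmul]

/-- The tensor product connection is unitary. -/
theorem mvfderiv_inner_tensor (hW : IsUnitaryConnection covW) (hA : IsUnitaryConnection A)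
    {φ ψ : Π x, W x ⊗[ℂ] E x} (hφ : IsSmoothTensorSection FW FE φ)
    (hψ : IsSmoothTensorSection FW FE ψ) (x : X) (v : TangentSpace (𝓡 4) x) :
    mvfderiv (𝓡 4) (fun y ↦ inner ℂ (φ y) (ψ y)) x v
      = inner ℂ (tensorCov covW A φ x v) (ψ x) + inner ℂ (φ x) (tensorCov covW A ψ x v) := by
  obtain ⟨t⟩ := hφ x
  obtain ⟨t'⟩ := hψ x
  rw [tensorCov_eq hW hA t.smooth_left t.smooth_right t.eq_sum,
    tensorCov_eq hW hA t'.smooth_left t'.smooth_right t'.eq_sum, t.eq_sum.self_of_nhds,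
    t'.eq_sum.self_of_nhds, ← mvfderiv_inner_sum_tmul hW hA t.smooth_left t.smooth_right
    t'.smooth_left t'.smooth_right]
  refine congrArg (fun L ↦ L v) (mvfderiv_congr (G := ℂ) ?_)
  filter_upwards [t.eq_sum, t'.eq_sum] with y hy hy'
  rw [hy, hy']

theorem tensorCov_sum_tmul (hW : IsUnitaryConnection covW) (hA : IsUnitaryConnection A)
    {ι : Type*} [Fintype ι] {φ : Π x, W x ⊗[ℂ] E x} {x : X} {σ : ι → Π y, W y} {τ : ι → Π y, E y}
    (hσ : ∀ i, SmoothSec FW (σ i)) (hτ : ∀ i, SmoothSec FE (τ i))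
    (h : ∀ᶠ y in 𝓝 x, φ y = ∑ i, σ i y ⊗ₜ[ℂ] τ i y) (Y : Π x : X, TangentSpace (𝓡 4) x) :
    ∀ᶠ y in 𝓝 x, tensorCov covW A φ y (Y y) = ∑ k : ι ⊕ ι,
      (Sum.elim (fun i y ↦ covW (σ i) y (Y y)) σ k y) ⊗ₜ[ℂ]
        (Sum.elim τ (fun i y ↦ A (τ i) y (Y y)) k y) := by
  filter_upwards [h.eventually_nhds] with y hy
  rw [tensorCov_eq hW hA hσ hτ hy, Fintype.sum_sum_type, Finset.sum_add_distrib]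
  rfl

theorem IsSmoothTensorSection.tensorCov (hW : IsUnitaryConnection covW)
    (hA : IsUnitaryConnection A) {φ : Π x, W x ⊗[ℂ] E x} (hφ : IsSmoothTensorSection FW FE φ)
    {Y : Π x : X, TangentSpace (𝓡 4) x} (hY : SmoothSec R4 Y) :
    IsSmoothTensorSection FW FE (fun y ↦ tensorCov covW A φ y (Y y)) := fun x ↦ by
  obtain ⟨t⟩ := hφ x
  refine TensorExpression.nonempty_of_sum ?_ ?_
    (tensorCov_sum_tmul hW hA t.smooth_left t.smooth_right t.eq_sum Y)
  · rintro (i | i)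
    · exact SmoothSec.covDeriv hW.smooth (t.smooth_left i) hY
    · exact t.smooth_left i
  · rintro (i | i)
    · exact t.smooth_right i
    · exact SmoothSec.covDeriv hA.smooth (t.smooth_right i) hY

theorem IsSmoothTensorSection.add {φ ψ : Π x, W x ⊗[ℂ] E x} (hφ : IsSmoothTensorSection FW FE φ)
    (hψ : IsSmoothTensorSection FW FE ψ) : IsSmoothTensorSection FW FE (fun y ↦ φ y + ψ y) :=
  fun x ↦ by
  obtain ⟨t⟩ := hφ x
  obtain ⟨t'⟩ := hψ x
  refine TensorExpression.nonempty_of_sum (σ := Sum.elim t.σ t'.σ) (τ := Sum.elim t.τ t'.τ) ?_ ?_ ?_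
  · rintro (i | i)
    exacts [t.smooth_left i, t'.smooth_left i]
  · rintro (i | i)
    exacts [t.smooth_right i, t'.smooth_right i]
  · filter_upwards [t.eq_sum, t'.eq_sum] with y hy hy'
    rw [hy, hy', Fintype.sum_sum_type]
    rfl

theorem IsSmoothTensorSection.zero :
    IsSmoothTensorSection FW FE (fun y ↦ (0 : W y ⊗[ℂ] E y)) := fun _ ↦
  TensorExpression.nonempty_of_sum (ι := Empty) (σ := fun i ↦ i.elim) (τ := fun i ↦ i.elim)
    (fun i ↦ i.elim) (fun i ↦ i.elim) (Filter.Eventually.of_forall fun _ ↦ by simp)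

theorem tensorCov_zero (hW : IsUnitaryConnection covW) (hA : IsUnitaryConnection A) (x : X)
    (v : TangentSpace (𝓡 4) x) : tensorCov covW A (fun y ↦ (0 : W y ⊗[ℂ] E y)) x v = 0 :=
  (tensorCov_eq hW hA (ι := Empty) (σ := fun i ↦ i.elim) (τ := fun i ↦ i.elim)
    (fun i ↦ i.elim) (fun i ↦ i.elim) (Filter.Eventually.of_forall fun _ ↦ by simp) v).trans
    (by simp)

theorem tensorCov_add (hW : IsUnitaryConnection covW) (hA : IsUnitaryConnection A)
    {φ ψ : Π x, W x ⊗[ℂ] E x} (hφ : IsSmoothTensorSection FW FE φ)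
    (hψ : IsSmoothTensorSection FW FE ψ) (x : X) (v : TangentSpace (𝓡 4) x) :
    tensorCov covW A (fun y ↦ φ y + ψ y) x v
      = tensorCov covW A φ x v + tensorCov covW A ψ x v := by
  obtain ⟨t⟩ := hφ x
  obtain ⟨t'⟩ := hψ x
  rw [tensorCov_eq hW hA (σ := Sum.elim t.σ t'.σ) (τ := Sum.elim t.τ t'.τ),
    tensorCov_eq hW hA t.smooth_left t.smooth_right t.eq_sum,
    tensorCov_eq hW hA t'.smooth_left t'.smooth_right t'.eq_sum, Fintype.sum_sum_type]
  · rfl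
  · rintro (i | i)
    exacts [t.smooth_left i, t'.smooth_left i]
  · rintro (i | i)
    exacts [t.smooth_right i, t'.smooth_right i]
  · filter_upwards [t.eq_sum, t'.eq_sum] with y hy hy'
    rw [hy, hy', Fintype.sum_sum_type]
    rfl

theorem IsSmoothTensorSection.sum {ι : Type*} (s : Finset ι) {φ : ι → Π x, W x ⊗[ℂ] E x}
    (hφ : ∀ i ∈ s, IsSmoothTensorSection FW FE (φ i)) :
    IsSmoothTensorSection FW FE (fun y ↦ ∑ i ∈ s, φ i y) := by
  classical
  induction s using Finset.induction_on with
  | empty => simpa only [Finset.sum_empty] using IsSmoothTensorSection.zero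
  | insert a s ha ih =>
    simp only [Finset.sum_insert ha]
    exact (hφ a (Finset.mem_insert_self a s)).add (ih fun i hi ↦ hφ i (Finset.mem_insert_of_mem hi))

theorem tensorCov_sum (hW : IsUnitaryConnection covW) (hA : IsUnitaryConnection A) {ι : Type*}
    (s : Finset ι) {φ : ι → Π x, W x ⊗[ℂ] E x} (hφ : ∀ i ∈ s, IsSmoothTensorSection FW FE (φ i))
    (x : X) (v : TangentSpace (𝓡 4) x) :
    tensorCov covW A (fun y ↦ ∑ i ∈ s, φ i y) x v = ∑ i ∈ s, tensorCov covW A (φ i) x v := by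
  classical
  induction s using Finset.induction_on with
  | empty => simpa only [Finset.sum_empty] using tensorCov_zero hW hA x v
  | insert a s ha ih =>
    have h : ∀ i ∈ s, IsSmoothTensorSection FW FE (φ i) :=
      fun i hi ↦ hφ i (Finset.mem_insert_of_mem hi)
    simp only [Finset.sum_insert ha]
    rw [tensorCov_add hW hA (hφ a (Finset.mem_insert_self a s)) (IsSmoothTensorSection.sum s h),
      ih h]

theorem IsSmoothTensorSection.const_smul {φ : Π x, W x ⊗[ℂ] E x}
    (hφ : IsSmoothTensorSection FW FE φ) (c : ℝ) :
    IsSmoothTensorSection FW FE (fun y ↦ (c : ℂ) • φ y) := fun x ↦ by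
  obtain ⟨t⟩ := hφ x
  refine TensorExpression.nonempty_of_sum (σ := fun i y ↦ c • t.σ i y) (τ := t.τ)
    (fun i ↦ SmoothSec.smul (f := fun _ ↦ c) contMDiff_const (t.smooth_left i)) t.smooth_right ?_
  filter_upwards [t.eq_sum] with y hy
  rw [hy, Finset.smul_sum]
  rfl

theorem tensorCov_const_smul (hW : IsUnitaryConnection covW) (hA : IsUnitaryConnection A)
    {φ : Π x, W x ⊗[ℂ] E x} (hφ : IsSmoothTensorSection FW FE φ) (c : ℝ) (x : X)
    (v : TangentSpace (𝓡 4) x) :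
    tensorCov covW A (fun y ↦ (c : ℂ) • φ y) x v = (c : ℂ) • tensorCov covW A φ x v := by
  obtain ⟨t⟩ := hφ x
  have hs : ∀ i, SmoothSec FW (fun y ↦ c • t.σ i y) := fun i ↦
    SmoothSec.smul (f := fun _ ↦ c) contMDiff_const (t.smooth_left i)
  rw [tensorCov_eq hW hA hs t.smooth_right, tensorCov_eq hW hA t.smooth_left t.smooth_right t.eq_sum,
    Finset.smul_sum]
  · refine Finset.sum_congr rfl fun i _ ↦ ?_
    rw [cov_const_smul c (SmoothSectionAt.diffSectionAt (t.smooth_left i x)), smul_add,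
      TensorProduct.smul_tmul', TensorProduct.smul_tmul']
    rfl
  · filter_upwards [t.eq_sum] with y hy
    rw [hy, Finset.smul_sum]
    rfl

end TensorSections

/-! ### Curvature and parallel bilinear maps -/

section BilinearCurvature

variable {X : Type*} [TopologicalSpace X] [ChartedSpace R4 X] [IsManifold (𝓡 4) ∞ X]
  {F₁ F₂ F₃ : Type*} [NormedAddCommGroup F₁] [NormedSpace ℝ F₁] [NormedAddCommGroup F₂]
  [NormedSpace ℝ F₂] [NormedAddCommGroup F₃] [NormedSpace ℝ F₃]
  {V₁ V₂ V₃ : X → Type*}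
  [TopologicalSpace (TotalSpace F₁ V₁)] [∀ x, AddCommGroup (V₁ x)] [∀ x, Module ℝ (V₁ x)]
  [∀ x, TopologicalSpace (V₁ x)] [∀ x, IsTopologicalAddGroup (V₁ x)]
  [∀ x, ContinuousSMul ℝ (V₁ x)] [FiberBundle F₁ V₁] [VectorBundle ℝ F₁ V₁]
  [TopologicalSpace (TotalSpace F₂ V₂)] [∀ x, AddCommGroup (V₂ x)] [∀ x, Module ℝ (V₂ x)]
  [∀ x, TopologicalSpace (V₂ x)] [∀ x, IsTopologicalAddGroup (V₂ x)]
  [∀ x, ContinuousSMul ℝ (V₂ x)] [FiberBundle F₂ V₂] [VectorBundle ℝ F₂ V₂]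
  [TopologicalSpace (TotalSpace F₃ V₃)] [∀ x, AddCommGroup (V₃ x)] [∀ x, Module ℝ (V₃ x)]
  [∀ x, TopologicalSpace (V₃ x)] [∀ x, IsTopologicalAddGroup (V₃ x)]
  [∀ x, ContinuousSMul ℝ (V₃ x)] [FiberBundle F₃ V₃] [VectorBundle ℝ F₃ V₃]
  {cov₁ : CovariantDerivative (𝓡 4) F₁ V₁} {cov₂ : CovariantDerivative (𝓡 4) F₂ V₂}
  {cov₃ : CovariantDerivative (𝓡 4) F₃ V₃}

/-- If a bilinear bundle map is parallel, then the curvatures act on it as derivations. -/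
theorem sectionCurvature_bilinear
    (h₁ : CovariantDerivative.ContMDiffCovariantDerivative cov₁ ∞)
    (h₂ : CovariantDerivative.ContMDiffCovariantDerivative cov₂ ∞)
    (β : ∀ x, V₁ x →ₗ[ℝ] V₂ x →ₗ[ℝ] V₃ x)
    (hβ : ∀ (σ : Π x, V₁ x) (τ : Π x, V₂ x), SmoothSec F₁ σ → SmoothSec F₂ τ →
      SmoothSec F₃ fun y ↦ β y (σ y) (τ y))
    (hl : ∀ (σ : Π x, V₁ x) (τ : Π x, V₂ x), SmoothSec F₁ σ → SmoothSec F₂ τ →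
      ∀ x (v : TangentSpace (𝓡 4) x), cov₃ (fun y ↦ β y (σ y) (τ y)) x v
        = β x (cov₁ σ x v) (τ x) + β x (σ x) (cov₂ τ x v))
    {σ : Π x, V₁ x} {τ : Π x, V₂ x} (hσ : SmoothSec F₁ σ) (hτ : SmoothSec F₂ τ)
    {U Y : Π x : X, TangentSpace (𝓡 4) x} (hU : SmoothSec R4 U) (hY : SmoothSec R4 Y) (x : X) :
    sectionCurvature cov₃ U Y (fun y ↦ β y (σ y) (τ y)) x
      = β x (sectionCurvature cov₁ U Y σ x) (τ x) + β x (σ x) (sectionCurvature cov₂ U Y τ x) := by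
  have key : ∀ {Z Z' : Π x : X, TangentSpace (𝓡 4) x}, SmoothSec R4 Z →
      cov₃ (fun y ↦ cov₃ (fun y ↦ β y (σ y) (τ y)) y (Z y)) x (Z' x)
        = (β x (cov₁ (fun y ↦ cov₁ σ y (Z y)) x (Z' x)) (τ x)
            + β x (cov₁ σ x (Z x)) (cov₂ τ x (Z' x)))
          + (β x (cov₁ σ x (Z' x)) (cov₂ τ x (Z x))
            + β x (σ x) (cov₂ (fun y ↦ cov₂ τ y (Z y)) x (Z' x))) := by
    intro Z Z' hZ
    have e : (fun y ↦ cov₃ (fun y ↦ β y (σ y) (τ y)) y (Z y))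
        = fun y ↦ β y (cov₁ σ y (Z y)) (τ y) + β y (σ y) (cov₂ τ y (Z y)) :=
      funext fun y ↦ hl σ τ hσ hτ y (Z y)
    have d1 := hσ.covDeriv h₁ hZ
    have d2 := hτ.covDeriv h₂ hZ
    rw [e, cov_add (hβ _ _ d1 hτ x).diffSectionAt (hβ _ _ hσ d2 x).diffSectionAt,
      hl _ _ d1 hτ, hl _ _ hσ d2]
  simp only [sectionCurvature]
  rw [key hY, key hU, hl σ τ hσ hτ]
  simp only [map_sub, LinearMap.sub_apply]
  abel

end BilinearCurvature

/-! ### Clifford multiplication and the spin connection -/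

section Spinc

variable {X : Type*} [TopologicalSpace X] [ChartedSpace R4 X] [IsManifold (𝓡 4) ∞ X] [T2Space X]
  [RiemannianBundle (fun x : X ↦ TangentSpace (𝓡 4) x)]
  [IsContMDiffRiemannianBundle (𝓡 4) ∞ R4 (fun x : X ↦ TangentSpace (𝓡 4) x)]
  {FW : Type*} [NormedAddCommGroup FW] [NormedSpace ℂ FW] [FiniteDimensional ℂ FW]
  {W : X → Type*} [∀ x, NormedAddCommGroup (W x)] [∀ x, InnerProductSpace ℂ (W x)]
  [TopologicalSpace (TotalSpace FW W)] [FiberBundle FW W] [VectorBundle ℂ FW W]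
  [VectorBundle ℝ FW W] [ContMDiffVectorBundle ∞ FW W (𝓡 4)] [IsSmoothHermitianBundle FW W]
  {FL : Type*} [NormedAddCommGroup FL] [NormedSpace ℂ FL] [FiniteDimensional ℂ FL]
  {L : X → Type*} [∀ x, NormedAddCommGroup (L x)] [∀ x, InnerProductSpace ℂ (L x)]
  [TopologicalSpace (TotalSpace FL L)] [FiberBundle FL L] [VectorBundle ℂ FL L]
  [VectorBundle ℝ FL L] [ContMDiffVectorBundle ∞ FL L (𝓡 4)] [IsSmoothHermitianBundle FL L]
  {FE : Type*} [NormedAddCommGroup FE] [NormedSpace ℂ FE] [FiniteDimensional ℂ FE]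
  {E : X → Type*} [∀ x, NormedAddCommGroup (E x)] [∀ x, InnerProductSpace ℂ (E x)]
  [TopologicalSpace (TotalSpace FE E)] [FiberBundle FE E] [VectorBundle ℂ FE E]
  [VectorBundle ℝ FE E] [ContMDiffVectorBundle ∞ FE E (𝓡 4)] [IsSmoothHermitianBundle FE E]
  {S : SpincStructure FW W} {δ : DeterminantLine FL L S}
  {covX : CovariantDerivative (𝓡 4) R4 (fun x : X ↦ TangentSpace (𝓡 4) x)}
  {Ad : CovariantDerivative (𝓡 4) FL L} {covW : CovariantDerivative (𝓡 4) FW W}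
  {A : CovariantDerivative (𝓡 4) FE E}

/-- The curvature of the spin connection and the Riemann tensor are intertwined by Clifford
multiplication. -/
theorem IsSpinConnection.curvature_clifford (h : IsSpinConnection δ covX Ad covW)
    (hX : IsLeviCivita covX) (x : X) (u v w : TangentSpace (𝓡 4) x) (a : W x) :
    curvatureAt covW x u v (S.ρ x w a)
      = S.ρ x (curvatureAt covX x u v w) a + S.ρ x w (curvatureAt covW x u v a) := by
  obtain ⟨σ, hσ, rfl⟩ := exists_smoothSec_eq (F := FW) a
  obtain ⟨U, hU, rfl⟩ := exists_smoothSec_eq (F := R4) u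
  obtain ⟨Y, hY, rfl⟩ := exists_smoothSec_eq (F := R4) v
  obtain ⟨Z, hZ, rfl⟩ := exists_smoothSec_eq (F := R4) w
  let β : ∀ x, TangentSpace (𝓡 4) x →ₗ[ℝ] W x →ₗ[ℝ] W x := fun x ↦
    LinearMap.mk₂ ℝ (fun v a ↦ S.ρ x v a) (fun v v' a ↦ by simp) (fun c v a ↦ by simp)
      (fun v a a' ↦ by simp) (fun c v a ↦ (S.ρ x v).map_smul_of_tower c a)
  have hβ : ∀ (Z : Π x : X, TangentSpace (𝓡 4) x) (τ : Π x, W x), SmoothSec R4 Z →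
      SmoothSec FW τ → SmoothSec FW fun y ↦ β y (Z y) (τ y) :=
    fun Z τ hZ hτ y ↦ S.ρ_smooth Z τ y (hZ y) (hτ y)
  have key := sectionCurvature_bilinear (cov₃ := covW) hX.smooth h.unitary.smooth β hβ
    (fun Z τ hZ hτ y v ↦ h.clifford Z τ y (hZ y).diffSectionAt (hτ y).diffSectionAt v) hZ hσ hU hY x
  rw [h.unitary.isCompatibleWith.curvatureAt_eq hσ hU hY,
    hX.isCompatibleWith.curvatureAt_eq hZ hU hY]
  exact (h.unitary.isCompatibleWith.curvatureAt_eq (hβ Z σ hZ hσ) hU hY x).trans key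

/-- The curvature of the determinant line is the trace of the curvature of the spin connection. -/
theorem IsSpinConnection.curvature_wedge (h : IsSpinConnection δ covX Ad covW)
    (hd : IsUnitaryConnection Ad) (x : X) (u v : TangentSpace (𝓡 4) x) (a b : W x) :
    curvatureAt Ad x u v (δ.wedge x a b)
      = δ.wedge x (curvatureAt covW x u v a) b + δ.wedge x a (curvatureAt covW x u v b) := by
  obtain ⟨σ, hσ, rfl⟩ := exists_smoothSec_eq (F := FW) a
  obtain ⟨τ, hτ, rfl⟩ := exists_smoothSec_eq (F := FW) b
  obtain ⟨U, hU, rfl⟩ := exists_smoothSec_eq (F := R4) u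
  obtain ⟨Y, hY, rfl⟩ := exists_smoothSec_eq (F := R4) v
  let β : ∀ x, W x →ₗ[ℝ] W x →ₗ[ℝ] L x := fun x ↦
    LinearMap.mk₂ ℝ (fun v a ↦ δ.wedge x v a) (fun v v' a ↦ by simp)
      (fun c v a ↦ by rw [(δ.wedge x).map_smul_of_tower]; rfl)
      (fun v a a' ↦ by simp) (fun c v a ↦ (δ.wedge x v).map_smul_of_tower c a)
  have hβ : ∀ (σ τ : Π x, W x), SmoothSec FW σ →
      SmoothSec FW τ → SmoothSec FL fun y ↦ β y (σ y) (τ y) :=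
    fun σ τ hσ hτ y ↦ δ.wedge_smooth σ τ y (hσ y) (hτ y)
  have key := sectionCurvature_bilinear (cov₃ := Ad) h.unitary.smooth h.unitary.smooth β hβ
    (fun σ τ hσ hτ y v ↦ h.det σ τ y (hσ y).diffSectionAt (hτ y).diffSectionAt v) hσ hτ hU hY x
  rw [h.unitary.isCompatibleWith.curvatureAt_eq hσ hU hY,
    h.unitary.isCompatibleWith.curvatureAt_eq hτ hU hY]
  exact (hd.isCompatibleWith.curvatureAt_eq (hβ σ τ hσ hτ) hU hY x).trans key

variable (S E) in
/-- Clifford multiplication on `V = W ⊗ E`. -/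
noncomputable def SpincStructure.tensorρ (x : X) :
    TangentSpace (𝓡 4) x →ₗ[ℝ] W x ⊗[ℂ] E x →ₗ[ℂ] W x ⊗[ℂ] E x where
  toFun v := (S.ρ x v).rTensor (E x)
  map_add' u v := by rw [map_add, LinearMap.rTensor_add]
  map_smul' c v := by
    rw [map_smul]
    refine TensorProduct.ext' fun a b ↦ ?_
    rw [LinearMap.rTensor_tmul, LinearMap.smul_apply, ← TensorProduct.smul_tmul']
    rfl

theorem SpincStructure.tensorρ_tmul (x : X) (v : TangentSpace (𝓡 4) x) (a : W x) (b : E x) :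
    S.tensorρ E x v (a ⊗ₜ b) = S.ρ x v a ⊗ₜ b := rfl

theorem SpincStructure.tensorρ_skew (x : X) (v : TangentSpace (𝓡 4) x) (p q : W x ⊗[ℂ] E x) :
    inner ℂ (S.tensorρ E x v p) q = - inner ℂ p (S.tensorρ E x v q) := by
  induction p using TensorProduct.induction_on with
  | zero => simp
  | add p p' hp hp' => rw [map_add, inner_add_left, inner_add_left, hp, hp', neg_add]
  | tmul a b =>
    induction q using TensorProduct.induction_on with
    | zero => simp
    | add p p' hp hp' => rw [map_add, inner_add_right, inner_add_right, hp, hp', neg_add]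
    | tmul a' b' =>
      rw [tensorρ_tmul, tensorρ_tmul, TensorProduct.inner_tmul, TensorProduct.inner_tmul,
        S.ρ_skew, neg_mul]

theorem SpincStructure.tensorρ_sq (x : X) (v : TangentSpace (𝓡 4) x) (p : W x ⊗[ℂ] E x) :
    S.tensorρ E x v (S.tensorρ E x v p) = - ((‖v‖ ^ 2 : ℝ) : ℂ) • p := by
  induction p using TensorProduct.induction_on with
  | zero => simp
  | add p p' hp hp' => rw [map_add, map_add, smul_add, hp, hp']
  | tmul a b => rw [tensorρ_tmul, tensorρ_tmul, S.ρ_sq, TensorProduct.smul_tmul']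

theorem IsSmoothTensorSection.tensorρ {φ : Π x, W x ⊗[ℂ] E x} (hφ : IsSmoothTensorSection FW FE φ)
    {Y : Π x : X, TangentSpace (𝓡 4) x} (hY : SmoothSec R4 Y) :
    IsSmoothTensorSection FW FE (fun y ↦ S.tensorρ E y (Y y) (φ y)) := fun x ↦ by
  obtain ⟨t⟩ := hφ x
  refine TensorExpression.nonempty_of_sum (σ := fun i y ↦ S.ρ y (Y y) (t.σ i y)) (τ := t.τ)
    (fun i y ↦ S.ρ_smooth Y (t.σ i) y (hY y) (t.smooth_left i y)) t.smooth_right ?_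
  filter_upwards [t.eq_sum] with y hy
  rw [hy, map_sum]
  rfl

/-- The Clifford multiplication on `V = W ⊗ E` is parallel. -/
theorem IsSpinConnection.tensorCov_tensorρ (h : IsSpinConnection δ covX Ad covW)
    (hA : IsUnitaryConnection A) {φ : Π x, W x ⊗[ℂ] E x} (hφ : IsSmoothTensorSection FW FE φ)
    {Y : Π x : X, TangentSpace (𝓡 4) x} (hY : SmoothSec R4 Y) (x : X)
    (v : TangentSpace (𝓡 4) x) :
    tensorCov covW A (fun y ↦ S.tensorρ E y (Y y) (φ y)) x v
      = S.tensorρ E x (covX Y x v) (φ x) + S.tensorρ E x (Y x) (tensorCov covW A φ x v) := by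
  obtain ⟨t⟩ := hφ x
  rw [tensorCov_eq h.unitary hA (σ := fun i y ↦ S.ρ y (Y y) (t.σ i y)) (τ := t.τ)
    (fun i y ↦ S.ρ_smooth Y (t.σ i) y (hY y) (t.smooth_left i y)) t.smooth_right
    (by
      filter_upwards [t.eq_sum] with y hy
      rw [hy, map_sum]
      rfl),
    tensorCov_eq h.unitary hA t.smooth_left t.smooth_right t.eq_sum, t.eq_sum.self_of_nhds,
    map_sum, map_sum, ← Finset.sum_add_distrib]
  refine Finset.sum_congr rfl fun i _ ↦ ?_
  rw [h.clifford Y (t.σ i) x (hY x).diffSectionAt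
    (SmoothSectionAt.diffSectionAt (t.smooth_left i x)), map_add, TensorProduct.add_tmul]
  simp only [SpincStructure.tensorρ_tmul]
  abel

/-- The Dirac operator may be computed in any orthonormal frame. -/
theorem dirac_eq (φ : Π x, W x ⊗[ℂ] E x) (x : X)
    (e : OrthonormalBasis (Fin 4) ℝ (TangentSpace (𝓡 4) x)) :
    dirac S covW A φ x = ∑ i, S.tensorρ E x (e i) (tensorCov covW A φ x (e i)) := by
  let B : TangentSpace (𝓡 4) x →ₗ[ℝ] TangentSpace (𝓡 4) x →ₗ[ℝ] W x ⊗[ℂ] E x :=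
    LinearMap.mk₂ ℝ (fun u v ↦ S.tensorρ E x u (tensorCovLinear covW A φ x v))
      (fun u u' v ↦ by simp) (fun c u v ↦ by rw [map_smul]; rfl)
      (fun u v v' ↦ by simp)
      (fun c u v ↦ by rw [map_smul]; exact (S.tensorρ E x u).map_smul_of_tower c _)
  exact sum_bilin_orthonormalBasis B (tangentFrame x) e

/-- The curvature of the tensor product connection is `F_W ⊗ 1 + 1 ⊗ F_A`. -/
theorem tensorCov_curvature (hW : IsUnitaryConnection covW) (hA : IsUnitaryConnection A)
    {φ : Π x, W x ⊗[ℂ] E x} (hφ : IsSmoothTensorSection FW FE φ)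
    {U Y : Π x : X, TangentSpace (𝓡 4) x} (hU : SmoothSec R4 U) (hY : SmoothSec R4 Y) (x : X) :
    tensorCov covW A (fun y ↦ tensorCov covW A φ y (Y y)) x (U x)
        - tensorCov covW A (fun y ↦ tensorCov covW A φ y (U y)) x (Y x)
        - tensorCov covW A φ x (VectorField.mlieBracket (𝓡 4) U Y x)
      = (hW.curvatureEnd x (U x) (Y x)).rTensor (E x) (φ x)
        + (hA.curvatureEnd x (U x) (Y x)).lTensor (W x) (φ x) := by
  obtain ⟨t⟩ := hφ x
  have key : ∀ {Z Z' : Π x : X, TangentSpace (𝓡 4) x}, SmoothSec R4 Z →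
      tensorCov covW A (fun y ↦ tensorCov covW A φ y (Z y)) x (Z' x)
        = ∑ i, ((covW (fun y ↦ covW (t.σ i) y (Z y)) x (Z' x) ⊗ₜ[ℂ] t.τ i x
            + covW (t.σ i) x (Z x) ⊗ₜ[ℂ] A (t.τ i) x (Z' x))
          + (covW (t.σ i) x (Z' x) ⊗ₜ[ℂ] A (t.τ i) x (Z x)
            + t.σ i x ⊗ₜ[ℂ] A (fun y ↦ A (t.τ i) y (Z y)) x (Z' x))) := by
    intro Z Z' hZ
    rw [tensorCov_eq hW hA ?_ ?_
      (tensorCov_sum_tmul hW hA t.smooth_left t.smooth_right t.eq_sum Z), Fintype.sum_sum_type,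
      ← Finset.sum_add_distrib]
    · rfl
    · rintro (i | i)
      · exact SmoothSec.covDeriv hW.smooth (t.smooth_left i) hZ
      · exact t.smooth_left i
    · rintro (i | i)
      · exact t.smooth_right i
      · exact SmoothSec.covDeriv hA.smooth (t.smooth_right i) hZ
  rw [key hY, key hU, tensorCov_eq hW hA t.smooth_left t.smooth_right t.eq_sum,
    t.eq_sum.self_of_nhds, map_sum, map_sum, ← Finset.sum_sub_distrib, ← Finset.sum_sub_distrib,
    ← Finset.sum_add_distrib]
  refine Finset.sum_congr rfl fun i _ ↦ ?_
  rw [LinearMap.rTensor_tmul, LinearMap.lTensor_tmul, IsUnitaryConnection.curvatureEnd_apply,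
    IsUnitaryConnection.curvatureEnd_apply,
    hW.isCompatibleWith.curvatureAt_eq (t.smooth_left i) hU hY,
    hA.isCompatibleWith.curvatureAt_eq (t.smooth_right i) hU hY]
  simp only [sectionCurvature, TensorProduct.sub_tmul, TensorProduct.tmul_sub]
  abel

end Spinc

/-! ### Clifford algebra in dimension four -/

/-- Four skew-adjoint operators that satisfy the relations of the Clifford algebra of `ℝ⁴`. -/
structure IsCliffordFamily {H : Type*} [NormedAddCommGroup H] [InnerProductSpace ℂ H]
    (r : Fin 4 → H →ₗ[ℂ] H) : Prop where
  skew : ∀ i a b, inner ℂ (r i a) b = - inner ℂ a (r i b)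
  sq : ∀ i a, r i (r i a) = - a
  anti : ∀ i j, i ≠ j → ∀ a, r i (r j a) = - r j (r i a)

section Clifford

variable {H : Type*} [NormedAddCommGroup H] [InnerProductSpace ℂ H] {r : Fin 4 → H →ₗ[ℂ] H}

namespace IsCliffordFamily

theorem comm (h : IsCliffordFamily r) (i j : Fin 4) (a : H) :
    r i (r j a) = - r j (r i a) - (if i = j then (2 : ℝ) else 0) • a := by
  split_ifs with hij
  · subst hij
    rw [h.sq, two_smul]
    abel
  · rw [h.anti i j hij, zero_smul, sub_zero]

theorem map_real_smul (r : H →ₗ[ℂ] H) (c : ℝ) (a : H) : r (c • a) = c • r a :=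
  r.map_smul_of_tower c a

theorem re_inner_apply_left (h : IsCliffordFamily r) (i : Fin 4) (a b : H) :
    (inner ℂ (r i a) b).re = - (inner ℂ a (r i b)).re := by
  rw [h.skew, Complex.neg_re]

theorem norm_apply (h : IsCliffordFamily r) (i : Fin 4) (a : H) : ‖r i a‖ = ‖a‖ := by
  have h1 : (inner ℂ (r i a) (r i a) : ℂ) = inner ℂ a a := by
    rw [h.skew, h.sq, inner_neg_right, neg_neg]
  have h2 : ‖r i a‖ ^ 2 = ‖a‖ ^ 2 := by
    rw [← inner_self_eq_norm_sq (𝕜 := ℂ), ← inner_self_eq_norm_sq (𝕜 := ℂ), h1]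
  exact (pow_left_inj₀ (norm_nonneg _) (norm_nonneg _) two_ne_zero).1 h2

theorem re_inner_self (h : IsCliffordFamily r) (i : Fin 4) (a : H) :
    (inner ℂ (r i a) a).re = 0 := by
  have h1 := h.re_inner_apply_left i a a
  have h2 : (inner ℂ a (r i a)).re = (inner ℂ (r i a) a).re := inner_re_symm (𝕜 := ℂ) _ _
  linarith

theorem re_inner_mul (h : IsCliffordFamily r) {i j : Fin 4} (hij : i ≠ j) (a : H) :
    (inner ℂ (r i (r j a)) a).re = 0 := by
  have h1 : (inner ℂ (r i (r j a)) a : ℂ) = - inner ℂ a (r i (r j a)) := by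
    rw [h.skew, h.skew, h.anti j i hij.symm, inner_neg_right, neg_neg]
  have h2 : (inner ℂ a (r i (r j a))).re = (inner ℂ (r i (r j a)) a).re :=
    inner_re_symm (𝕜 := ℂ) _ _
  have h3 := congrArg Complex.re h1
  rw [Complex.neg_re] at h3
  linarith

theorem re_inner_apply_apply (h : IsCliffordFamily r) (i j : Fin 4) (a : H) :
    (inner ℂ (r i a) (r j a)).re = if i = j then ‖a‖ ^ 2 else 0 := by
  split_ifs with hij
  · subst hij
    rw [← h.norm_apply i a]
    exact inner_self_eq_norm_sq (𝕜 := ℂ) _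
  · have h2 : (inner ℂ (r i a) (r j a)).re = (inner ℂ (r j a) (r i a)).re :=
      inner_re_symm (𝕜 := ℂ) _ _
    have h3 := h.re_inner_apply_left i (r j a) a
    have h4 := h.re_inner_mul hij a
    linarith

/-- Clifford multiplication by a real vector `t` scales the norm by `|t|`. -/
theorem norm_sq_sum_smul (h : IsCliffordFamily r) (t : Fin 4 → ℝ) (a : H) :
    ‖∑ i, t i • r i a‖ ^ 2 = (∑ i, t i ^ 2) * ‖a‖ ^ 2 := by
  have h1 : ‖∑ i, t i • r i a‖ ^ 2 = reInner H (∑ i, t i • r i a) (∑ i, t i • r i a) :=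
    (inner_self_eq_norm_sq (𝕜 := ℂ) _).symm
  rw [h1]
  simp only [map_sum, map_smul, LinearMap.sum_apply, LinearMap.smul_apply, reInner_apply,
    h.re_inner_apply_apply, smul_eq_mul, mul_ite, mul_zero, Finset.sum_ite_eq',
    Finset.mem_univ, if_true, Finset.sum_mul]
  exact Finset.sum_congr rfl fun i _ ↦ by ring

theorem sum_inner_apply (h : IsCliffordFamily r) (p : Fin 4 → H) (q : H) :
    ∑ i, (inner ℂ (p i) (r i q)).re = - (inner ℂ (∑ i, r i (p i)) q).re := by
  rw [sum_inner, Complex.re_sum, ← Finset.sum_neg_distrib]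
  exact Finset.sum_congr rfl fun i _ ↦ by rw [h.re_inner_apply_left, neg_neg]

/-- The refined Kato inequality for a twistor: project `(t_i φ)_i`, with
`t_i = Re ⟨ψ_i, φ⟩`, orthogonally to the kernel of Clifford contraction. -/
theorem kato_of_sum_eq_zero (h : IsCliffordFamily r) (ψ : Fin 4 → H) (φ : H)
    (hψ : ∑ i, r i (ψ i) = 0) :
    ∑ i, (inner ℂ (ψ i) φ).re ^ 2 ≤ 3 / 4 * ‖φ‖ ^ 2 * ∑ i, ‖ψ i‖ ^ 2 := by
  set t : Fin 4 → ℝ := fun i ↦ (inner ℂ (ψ i) φ).re with ht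
  set η : H := ∑ i, t i • r i φ with hη
  have hηn : ‖η‖ ^ 2 = (∑ i, t i ^ 2) * ‖φ‖ ^ 2 := h.norm_sq_sum_smul t φ
  set ξ : Fin 4 → H := fun i ↦ t i • φ + (1 / 4 : ℝ) • r i η with hξ
  have hre : ∀ (c : ℝ) (a b : H), (inner ℂ a (c • b)).re = c * (inner ℂ a b).re := fun c a b ↦
    map_smul (reInner H a) c b
  have h1 : ∑ i, (inner ℂ (ψ i) (ξ i)).re = ∑ i, t i ^ 2 := by
    have e : ∀ i, (inner ℂ (ψ i) (ξ i)).re = t i ^ 2 + 1 / 4 * (inner ℂ (ψ i) (r i η)).re :=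
      fun i ↦ by
        simp only [hξ]
        rw [inner_add_right, Complex.add_re, hre, hre]
        simp only [ht]
        ring
    simp only [e, Finset.sum_add_distrib, ← Finset.mul_sum]
    rw [h.sum_inner_apply, hψ]
    simp
  have h2 : ∑ i, ‖ξ i‖ ^ 2 = 3 / 4 * ((∑ i, t i ^ 2) * ‖φ‖ ^ 2) := by
    have e : ∀ i, ‖ξ i‖ ^ 2 = t i ^ 2 * ‖φ‖ ^ 2 + 1 / 2 * (inner ℂ (t i • φ) (r i η)).re
        + 1 / 16 * ‖η‖ ^ 2 := fun i ↦ by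
      have := norm_add_sq (𝕜 := ℂ) (t i • φ) ((1 / 4 : ℝ) • r i η)
      change ‖ξ i‖ ^ 2 = _ + 2 * (inner ℂ (t i • φ) ((1 / 4 : ℝ) • r i η)).re + _ at this
      rw [this, hre, norm_smul, norm_smul, h.norm_apply, mul_pow, mul_pow, Real.norm_eq_abs,
        Real.norm_eq_abs, sq_abs, sq_abs]
      ring
    simp only [e, Finset.sum_add_distrib, ← Finset.mul_sum, ← Finset.sum_mul]
    rw [h.sum_inner_apply]
    have e2 : ∑ i, r i (t i • φ) = η := by
      simp only [map_real_smul, hη]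
    have e3 : (inner ℂ η η : ℂ).re = ‖η‖ ^ 2 := inner_self_eq_norm_sq (𝕜 := ℂ) η
    rw [e2, e3, hηn]
    simp
    ring
  have h3 : (∑ i, t i ^ 2) ^ 2 ≤ (∑ i, ‖ψ i‖ ^ 2) * ∑ i, ‖ξ i‖ ^ 2 := by
    refine le_trans ?_ (Finset.sum_mul_sq_le_sq_mul_sq _ _ _)
    rw [← h1]
    refine sq_le_sq' ?_ ?_
    · rw [← Finset.sum_neg_distrib]
      exact Finset.sum_le_sum fun i _ ↦ (abs_le.1 ((Complex.abs_re_le_norm _).trans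
        (norm_inner_le_norm (𝕜 := ℂ) (ψ i) (ξ i)))).1
    · exact Finset.sum_le_sum fun i _ ↦ (abs_le.1 ((Complex.abs_re_le_norm _).trans
        (norm_inner_le_norm (𝕜 := ℂ) (ψ i) (ξ i)))).2
  rw [h2] at h3
  have h4 : 0 ≤ ∑ i, t i ^ 2 := by positivity
  rcases h4.eq_or_lt with h5 | h5
  · rw [← h5]
    positivity
  · refine le_of_mul_le_mul_right ?_ h5
    calc (∑ i, t i ^ 2) * ∑ i, t i ^ 2 = (∑ i, t i ^ 2) ^ 2 := by ring
      _ ≤ _ := h3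
      _ = _ := by ring

/-- The refined Kato inequality for the covariant derivatives `ψ_i` of an eigenspinor. -/
theorem kato (h : IsCliffordFamily r) (ψ : Fin 4 → H) (φ : H) (μ : ℝ)
    (hψ : ∑ i, r i (ψ i) = (μ : ℂ) • φ) :
    ∑ i, (inner ℂ (ψ i) φ).re ^ 2 ≤ 3 / 4 * ‖φ‖ ^ 2 * ∑ i, ‖ψ i‖ ^ 2 := by
  have hψ' : ∑ i, r i (ψ i) = μ • φ := hψ
  have hre : ∀ (c : ℝ) (a b : H), (inner ℂ a (c • b)).re = c * (inner ℂ a b).re := fun c a b ↦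
    map_smul (reInner H a) c b
  have hre' : ∀ (c : ℝ) (a b : H), (inner ℂ (c • a) b).re = c * (inner ℂ a b).re := fun c a b ↦ by
    have := congrArg (fun f ↦ f b) (map_smul (reInner H) c a)
    exact this
  have h1 := h.kato_of_sum_eq_zero (fun i ↦ ψ i + (μ / 4) • r i φ) φ (by
    simp only [map_add, map_real_smul, Finset.sum_add_distrib, hψ', h.sq, Finset.sum_const,
      Finset.card_univ, Fintype.card_fin]
    module)
  have h2 : ∀ i, (inner ℂ (ψ i + (μ / 4) • r i φ) φ).re = (inner ℂ (ψ i) φ).re := fun i ↦ by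
    rw [inner_add_left, Complex.add_re, hre', h.re_inner_self, mul_zero, add_zero]
  have h3 : ∑ i, ‖ψ i + (μ / 4) • r i φ‖ ^ 2 = ∑ i, ‖ψ i‖ ^ 2 - μ ^ 2 / 4 * ‖φ‖ ^ 2 := by
    have e : ∀ i, ‖ψ i + (μ / 4) • r i φ‖ ^ 2 = ‖ψ i‖ ^ 2 + μ / 2 * (inner ℂ (ψ i) (r i φ)).re
        + μ ^ 2 / 16 * ‖φ‖ ^ 2 := fun i ↦ by
      have := norm_add_sq (𝕜 := ℂ) (ψ i) ((μ / 4) • r i φ)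
      change _ = _ + 2 * (inner ℂ (ψ i) ((μ / 4) • r i φ)).re + _ at this
      rw [this, hre, norm_smul, h.norm_apply, mul_pow, Real.norm_eq_abs, sq_abs]
      ring
    simp only [e, Finset.sum_add_distrib, ← Finset.mul_sum]
    rw [h.sum_inner_apply, hψ', hre']
    have e3 : (inner ℂ φ φ : ℂ).re = ‖φ‖ ^ 2 := inner_self_eq_norm_sq (𝕜 := ℂ) φ
    rw [e3]
    simp
    ring
  simp only [h2, h3] at h1
  refine h1.trans ?_
  have : 0 ≤ μ ^ 2 / 4 * ‖φ‖ ^ 2 := by positivity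
  gcongr
  linarith

/-- The contraction of a tensor with the Bianchi identity by three Clifford multiplications. -/
theorem sum_bianchi (h : IsCliffordFamily r) (R : Fin 4 → Fin 4 → Fin 4 → ℝ)
    (hskew : ∀ k i a, R k i a = - R i k a) (hB : ∀ k i a, R k i a + R i a k + R a k i = 0) (v : H) :
    ∑ k, ∑ i, ∑ a, R k i a • r k (r i (r a v)) = (-2 : ℝ) • ∑ k, ∑ i, R k i i • r k v := by
  have hself : ∀ k a, R k k a = 0 := fun k a ↦ by linarith [hskew k k a]
  set X := ∑ k, ∑ i, ∑ a, R k i a • r k (r i (r a v)) with hX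
  set Y := ∑ k, ∑ i, R k i i • r k v with hY
  have hY' : ∑ k, ∑ i, R k i k • r i v = - Y := by
    rw [hY, Finset.sum_comm, ← Finset.sum_neg_distrib]
    refine Finset.sum_congr rfl fun i _ ↦ ?_
    rw [← Finset.sum_neg_distrib]
    refine Finset.sum_congr rfl fun k _ ↦ ?_
    rw [hskew, neg_smul]
  -- cyclic permutations of the three Clifford multiplications, up to lower order terms
  have c1 : ∀ k i a, r i (r a (r k v)) = r k (r i (r a v)) + (if i = k then (2 : ℝ) else 0) • r a v
      - (if a = k then (2 : ℝ) else 0) • r i v := fun k i a ↦ by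
    rw [h.comm a k v, map_sub, map_neg, map_real_smul, h.comm i k (r a v)]
    abel
  have c2 : ∀ k i a, r a (r k (r i v)) = r k (r i (r a v)) + (if a = i then (2 : ℝ) else 0) • r k v
      - (if a = k then (2 : ℝ) else 0) • r i v := fun k i a ↦ by
    rw [h.comm a k (r i v), h.comm a i v, map_sub, map_neg, map_real_smul]
    abel
  have h1 : ∑ k, ∑ i, ∑ a, R k i a • r i (r a (r k v)) = X + (2 : ℝ) • Y := by
    refine Eq.trans (Finset.sum_congr rfl fun k _ ↦ Finset.sum_congr rfl fun i _ ↦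
      Finset.sum_congr rfl fun a _ ↦ congrArg (R k i a • ·) (c1 k i a)) ?_
    simp only [smul_sub, smul_add, Finset.sum_sub_distrib, Finset.sum_add_distrib, ← hX,
      ite_smul, zero_smul, smul_ite, smul_zero, Finset.sum_ite_eq', Finset.mem_univ, if_true]
    have e1 : ∑ k, ∑ i, ∑ a, (if i = k then R k i a • (2 : ℝ) • r a v else 0) = 0 := by
      refine Finset.sum_eq_zero fun k _ ↦ Finset.sum_eq_zero fun i _ ↦ Finset.sum_eq_zero fun a _ ↦ ?_
      split_ifs with hik
      · rw [hik, hself, zero_smul]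
      · rfl
    have e2 : ∑ k, ∑ i, R k i k • (2 : ℝ) • r i v = (2 : ℝ) • -Y := by
      rw [← hY']
      simp only [Finset.smul_sum]
      exact Finset.sum_congr rfl fun k _ ↦ Finset.sum_congr rfl fun i _ ↦ smul_comm _ _ _
    rw [e1, e2]
    module
  have h2 : ∑ k, ∑ i, ∑ a, R k i a • r a (r k (r i v)) = X + (4 : ℝ) • Y := by
    refine Eq.trans (Finset.sum_congr rfl fun k _ ↦ Finset.sum_congr rfl fun i _ ↦
      Finset.sum_congr rfl fun a _ ↦ congrArg (R k i a • ·) (c2 k i a)) ?_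
    simp only [smul_sub, smul_add, Finset.sum_sub_distrib, Finset.sum_add_distrib, ← hX,
      ite_smul, zero_smul, smul_ite, smul_zero, Finset.sum_ite_eq', Finset.mem_univ, if_true]
    have e1 : ∑ k, ∑ i, R k i i • (2 : ℝ) • r k v = (2 : ℝ) • Y := by
      rw [hY]
      simp only [Finset.smul_sum]
      exact Finset.sum_congr rfl fun k _ ↦ Finset.sum_congr rfl fun i _ ↦ smul_comm _ _ _
    have e2 : ∑ k, ∑ i, R k i k • (2 : ℝ) • r i v = (2 : ℝ) • -Y := by
      rw [← hY']
      simp only [Finset.smul_sum]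
      exact Finset.sum_congr rfl fun k _ ↦ Finset.sum_congr rfl fun i _ ↦ smul_comm _ _ _
    rw [e1, e2]
    module
  have h3 : ∑ k, ∑ i, ∑ a, R k i a • r i (r a (r k v))
      = ∑ k, ∑ i, ∑ a, R a k i • r k (r i (r a v)) := by
    rw [Finset.sum_comm]
    exact Finset.sum_congr rfl fun k _ ↦ Finset.sum_comm
  have h4 : ∑ k, ∑ i, ∑ a, R k i a • r a (r k (r i v))
      = ∑ k, ∑ i, ∑ a, R i a k • r k (r i (r a v)) := by
    refine Eq.trans (Finset.sum_congr rfl fun k _ ↦ Finset.sum_comm) ?_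
    exact Finset.sum_comm
  have h5 : X + (X + (4 : ℝ) • Y) + (X + (2 : ℝ) • Y) = 0 := by
    rw [← h1, ← h2, h3, h4]
    nth_rewrite 1 [hX]
    simp only [← Finset.sum_add_distrib, ← add_smul, hB, zero_smul, Finset.sum_const_zero]
  have h6 : (3 : ℝ) • (X - (-2 : ℝ) • Y) = 0 := by
    rw [← h5]
    module
  exact sub_eq_zero.1 ((smul_eq_zero.1 h6).resolve_left (by norm_num))

/-- The curvature term of the Lichnerowicz formula is the scalar curvature. -/
theorem re_inner_sum_curvature (h : IsCliffordFamily r) (R : Fin 4 → Fin 4 → Fin 4 → Fin 4 → ℝ)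
    (hskew : ∀ k i a b, R k i a b = - R i k a b)
    (hB : ∀ k i a b, R k i a b + R i a k b + R a k i b = 0) (v : H) :
    (inner ℂ (∑ k, ∑ i, ∑ a, ∑ b, R k i a b • r k (r i (r a (r b v)))) v).re
      = 2 * (∑ k, ∑ i, R k i i k) * ‖v‖ ^ 2 := by
  have e : ∑ k, ∑ i, ∑ a, ∑ b, R k i a b • r k (r i (r a (r b v)))
      = ∑ b, ∑ k, ∑ i, ∑ a, R k i a b • r k (r i (r a (r b v))) := by
    symm
    rw [Finset.sum_comm]
    refine Finset.sum_congr rfl fun k _ ↦ ?_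
    rw [Finset.sum_comm]
    exact Finset.sum_congr rfl fun i _ ↦ Finset.sum_comm
  rw [e]
  have e1 : ∀ b, ∑ k, ∑ i, ∑ a, R k i a b • r k (r i (r a (r b v)))
      = (-2 : ℝ) • ∑ k, ∑ i, R k i i b • r k (r b v) := fun b ↦
    h.sum_bianchi (fun k i a ↦ R k i a b) (fun k i a ↦ hskew k i a b) (fun k i a ↦ hB k i a b) _
  simp only [e1]
  have e2 : ∀ k b, (inner ℂ (r k (r b v)) v).re = if k = b then - ‖v‖ ^ 2 else 0 := fun k b ↦ by
    rw [h.re_inner_apply_left]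
    have := h.re_inner_apply_apply b k v
    rw [this]
    by_cases hkb : b = k
    · simp [hkb]
    · simp [hkb, Ne.symm hkb]
  change reInner H _ v = _
  simp only [map_sum, map_smul, LinearMap.sum_apply, LinearMap.smul_apply, reInner_apply, e2,
    smul_eq_mul, mul_ite, mul_zero]
  have e3 : ∀ b, ∑ k, ∑ i, (if k = b then R k i i b * - ‖v‖ ^ 2 else 0)
      = (∑ i, R b i i b) * - ‖v‖ ^ 2 := fun b ↦ by
    rw [Finset.sum_comm, Finset.sum_mul]
    simp
  simp only [e3]
  rw [← Finset.mul_sum, ← Finset.sum_mul]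
  ring

/-- A nonzero Clifford module with a grading `ε` contains an even vector that is a joint eigenvector
of the commuting operators `r₀ r₁` and `r₂ r₃`, both of square `-1`. -/
theorem exists_joint_eigenvector (h : IsCliffordFamily r) [Nontrivial H] {ε : H →ₗ[ℂ] H}
    (hε : ∀ a, ε (ε a) = a) (hεr : ∀ i a, ε (r i a) = - r i (ε a)) :
    ∃ (w : H) (α β : ℂ), w ≠ 0 ∧ ε w = w ∧ α ^ 2 = -1 ∧ β ^ 2 = -1 ∧
      r 1 w = α • r 0 w ∧ r 3 w = β • r 2 w := by
  have hzero : ∀ i a, r i a = 0 → a = 0 := fun i a ha ↦ by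
    have := h.norm_apply i a
    rw [ha, norm_zero] at this
    exact norm_eq_zero.1 this.symm
  have step0 : ∃ w : H, w ≠ 0 ∧ ε w = w := by
    obtain ⟨a, ha⟩ := exists_ne (0 : H)
    by_cases h1 : a + ε a = 0
    · have h2 : ε a = - a := by rw [← sub_eq_zero, sub_neg_eq_add, add_comm, h1]
      exact ⟨r 0 a, fun h3 ↦ ha (hzero 0 a h3), by rw [hεr, h2, map_neg, neg_neg]⟩
    · exact ⟨a + ε a, h1, by rw [map_add, hε, add_comm]⟩
  obtain ⟨a, ha, hεa⟩ := step0
  -- either `r₁ a = i r₀ a`, or `(r₀ r₁ + i) a ≠ 0` is an eigenvector for the other eigenvalue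
  have step1 : ∃ (w : H) (α : ℂ), w ≠ 0 ∧ ε w = w ∧ α ^ 2 = -1 ∧ r 1 w = α • r 0 w := by
    by_cases h1 : r 1 a - Complex.I • r 0 a = 0
    · exact ⟨a, Complex.I, ha, hεa, by simp, sub_eq_zero.1 h1⟩
    · refine ⟨r 0 (r 1 a - Complex.I • r 0 a), -Complex.I, fun h2 ↦ h1 (hzero 0 _ h2), ?_,
        by simp, ?_⟩
      · simp only [map_sub, map_smul, hεr, map_neg, hεa, neg_neg]
      · simp only [map_sub, map_smul, h.sq, h.anti 1 0 (by decide), map_neg]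
        simp only [smul_sub, smul_neg, neg_smul, smul_smul, neg_mul, Complex.I_mul_I]
        simp
        abel
  obtain ⟨b, α, hb, hεb, hα, hbα⟩ := step1
  by_cases h1 : r 3 b - Complex.I • r 2 b = 0
  · exact ⟨b, α, Complex.I, hb, hεb, hα, by simp, hbα, sub_eq_zero.1 h1⟩
  · refine ⟨r 2 (r 3 b - Complex.I • r 2 b), α, -Complex.I, fun h2 ↦ h1 (hzero 2 _ h2), ?_, hα,
      by simp, ?_, ?_⟩
    · simp only [map_sub, map_smul, hεr, map_neg, hεb, neg_neg]
    · have e1 : r 1 (r 2 (r 3 b)) = r 2 (r 3 (r 1 b)) := by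
        rw [h.anti 1 2 (by decide), h.anti 1 3 (by decide), map_neg, neg_neg]
      have e0 : r 0 (r 2 (r 3 b)) = r 2 (r 3 (r 0 b)) := by
        rw [h.anti 0 2 (by decide), h.anti 0 3 (by decide), map_neg, neg_neg]
      simp only [map_sub, map_smul, h.sq, e1, e0, hbα, map_neg, smul_sub, smul_neg]
      rw [smul_comm α Complex.I]
    · simp only [map_sub, map_smul, h.sq, h.anti 3 2 (by decide), map_neg]
      simp only [smul_sub, smul_neg, neg_smul, smul_smul, neg_mul, Complex.I_mul_I]
      simp
      abel

section JointEigenvector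

variable {w : H} {α β : ℂ}

theorem one_zero_apply (h : IsCliffordFamily r) (h1 : r 1 w = α • r 0 w) :
    r 1 (r 0 w) = α • w := by
  rw [h.anti 1 0 (by decide), h1, map_smul, h.sq, smul_neg, neg_neg]

theorem three_two_apply (h : IsCliffordFamily r) (h3 : r 3 w = β • r 2 w) :
    r 3 (r 2 w) = β • w := by
  rw [h.anti 3 2 (by decide), h3, map_smul, h.sq, smul_neg, neg_neg]

theorem three_zero_apply (h : IsCliffordFamily r) (h3 : r 3 w = β • r 2 w) :
    r 3 (r 0 w) = - β • r 0 (r 2 w) := by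
  rw [h.anti 3 0 (by decide), h3, map_smul, neg_smul]

theorem one_two_apply (h : IsCliffordFamily r) (h1 : r 1 w = α • r 0 w) :
    r 1 (r 2 w) = α • r 0 (r 2 w) := by
  rw [h.anti 1 2 (by decide), h1, map_smul, h.anti 2 0 (by decide), smul_neg, neg_neg]

theorem one_zero_two_apply (h : IsCliffordFamily r) (h1 : r 1 w = α • r 0 w) :
    r 1 (r 0 (r 2 w)) = α • r 2 w := by
  rw [h.anti 1 0 (by decide), h.one_two_apply h1, map_smul, h.sq, smul_neg, neg_neg]

theorem two_zero_two_apply (h : IsCliffordFamily r) : r 2 (r 0 (r 2 w)) = r 0 w := by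
  rw [h.anti 2 0 (by decide), h.sq, map_neg, neg_neg]

theorem three_zero_two_apply (h : IsCliffordFamily r) (h3 : r 3 w = β • r 2 w) :
    r 3 (r 0 (r 2 w)) = - β • r 0 w := by
  rw [h.anti 3 0 (by decide), h.three_two_apply h3, map_smul, neg_smul]

/-- A joint eigenvector of `r₀ r₁` and `r₂ r₃` generates four independent vectors, which are
distinguished by their eigenvalues. -/
theorem linearIndependent_of_joint_eigenvector (h : IsCliffordFamily r)
    (hw : w ≠ 0) (hα : α ^ 2 = -1) (hβ : β ^ 2 = -1) (h1 : r 1 w = α • r 0 w)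
    (h3 : r 3 w = β • r 2 w) : LinearIndependent ℂ ![w, r 0 w, r 2 w, r 0 (r 2 w)] := by
  have hα0 : α ≠ 0 := fun h0 ↦ by simp [h0] at hα
  have hβ0 : β ≠ 0 := fun h0 ↦ by simp [h0] at hβ
  have hzero : ∀ i a, r i a = 0 → a = 0 := fun i a ha ↦ by
    have := h.norm_apply i a
    rw [ha, norm_zero] at this
    exact norm_eq_zero.1 this.symm
  have half : ∀ {γ : ℂ} {p q : H}, γ ≠ 0 → p + q = 0 → γ • p - γ • q = 0 → p = 0 ∧ q = 0 := by
    intro γ p q hγ e1 e2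
    rw [← smul_sub] at e2
    have e3 := (smul_eq_zero.1 e2).resolve_left hγ
    have e4 : (2 : ℂ) • p = 0 := by
      rw [two_smul]
      calc p + p = (p + q) + (p - q) := by abel
        _ = 0 := by rw [e1, e3, add_zero]
    have e5 := (smul_eq_zero.1 e4).resolve_left two_ne_zero
    exact ⟨e5, by simpa [e5] using e1⟩
  rw [Fintype.linearIndependent_iff]
  intro g hg
  simp only [Fin.sum_univ_four, Matrix.cons_val] at hg
  have e1 := congrArg (fun z ↦ r 1 (r 0 z)) hg
  simp only [map_add, map_smul, h.sq, h.one_zero_apply h1, h1, h.one_zero_two_apply h1, map_neg,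
    h.one_two_apply h1, map_zero, smul_neg] at e1
  obtain ⟨p1, p2⟩ := half (p := g 0 • w + g 2 • r 2 w) (q := g 1 • r 0 w + g 3 • r 0 (r 2 w)) hα0
    (by rw [← hg]; abel) (by rw [← e1]; module)
  have e2 := congrArg (fun z ↦ r 3 (r 2 z)) p1
  simp only [map_add, map_smul, h.sq, h.three_two_apply h3, h3, map_neg, map_zero, smul_neg] at e2
  have e3 := congrArg (fun z ↦ r 3 (r 2 (r 0 z))) p2
  simp only [map_add, map_smul, h.sq, h.three_two_apply h3, h3, map_neg, map_zero, smul_neg] at e3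
  obtain ⟨q0, q2⟩ := half hβ0 p1 (by rw [← e2]; module)
  obtain ⟨q1, q3⟩ := half hβ0 (p := g 1 • w) (q := g 3 • r 2 w)
    (hzero 0 _ (by rw [← p2, map_add, map_smul, map_smul]))
    (by rw [← neg_eq_zero, ← e3]; module)
  intro i
  have r2 : r 2 w ≠ 0 := fun h0 ↦ hw (hzero 2 _ h0)
  fin_cases i
  exacts [(smul_eq_zero.1 q0).resolve_right hw, (smul_eq_zero.1 q1).resolve_right hw,
    (smul_eq_zero.1 q2).resolve_right r2, (smul_eq_zero.1 q3).resolve_right r2]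

/-- Schur's lemma for the Clifford module of rank four. -/
theorem exists_eq_smul_of_commute (h : IsCliffordFamily r) (hrank : Module.finrank ℂ H = 4)
    (hw : w ≠ 0) (hα : α ^ 2 = -1) (hβ : β ^ 2 = -1) (h1 : r 1 w = α • r 0 w)
    (h3 : r 3 w = β • r 2 w) (T : H →ₗ[ℂ] H) (hT : ∀ i a, T (r i a) = r i (T a)) :
    ∃ t : ℂ, ∀ a, T a = t • a := by
  have hli := h.linearIndependent_of_joint_eigenvector hw hα hβ h1 h3
  have hspan : ∀ z : H, ∃ g : Fin 4 → ℂ,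
      z = g 0 • w + g 1 • r 0 w + g 2 • r 2 w + g 3 • r 0 (r 2 w) := fun z ↦ by
    let b := basisOfLinearIndependentOfCardEqFinrank hli (by simp [hrank])
    refine ⟨b.repr z, ?_⟩
    conv_lhs => rw [← b.sum_repr z]
    simp [Fin.sum_univ_four, b]
  have hcoeff : ∀ g : Fin 4 → ℂ,
      g 0 • w + g 1 • r 0 w + g 2 • r 2 w + g 3 • r 0 (r 2 w) = 0 → ∀ i, g i = 0 := fun g hg ↦ by
    refine Fintype.linearIndependent_iff.1 hli g ?_
    simpa [Fin.sum_univ_four] using hg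
  have hα0 : α ≠ 0 := fun h0 ↦ by simp [h0] at hα
  have hβ0 : β ≠ 0 := fun h0 ↦ by simp [h0] at hβ
  obtain ⟨g, hg⟩ := hspan (T w)
  have e1 : r 1 (T w) = α • r 0 (T w) := by rw [← hT, h1, map_smul, hT]
  have e2 : r 3 (T w) = β • r 2 (T w) := by rw [← hT, h3, map_smul, hT]
  rw [hg] at e1 e2
  simp only [map_add, map_smul, h.sq, h.one_zero_apply h1, h1, h.one_zero_two_apply h1,
    h.one_two_apply h1, smul_neg] at e1
  simp only [map_add, map_smul, h.sq, h.three_zero_apply h3, h3, h.three_zero_two_apply h3,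
    h.three_two_apply h3, smul_neg, h.two_zero_two_apply, h.anti 2 0 (by decide) w] at e2
  have f1 := hcoeff ![2 * α * g 1, 0, 2 * α * g 3, 0] (by
    simp only [Matrix.cons_val]
    rw [← sub_eq_zero] at e1
    rw [← e1]
    module)
  have f2 := hcoeff ![2 * β * g 2, - (2 * β * g 3), 0, 0] (by
    simp only [Matrix.cons_val]
    rw [← sub_eq_zero] at e2
    rw [← e2]
    module)
  have g1 : g 1 = 0 := by simpa [hα0] using f1 0
  have g3 : g 3 = 0 := by simpa [hα0] using f1 2
  have g2 : g 2 = 0 := by simpa [hβ0] using f2 0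
  have hTw : T w = g 0 • w := by rw [hg, g1, g2, g3]; simp
  refine ⟨g 0, fun z ↦ ?_⟩
  obtain ⟨c, rfl⟩ := hspan z
  simp only [map_add, map_smul, hT, hTw, smul_add]
  simp only [smul_comm (g 0)]

variable {L : Type*} [NormedAddCommGroup L] [NormedSpace ℂ L]

/-- The operators `r_k r_l`, `k ≠ l`, have trace zero on the even part of the module. -/
theorem wedge_trace_eq_zero (h : IsCliffordFamily r)
    (h1 : r 1 w = α • r 0 w) (h3 : r 3 w = β • r 2 w) (B : H →ₗ[ℂ] H →ₗ[ℂ] L)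
    (hB : ∀ a, B a a = 0) (k l : Fin 4) (hkl : k ≠ l) :
    B (r k (r l w)) (r 0 (r 2 w)) + B w (r k (r l (r 0 (r 2 w)))) = 0 := by
  have e20 := h.anti 2 0 (by decide) w
  fin_cases k <;> fin_cases l <;> first | exact absurd rfl hkl | skip
  all_goals
    simp only [Fin.zero_eta, Fin.mk_one, Fin.reduceFinMk, h1, h3, map_smul, h.sq,
      h.one_zero_apply h1, h.three_two_apply h3, h.three_zero_apply h3, h.one_two_apply h1,
      h.one_zero_two_apply h1, h.two_zero_two_apply, h.three_zero_two_apply h3, map_neg, e20,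
      LinearMap.smul_apply, LinearMap.neg_apply, hB, smul_zero, smul_neg, neg_zero, add_zero,
      neg_smul, neg_neg, neg_add_cancel, add_neg_cancel]

/-- The vectors `w` and `r₀ r₂ w` are orthogonal, since they have different eigenvalues for the
skew-adjoint operator `r₁ r₀`. -/
theorem inner_zero_two_apply (h : IsCliffordFamily r) (hα : α ^ 2 = -1)
    (h1 : r 1 w = α • r 0 w) : inner ℂ w (r 0 (r 2 w)) = 0 := by
  have hα0 : α ≠ 0 := fun h0 ↦ by simp [h0] at hα
  have hc : (starRingEnd ℂ) α = - α := by
    have : α ^ 2 = Complex.I ^ 2 := by rw [hα, Complex.I_sq]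
    rcases sq_eq_sq_iff_eq_or_eq_neg.1 this with h | h <;> simp [h]
  have e1 : inner ℂ w (r 0 (r 1 (r 0 (r 2 w)))) = inner ℂ (r 1 (r 0 w)) (r 0 (r 2 w)) := by
    rw [h.skew 1, h.skew 0, neg_neg]
  rw [h.one_zero_two_apply h1, h.one_zero_apply h1, map_smul, inner_smul_right, inner_smul_left,
    hc] at e1
  have e2 : (2 * α) * inner ℂ w (r 0 (r 2 w)) = 0 := by linear_combination e1
  exact (mul_eq_zero.1 e2).resolve_left (mul_ne_zero two_ne_zero hα0)

end JointEigenvector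

variable {L : Type*} [NormedAddCommGroup L] [NormedSpace ℂ L]

/-- The operator `¼ ∑ R_{ab} r_a r_b` implements the infinitesimal rotation `R`: its commutator with
`r_c` is `∑ R_{cb} r_b`. -/
theorem commutator_quadratic (h : IsCliffordFamily r) {R : Fin 4 → Fin 4 → ℝ}
    (hR : ∀ a b, R a b = - R b a) (c : Fin 4) (v : H) :
    (1 / 4 : ℝ) • ∑ a, ∑ b, R a b • r a (r b (r c v))
      = ∑ b, R c b • r b v + r c ((1 / 4 : ℝ) • ∑ a, ∑ b, R a b • r a (r b v)) := by
  have e : ∀ a b, r a (r b (r c v)) = r c (r a (r b v)) - (if b = c then (2 : ℝ) else 0) • r a v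
      + (if a = c then (2 : ℝ) else 0) • r b v := fun a b ↦ by
    rw [h.comm b c v, map_sub, map_neg, map_real_smul, h.comm a c (r b v)]
    abel
  simp only [e, smul_sub, smul_add, Finset.sum_sub_distrib, Finset.sum_add_distrib, map_real_smul,
    map_sum, ite_smul, zero_smul, smul_ite, smul_zero, Finset.sum_ite_eq', Finset.mem_univ, if_true]
  have e1 : ∑ a, R a c • (2 : ℝ) • r a v = - ((2 : ℝ) • ∑ b, R c b • r b v) := by
    rw [Finset.smul_sum, ← Finset.sum_neg_distrib]
    refine Finset.sum_congr rfl fun a _ ↦ ?_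
    rw [hR a c, neg_smul, smul_comm]
  have e2 : ∑ a, ∑ b, (if a = c then R a b • (2 : ℝ) • r b v else 0)
      = (2 : ℝ) • ∑ b, R c b • r b v := by
    rw [Finset.sum_comm, Finset.smul_sum]
    refine Finset.sum_congr rfl fun b _ ↦ ?_
    simp [smul_comm (2 : ℝ)]
  rw [e1, e2]
  module

/-- An endomorphism `T` of the spinor module whose commutator with Clifford multiplication is the
infinitesimal rotation `R` is the Clifford action of `R` up to a scalar (Schur's lemma), and the
scalar is half the trace of `T` on the even part. -/
theorem exists_spin_curvature (h : IsCliffordFamily r) (hrank : Module.finrank ℂ H = 4)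
    {ε : H →ₗ[ℂ] H} (hε : ∀ a, ε (ε a) = a) (hεr : ∀ i a, ε (r i a) = - r i (ε a))
    {R : Fin 4 → Fin 4 → ℝ} (hR : ∀ a b, R a b = - R b a)
    (T : H →ₗ[ℂ] H) (hT : ∀ c a, T (r c a) = ∑ b, R c b • r b a + r c (T a))
    (B : H →ₗ[ℂ] H →ₗ[ℂ] L) (hB : ∀ a, B a a = 0)
    (hBn : ∀ a b, ε a = a → ε b = b → ‖B a b‖ ^ 2 = ‖a‖ ^ 2 * ‖b‖ ^ 2 - ‖(inner ℂ a b : ℂ)‖ ^ 2)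
    (f : L → L) (hf : ∀ a b, f (B a b) = B (T a) b + B a (T b)) {C : ℝ}
    (hC : ∀ l, ‖f l‖ ≤ C * ‖l‖) :
    ∃ t : ℂ, ‖t‖ ≤ C ∧ ∀ a, T a = (1 / 4 : ℝ) • ∑ k, ∑ l, R k l • r k (r l a) + t • a := by
  have : Nontrivial H := Module.nontrivial_of_finrank_pos (R := ℂ) (by rw [hrank]; norm_num)
  obtain ⟨w, α, β, hw, hεw, hα, hβ, h1, h3⟩ := h.exists_joint_eigenvector hε hεr
  let G : H →ₗ[ℂ] H := (1 / 4 : ℝ) • ∑ k, ∑ l, R k l • (r k ∘ₗ r l)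
  have hG : ∀ a, G a = (1 / 4 : ℝ) • ∑ k, ∑ l, R k l • r k (r l a) := fun a ↦ by
    simp [G, LinearMap.sum_apply]
  obtain ⟨t, ht⟩ := h.exists_eq_smul_of_commute hrank hw hα hβ h1 h3 (T - G) fun c a ↦ by
    rw [LinearMap.sub_apply, LinearMap.sub_apply, hT, hG, h.commutator_quadratic hR, map_sub, hG]
    abel
  have hTa : ∀ a, T a = G a + t • a := fun a ↦ by
    rw [← ht a, LinearMap.sub_apply]; abel
  refine ⟨t, ?_, fun a ↦ by rw [hTa, hG]⟩
  set z := r 0 (r 2 w) with hz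
  have hεz : ε z = z := by rw [hz, hεr, hεr, map_neg, neg_neg, hεw]
  have hnz : B w z ≠ 0 := fun h0 ↦ by
    have h2 := hBn w z hεw hεz
    rw [h0, h.inner_zero_two_apply hα h1, hz, h.norm_apply, h.norm_apply] at h2
    simp at h2
    exact hw h2
  have hGB : B (G w) z + B w (G z) = 0 := by
    rw [hG, hG]
    have s1 : ∀ (c : ℝ) (a b : H), B (c • a) b = c • B a b := fun c a b ↦ by
      rw [B.map_smul_of_tower]; rfl
    have s2 : ∀ (c : ℝ) (a b : H), B a (c • b) = c • B a b := fun c a b ↦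
      (B a).map_smul_of_tower c b
    simp only [s1, s2, map_sum, LinearMap.sum_apply]
    rw [← smul_add, ← Finset.sum_add_distrib]
    refine smul_eq_zero_of_right _ (Finset.sum_eq_zero fun k _ ↦ ?_)
    rw [← Finset.sum_add_distrib]
    refine Finset.sum_eq_zero fun l _ ↦ ?_
    rw [← smul_add]
    by_cases hkl : k = l
    · have : R k l = 0 := by
        have := hR k l
        rw [hkl] at this ⊢
        linarith
      rw [this, zero_smul]
    · rw [hz, h.wedge_trace_eq_zero h1 h3 B hB k l hkl, smul_zero]
  have hft : f (B w z) = (2 * t) • B w z := by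
    rw [hf, hTa, hTa]
    simp only [map_add, LinearMap.add_apply, map_smul, LinearMap.smul_apply]
    rw [show B (G w) z + t • B w z + (B w (G z) + t • B w z)
      = (B (G w) z + B w (G z)) + (2 * t) • B w z by module, hGB, zero_add]
  have h5 := hC (B w z)
  rw [hft, norm_smul, norm_mul] at h5
  have h6 := le_of_mul_le_mul_right h5 (norm_pos_iff.2 hnz)
  have h7 : ‖(2 : ℂ)‖ = 2 := by simp
  rw [h7] at h6
  linarith [norm_nonneg t]

end IsCliffordFamily

theorem isCliffordFamily_of_orthonormal {T : Type*} [NormedAddCommGroup T] [InnerProductSpace ℝ T]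
    (ρ : T →ₗ[ℝ] H →ₗ[ℂ] H) (hskew : ∀ v a b, inner ℂ (ρ v a) b = - inner ℂ a (ρ v b))
    (hsq : ∀ v a, ρ v (ρ v a) = - ((‖v‖ ^ 2 : ℝ) : ℂ) • a) (e : OrthonormalBasis (Fin 4) ℝ T) :
    IsCliffordFamily fun i ↦ ρ (e i) where
  skew i a b := hskew (e i) a b
  sq i a := by simp [hsq]
  anti i j hij a := by
    have h1 := hsq (e i + e j) a
    have h2 : ‖e i + e j‖ ^ 2 = ‖e i‖ ^ 2 + ‖e j‖ ^ 2 := by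
      rw [norm_add_sq_real, e.inner_eq_zero hij]
      ring
    simp only [map_add, LinearMap.add_apply, hsq, h2, Complex.ofReal_add, neg_add, add_smul] at h1
    rw [← add_eq_zero_iff_eq_neg]
    rw [← sub_eq_zero] at h1
    rw [← h1]
    abel

end Clifford

/-! ### Operator norms -/

section OperatorNorms

/-- The operator norm is at most the Hilbert-Schmidt norm. -/
theorem norm_apply_le_hilbertSchmidt {ι E E' : Type*} [Fintype ι] [NormedAddCommGroup E]
    [InnerProductSpace ℂ E] [NormedAddCommGroup E'] [InnerProductSpace ℂ E'] (T : E →ₗ[ℂ] E')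
    (b : OrthonormalBasis ι ℂ E) {C : ℝ} (hC : 0 ≤ C) (h : ∑ a, ‖T (b a)‖ ^ 2 ≤ C ^ 2) (v : E) :
    ‖T v‖ ≤ C * ‖v‖ := by
  have h1 : ‖T v‖ ≤ ∑ a, ‖inner ℂ (b a) v‖ * ‖T (b a)‖ := by
    conv_lhs => rw [← b.sum_repr' v, map_sum]
    refine (norm_sum_le _ _).trans (le_of_eq (Finset.sum_congr rfl fun a _ ↦ ?_))
    rw [map_smul, norm_smul]
  have h2 := Finset.sum_mul_sq_le_sq_mul_sq Finset.univ (fun a ↦ ‖inner ℂ (b a) v‖)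
    fun a ↦ ‖T (b a)‖
  rw [b.sum_sq_norm_inner_right] at h2
  have h3 : (∑ a, ‖inner ℂ (b a) v‖ * ‖T (b a)‖) ^ 2 ≤ (C * ‖v‖) ^ 2 := by
    rw [mul_pow, mul_comm (C ^ 2)]
    exact h2.trans (mul_le_mul_of_nonneg_left h (by positivity))
  exact h1.trans (le_of_sq_le_sq h3 (by positivity))

theorem norm_lTensor_apply_le {W E : Type*} [NormedAddCommGroup W] [InnerProductSpace ℂ W]
    [FiniteDimensional ℂ W] [NormedAddCommGroup E] [InnerProductSpace ℂ E] (T : E →ₗ[ℂ] E) {C : ℝ}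
    (hC : 0 ≤ C) (h : ∀ v, ‖T v‖ ≤ C * ‖v‖) (φ : W ⊗[ℂ] E) : ‖T.lTensor W φ‖ ≤ C * ‖φ‖ := by
  let b := stdOrthonormalBasis ℂ W
  have hexp : ∃ ξ : Fin (Module.finrank ℂ W) → E, φ = ∑ a, b a ⊗ₜ ξ a := by
    induction φ using TensorProduct.induction_on with
    | zero => exact ⟨0, by simp⟩
    | add p q hp hq =>
      obtain ⟨ξ, rfl⟩ := hp
      obtain ⟨ξ', rfl⟩ := hq
      exact ⟨ξ + ξ', by simp [TensorProduct.tmul_add, Finset.sum_add_distrib]⟩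
    | tmul w e =>
      refine ⟨fun a ↦ inner ℂ (b a) w • e, ?_⟩
      conv_lhs => rw [← b.sum_repr' w, TensorProduct.sum_tmul]
      exact Finset.sum_congr rfl fun a _ ↦ TensorProduct.smul_tmul _ _ _
  have hn : ∀ ξ : Fin (Module.finrank ℂ W) → E, ‖∑ a, b a ⊗ₜ[ℂ] ξ a‖ ^ 2 = ∑ a, ‖ξ a‖ ^ 2 := by
    intro ξ
    have h1 : ‖∑ a, b a ⊗ₜ[ℂ] ξ a‖ ^ 2 = (inner ℂ (∑ a, b a ⊗ₜ[ℂ] ξ a) (∑ a, b a ⊗ₜ[ℂ] ξ a)).re :=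
      (inner_self_eq_norm_sq (𝕜 := ℂ) _).symm
    have h2 : ∀ a, (inner ℂ (ξ a) (ξ a)).re = ‖ξ a‖ ^ 2 := fun a ↦ inner_self_eq_norm_sq (𝕜 := ℂ) _
    rw [h1, inner_sum_sum]
    simp only [TensorProduct.inner_tmul, orthonormal_iff_ite.1 b.orthonormal, ite_mul, one_mul,
      zero_mul, Finset.sum_ite_eq, Finset.mem_univ, if_true, Complex.re_sum, h2]
  obtain ⟨ξ, rfl⟩ := hexp
  have h3 : ‖T.lTensor W (∑ a, b a ⊗ₜ[ℂ] ξ a)‖ ^ 2 ≤ (C * ‖∑ a, b a ⊗ₜ[ℂ] ξ a‖) ^ 2 := by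
    rw [map_sum]
    simp only [LinearMap.lTensor_tmul]
    rw [hn fun a ↦ T (ξ a), mul_pow, hn, Finset.mul_sum]
    refine Finset.sum_le_sum fun a _ ↦ ?_
    rw [← mul_pow]
    exact pow_le_pow_left₀ (norm_nonneg _) (h _) 2
  exact le_of_sq_le_sq h3 (by positivity)

end OperatorNorms

/-! ### The Weitzenböck formula -/

section Weitzenbock

theorem re_inner_comm {H : Type*} [NormedAddCommGroup H] [InnerProductSpace ℂ H] (a b : H) :
    (inner ℂ a b).re = (inner ℂ b a).re := inner_re_symm (𝕜 := ℂ) a b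

variable {X : Type*} [TopologicalSpace X] [ChartedSpace R4 X] [IsManifold (𝓡 4) ∞ X] [T2Space X]
  [RiemannianBundle (fun x : X ↦ TangentSpace (𝓡 4) x)]
  [IsContMDiffRiemannianBundle (𝓡 4) ∞ R4 (fun x : X ↦ TangentSpace (𝓡 4) x)]
  {FW : Type*} [NormedAddCommGroup FW] [NormedSpace ℂ FW] [FiniteDimensional ℂ FW]
  {W : X → Type*} [∀ x, NormedAddCommGroup (W x)] [∀ x, InnerProductSpace ℂ (W x)]
  [TopologicalSpace (TotalSpace FW W)] [FiberBundle FW W] [VectorBundle ℂ FW W]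
  [VectorBundle ℝ FW W] [ContMDiffVectorBundle ∞ FW W (𝓡 4)] [IsSmoothHermitianBundle FW W]
  {FL : Type*} [NormedAddCommGroup FL] [NormedSpace ℂ FL] [FiniteDimensional ℂ FL]
  {L : X → Type*} [∀ x, NormedAddCommGroup (L x)] [∀ x, InnerProductSpace ℂ (L x)]
  [TopologicalSpace (TotalSpace FL L)] [FiberBundle FL L] [VectorBundle ℂ FL L]
  [VectorBundle ℝ FL L] [ContMDiffVectorBundle ∞ FL L (𝓡 4)] [IsSmoothHermitianBundle FL L]
  {FE : Type*} [NormedAddCommGroup FE] [NormedSpace ℂ FE] [FiniteDimensional ℂ FE]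
  {E : X → Type*} [∀ x, NormedAddCommGroup (E x)] [∀ x, InnerProductSpace ℂ (E x)]
  [TopologicalSpace (TotalSpace FE E)] [FiberBundle FE E] [VectorBundle ℂ FE E]
  [VectorBundle ℝ FE E] [ContMDiffVectorBundle ∞ FE E (𝓡 4)] [IsSmoothHermitianBundle FE E]
  {S : SpincStructure FW W} {δ : DeterminantLine FL L S}
  {covX : CovariantDerivative (𝓡 4) R4 (fun x : X ↦ TangentSpace (𝓡 4) x)}
  {Ad : CovariantDerivative (𝓡 4) FL L} {covW : CovariantDerivative (𝓡 4) FW W}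
  {A : CovariantDerivative (𝓡 4) FE E}

theorem IsUnitaryConnection.norm_curvatureAt_le {cov : CovariantDerivative (𝓡 4) FE E}
    (h : IsUnitaryConnection cov) (x : X)
    (e : OrthonormalBasis (Fin 4) ℝ (TangentSpace (𝓡 4) x)) (i j : Fin 4) (v : E x) :
    ‖curvatureAt cov x (e i) (e j) v‖ ≤ curvatureNorm cov x * ‖v‖ := by
  have hfin : FiniteDimensional ℂ (E x) := finiteDimensional_fiber FE E x
  have h0 : 0 ≤ curvatureNorm cov x := Real.sqrt_nonneg _
  by_cases hij : i = j
  · subst hij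
    have h1 := h.isCompatibleWith.curvatureAt_swap x (e i) (e i) v
    have h2 : (2 : ℝ) • curvatureAt cov x (e i) (e i) v = 0 := by
      rw [two_smul]
      nth_rewrite 1 [h1]
      exact neg_add_cancel _
    rw [(smul_eq_zero.1 h2).resolve_left two_ne_zero, norm_zero]
    positivity
  let b := stdOrthonormalBasis ℂ (E x)
  refine norm_apply_le_hilbertSchmidt (h.curvatureEnd x (e i) (e j)) b h0 ?_ v
  rw [h.curvatureNorm_sq x e b]
  let f : Fin 4 → Fin 4 → ℝ := fun i j ↦ ∑ a, ‖curvatureAt cov x (e i) (e j) (b a)‖ ^ 2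
  have hf : ∀ i j, 0 ≤ f i j := fun i j ↦ by positivity
  have hsymm : f i j = f j i := by
    refine Finset.sum_congr rfl fun a _ ↦ ?_
    rw [h.isCompatibleWith.curvatureAt_swap, norm_neg]
  change f i j ≤ 2⁻¹ * ∑ i, ∑ j, f i j
  have h1 : f i j + f j i ≤ ∑ i, ∑ j, f i j := by
    have h2 : ∑ k ∈ {i, j}, ∑ l, f k l ≤ ∑ k, ∑ l, f k l :=
      Finset.sum_le_sum_of_subset_of_nonneg (Finset.subset_univ _)
        fun k _ _ ↦ Finset.sum_nonneg fun l _ ↦ hf k l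
    rw [Finset.sum_pair hij] at h2
    have h3 := Finset.single_le_sum (f := f i) (fun l _ ↦ hf i l) (Finset.mem_univ j)
    have h4 := Finset.single_le_sum (f := f j) (fun l _ ↦ hf j l) (Finset.mem_univ i)
    linarith
  linarith

theorem SpincStructure.isCliffordFamily_ρ (S : SpincStructure FW W) (x : X)
    (e : OrthonormalBasis (Fin 4) ℝ (TangentSpace (𝓡 4) x)) :
    IsCliffordFamily fun i ↦ S.ρ x (e i) :=
  isCliffordFamily_of_orthonormal (S.ρ x) (S.ρ_skew x) (S.ρ_sq x) e

theorem SpincStructure.isCliffordFamily_tensorρ (S : SpincStructure FW W) (x : X)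
    (e : OrthonormalBasis (Fin 4) ℝ (TangentSpace (𝓡 4) x)) :
    IsCliffordFamily fun i ↦ S.tensorρ E x (e i) :=
  isCliffordFamily_of_orthonormal (S.tensorρ E x) (S.tensorρ_skew x) (S.tensorρ_sq x) e

/-- The curvature of the spin connection on `V = W ⊗ E`: the Riemann tensor acts by Clifford
multiplication, and what remains is a scalar that is bounded by the curvature of `det W⁺`. -/
theorem IsSpinConnection.rTensor_curvature (h : IsSpinConnection δ covX Ad covW)
    (hX : IsLeviCivita covX) (hd : IsUnitaryConnection Ad) (x : X)
    (e : OrthonormalBasis (Fin 4) ℝ (TangentSpace (𝓡 4) x)) (k i : Fin 4) :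
    ∃ t : ℂ, ‖t‖ ≤ curvatureNorm Ad x ∧ ∀ p : W x ⊗[ℂ] E x,
      (h.unitary.curvatureEnd x (e k) (e i)).rTensor (E x) p
        = (1 / 4 : ℝ) • ∑ a, ∑ b, inner ℝ (curvatureAt covX x (e k) (e i) (e a)) (e b) •
            S.tensorρ E x (e a) (S.tensorρ E x (e b) p) + t • p := by
  have hrank : Module.finrank ℂ (W x) = 4 := by
    rw [((trivializationAt FW W x).linearEquivAt ℂ x
      (FiberBundle.mem_baseSet_trivializationAt' x)).finrank_eq, S.rank_eq_four]
  obtain ⟨t, ht, hT⟩ := (S.isCliffordFamily_ρ x e).exists_spin_curvature hrank (S.ε_sq x)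
    (fun i a ↦ S.ε_ρ x (e i) a)
    (R := fun a b ↦ inner ℝ (curvatureAt covX x (e k) (e i) (e a)) (e b))
    (fun a b ↦ by
      have := hX.isCompatibleWith.curvatureAt_skew x (e k) (e i) (e a) (e b)
      rw [real_inner_comm (e a)]
      exact this)
    (h.unitary.curvatureEnd x (e k) (e i))
    (fun c a ↦ by
      simp only [IsUnitaryConnection.curvatureEnd_apply]
      rw [h.curvature_clifford hX]
      congr 1
      conv_lhs => rw [← e.sum_repr' (curvatureAt covX x (e k) (e i) (e c)), map_sum,
        LinearMap.sum_apply]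
      refine Finset.sum_congr rfl fun b _ ↦ ?_
      rw [map_smul, LinearMap.smul_apply, real_inner_comm])
    (δ.wedge x) (δ.wedge_self x) (δ.norm_wedge x) (curvatureAt Ad x (e k) (e i))
    (fun a b ↦ h.curvature_wedge hd x (e k) (e i) a b)
    (fun l ↦ hd.norm_curvatureAt_le x e k i l)
  refine ⟨t, ht, fun p ↦ ?_⟩
  induction p using TensorProduct.induction_on with
  | zero => simp
  | add p q hp hq =>
    simp only [map_add, hp, hq, smul_add, Finset.sum_add_distrib]
    abel
  | tmul a b =>
    rw [LinearMap.rTensor_tmul, hT]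
    simp only [SpincStructure.tensorρ_tmul, TensorProduct.add_tmul]
    rw [TensorProduct.smul_tmul']
    congr 1
    have hs : ∀ (c : ℝ) (w : W x), (c • w) ⊗ₜ[ℂ] b = c • (w ⊗ₜ[ℂ] b) := fun c w ↦
      (TensorProduct.smul_tmul' c w b).symm
    simp only [hs, TensorProduct.sum_tmul]

theorem mvfderiv_norm_sq (hW : IsUnitaryConnection covW) (hA : IsUnitaryConnection A)
    {φ : Π x, W x ⊗[ℂ] E x} (hφ : IsSmoothTensorSection FW FE φ) (x : X)
    (v : TangentSpace (𝓡 4) x) :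
    mvfderiv (𝓡 4) (fun y ↦ ‖φ y‖ ^ 2) x v = 2 * (inner ℂ (tensorCov covW A φ x v) (φ x)).re := by
  have e : (fun y ↦ ‖φ y‖ ^ 2) = fun y ↦ (inner ℂ (φ y) (φ y) : ℂ).re :=
    funext fun y ↦ (inner_self_eq_norm_sq (𝕜 := ℂ) (φ y)).symm
  rw [e, mvfderiv_re ((hφ.inner_smooth hφ).contMDiffAt.mdifferentiableAt (by simp)),
    mvfderiv_inner_tensor hW hA hφ hφ, Complex.add_re]
  have : (inner ℂ (φ x) (tensorCov covW A φ x v)).re = (inner ℂ (tensorCov covW A φ x v) (φ x)).re :=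
    re_inner_comm (φ x) (tensorCov covW A φ x v)
  linarith

theorem IsSmoothTensorSection.contMDiff_norm_sq {φ : Π x, W x ⊗[ℂ] E x}
    (hφ : IsSmoothTensorSection FW FE φ) : ContMDiff (𝓡 4) 𝓘(ℝ, ℝ) ∞ (fun y ↦ ‖φ y‖ ^ 2) := by
  have e : (fun y ↦ ‖φ y‖ ^ 2) = fun y ↦ (inner ℂ (φ y) (φ y) : ℂ).re :=
    funext fun y ↦ (inner_self_eq_norm_sq (𝕜 := ℂ) (φ y)).symm
  rw [e]
  exact contMDiff_re (hφ.inner_smooth hφ)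

variable (covX covW A) in
/-- The second covariant derivative `∇²_{U, Y} φ = ∇_U ∇_Y φ - ∇_{∇_U Y} φ`. -/
noncomputable def secondTensorCov (φ : Π x, W x ⊗[ℂ] E x) (U Y : Π x : X, TangentSpace (𝓡 4) x)
    (x : X) : W x ⊗[ℂ] E x :=
  tensorCov covW A (fun y ↦ tensorCov covW A φ y (Y y)) x (U x)
    - tensorCov covW A φ x (covX Y x (U x))

theorem hessianAt_norm_sq (hW : IsUnitaryConnection covW) (hA : IsUnitaryConnection A)
    {φ : Π x, W x ⊗[ℂ] E x} (hφ : IsSmoothTensorSection FW FE φ)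
    {Y : Π x : X, TangentSpace (𝓡 4) x} (hY : SmoothSec R4 Y) (x : X) :
    hessianAt covX (fun y ↦ ‖φ y‖ ^ 2) x (Y x) (Y x)
      = 2 * (inner ℂ (secondTensorCov covX covW A φ Y Y x) (φ x)).re
        + 2 * ‖tensorCov covW A φ x (Y x)‖ ^ 2 := by
  rw [hessianAt_eq hφ.contMDiff_norm_sq (hY x).diffSectionAt]
  have e : (fun y ↦ mvfderiv (𝓡 4) (fun y ↦ ‖φ y‖ ^ 2) y (Y y))
      = fun y ↦ (2 : ℝ) * (inner ℂ (tensorCov covW A φ y (Y y)) (φ y)).re :=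
    funext fun y ↦ mvfderiv_norm_sq hW hA hφ y (Y y)
  have hψ := hφ.tensorCov hW hA hY
  have hd : MDifferentiableAt (𝓡 4) 𝓘(ℝ, ℂ)
      (fun y ↦ inner ℂ (tensorCov covW A φ y (Y y)) (φ y)) x :=
    (hψ.inner_smooth hφ).contMDiffAt.mdifferentiableAt (by simp)
  have hdr : MDifferentiableAt (𝓡 4) 𝓘(ℝ, ℝ)
      (fun y ↦ (inner ℂ (tensorCov covW A φ y (Y y)) (φ y)).re) x :=
    (contMDiff_re (hψ.inner_smooth hφ)).contMDiffAt.mdifferentiableAt (by simp)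
  have hm : mvfderiv (𝓡 4) (fun y ↦ (2 : ℝ) * (inner ℂ (tensorCov covW A φ y (Y y)) (φ y)).re) x (Y x)
      = 2 * mvfderiv (𝓡 4) (fun y ↦ (inner ℂ (tensorCov covW A φ y (Y y)) (φ y)).re) x (Y x) := by
    have h1 := mvfderiv_mul (mdifferentiableAt_const (c := (2 : ℝ))) hdr
    refine (congrArg (fun L ↦ L (Y x)) h1).trans ?_
    rw [mvfderiv_const]
    simp
  rw [e, hm, mvfderiv_norm_sq hW hA hφ x]
  have h3 : (inner ℂ (tensorCov covW A φ x (Y x)) (tensorCov covW A φ x (Y x)) : ℂ).re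
      = ‖tensorCov covW A φ x (Y x)‖ ^ 2 :=
    inner_self_eq_norm_sq (𝕜 := ℂ) (tensorCov covW A φ x (Y x))
  rw [mvfderiv_re hd, mvfderiv_inner_tensor hW hA hψ hφ, secondTensorCov, inner_sub_left,
    Complex.add_re, Complex.sub_re, h3]
  ring

/-- The commutator of second covariant derivatives is the curvature. -/
theorem secondTensorCov_sub (hX : IsLeviCivita covX) (hW : IsUnitaryConnection covW)
    (hA : IsUnitaryConnection A) {φ : Π x, W x ⊗[ℂ] E x} (hφ : IsSmoothTensorSection FW FE φ)
    {U Y : Π x : X, TangentSpace (𝓡 4) x} (hU : SmoothSec R4 U) (hY : SmoothSec R4 Y) (x : X) :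
    secondTensorCov covX covW A φ U Y x - secondTensorCov covX covW A φ Y U x
      = (hW.curvatureEnd x (U x) (Y x)).rTensor (E x) (φ x)
        + (hA.curvatureEnd x (U x) (Y x)).lTensor (W x) (φ x) := by
  rw [← tensorCov_curvature hW hA hφ hU hY, hX.mlieBracket_eq (hU x).diffSectionAt
    (hY x).diffSectionAt]
  have := map_sub (tensorCovLinear covW A φ x) (covX Y x (U x)) (covX U x (Y x))
  change tensorCov covW A φ x _ = tensorCov covW A φ x _ - tensorCov covW A φ x _ at this
  rw [this, secondTensorCov, secondTensorCov]
  abel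

/-- The Weitzenböck formula for an eigensection of the Dirac operator, in a local orthonormal frame. -/
theorem IsSpinConnection.weitzenbock (h : IsSpinConnection δ covX Ad covW)
    (hX : IsLeviCivita covX) (hA : IsUnitaryConnection A) {φ : Π x, W x ⊗[ℂ] E x}
    (hφ : IsSmoothTensorSection FW FE φ) {μ : ℝ}
    (hD : ∀ x, dirac S covW A φ x = (μ : ℂ) • φ x) {x : X}
    {e : Fin 4 → Π y : X, TangentSpace (𝓡 4) y} (he : ∀ i, SmoothSec R4 (e i))
    (heo : ∀ᶠ y in 𝓝 x, ∃ b : OrthonormalBasis (Fin 4) ℝ (TangentSpace (𝓡 4) y), ∀ i, b i = e i y) :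
    ∑ i, secondTensorCov covX covW A φ (e i) (e i) x = - (μ ^ 2) • φ x
      + (1 / 2 : ℝ) • ∑ k, ∑ i, S.tensorρ E x (e k x) (S.tensorρ E x (e i x)
        ((h.unitary.curvatureEnd x (e k x) (e i x)).rTensor (E x) (φ x)
          + (hA.curvatureEnd x (e k x) (e i x)).lTensor (W x) (φ x))) := by
  obtain ⟨b, hb⟩ := heo.self_of_nhds
  have hW := h.unitary
  have hcl : IsCliffordFamily fun i ↦ S.tensorρ E x (e i x) := by
    simpa only [hb] using S.isCliffordFamily_tensorρ (E := E) x b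
  -- the connection coefficients of an orthonormal frame are skew
  have hskew : ∀ (v : TangentSpace (𝓡 4) x) (i j : Fin 4),
      inner ℝ (covX (e i) x v) (e j x) + inner ℝ (e i x) (covX (e j) x v) = 0 := fun v i j ↦ by
    have h1 := hX.isCompatibleWith.metric (e i) (e j) (he i) (he j) x v
    have h2 : (fun y ↦ (inner ℝ (e i y) (e j y) : ℝ)) =ᶠ[𝓝 x] fun _ ↦ if i = j then 1 else 0 := by
      filter_upwards [heo] with y ⟨b', hb'⟩
      rw [← hb', ← hb', orthonormal_iff_ite.1 b'.orthonormal]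
    have h3 := congrArg (fun L ↦ L v) (mvfderiv_congr (G := ℝ) h2)
    have h4 : mvfderiv (𝓡 4) (fun _ : X ↦ if i = j then (1 : ℝ) else 0) x v = 0 := by
      rw [mvfderiv_const]
      rfl
    exact h1.symm.trans (h3.trans h4)
  have hψ := fun i ↦ hφ.tensorCov hW hA (he i)
  -- differentiate the equation `∑ ρ(e_i) ∇_{e_i} φ = μ φ`
  have h1 : ∀ k, ∑ i, S.tensorρ E x (e i x) (secondTensorCov covX covW A φ (e k) (e i) x)
      = (μ : ℂ) • tensorCov covW A φ x (e k x) := fun k ↦ by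
    have ev : ∀ᶠ y in 𝓝 x, ∑ i, S.tensorρ E y (e i y) (tensorCov covW A φ y (e i y))
        = (μ : ℂ) • φ y := by
      filter_upwards [heo] with y ⟨b', hb'⟩
      rw [← hD y, dirac_eq φ y b']
      simp only [hb']
    have hs : ∀ i ∈ Finset.univ, IsSmoothTensorSection FW FE
        (fun y ↦ S.tensorρ E y (e i y) (tensorCov covW A φ y (e i y))) := fun i _ ↦
      (hψ i).tensorρ (he i)
    have hc : IsSmoothTensorSection FW FE (fun y ↦ (μ : ℂ) • φ y) := hφ.const_smul μ
    have d1 := tensorCov_congr hW hA (hc x) ev (e k x)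
    rw [tensorCov_sum hW hA _ hs, tensorCov_const_smul hW hA hφ] at d1
    rw [← d1]
    have d2 : ∀ i, tensorCov covW A
        (fun y ↦ S.tensorρ E y (e i y) (tensorCov covW A φ y (e i y))) x (e k x)
        = S.tensorρ E x (covX (e i) x (e k x)) (tensorCov covW A φ x (e i x))
          + S.tensorρ E x (e i x)
            (tensorCov covW A (fun y ↦ tensorCov covW A φ y (e i y)) x (e k x)) := fun i ↦
      h.tensorCov_tensorρ hA (hψ i) (he i) x (e k x)
    simp only [d2, secondTensorCov, map_sub, Finset.sum_add_distrib, Finset.sum_sub_distrib]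
    have d3 : ∑ i, S.tensorρ E x (covX (e i) x (e k x)) (tensorCov covW A φ x (e i x))
        = - ∑ i, S.tensorρ E x (e i x) (tensorCov covW A φ x (covX (e i) x (e k x))) := by
      have r1 : ∀ i, S.tensorρ E x (covX (e i) x (e k x)) (tensorCov covW A φ x (e i x))
          = ∑ j, inner ℝ (e j x) (covX (e i) x (e k x)) •
            S.tensorρ E x (e j x) (tensorCov covW A φ x (e i x)) := fun i ↦ by
        conv_lhs => rw [← b.sum_repr' (covX (e i) x (e k x)), map_sum, LinearMap.sum_apply]
        refine Finset.sum_congr rfl fun j _ ↦ ?_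
        rw [map_smul, LinearMap.smul_apply, hb]
      have r2 : ∀ i, S.tensorρ E x (e i x) (tensorCov covW A φ x (covX (e i) x (e k x)))
          = ∑ j, inner ℝ (e j x) (covX (e i) x (e k x)) •
            S.tensorρ E x (e i x) (tensorCov covW A φ x (e j x)) := fun i ↦ by
        change S.tensorρ E x (e i x) (tensorCovLinear covW A φ x _) = _
        conv_lhs => rw [← b.sum_repr' (covX (e i) x (e k x)), map_sum, map_sum]
        refine Finset.sum_congr rfl fun j _ ↦ ?_
        rw [map_smul, hb]
        exact (S.tensorρ E x (e i x)).map_smul_of_tower _ _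
      simp only [r1, r2]
      rw [Finset.sum_comm, ← Finset.sum_neg_distrib]
      refine Finset.sum_congr rfl fun j _ ↦ ?_
      rw [← Finset.sum_neg_distrib]
      refine Finset.sum_congr rfl fun i _ ↦ ?_
      have := hskew (e k x) i j
      have hc : inner ℝ (covX (e i) x (e k x)) (e j x) = inner ℝ (e j x) (covX (e i) x (e k x)) :=
        real_inner_comm _ _
      rw [← neg_smul]
      congr 1
      linarith
    rw [d3]
    abel
  -- and contract once more
  have h2 : ∑ k, ∑ i, S.tensorρ E x (e k x) (S.tensorρ E x (e i x)
      (secondTensorCov covX covW A φ (e k) (e i) x)) = (μ ^ 2) • φ x := by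
    simp only [← map_sum, h1, map_smul]
    rw [← Finset.smul_sum]
    have := dirac_eq (S := S) (covW := covW) (A := A) φ x b
    simp only [hb, hD] at this
    rw [← this, smul_smul, ← sq]
    norm_cast
  set Θ : Fin 4 → Fin 4 → W x ⊗[ℂ] E x := fun k i ↦ secondTensorCov covX covW A φ (e k) (e i) x
    with hΘ
  set r : Fin 4 → W x ⊗[ℂ] E x →ₗ[ℂ] W x ⊗[ℂ] E x := fun i ↦ S.tensorρ E x (e i x) with hr
  have h3 : ∑ k, ∑ i, r k (r i (Θ i k)) = - (μ ^ 2) • φ x - (2 : ℝ) • ∑ i, Θ i i := by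
    have : ∀ k i, r k (r i (Θ i k)) = - r i (r k (Θ i k)) - (if k = i then (2 : ℝ) else 0) • Θ i k :=
      fun k i ↦ hcl.comm k i _
    simp only [this, Finset.sum_sub_distrib, Finset.sum_neg_distrib, ite_smul, zero_smul,
      Finset.sum_ite_eq, Finset.mem_univ, if_true, ← Finset.smul_sum]
    rw [Finset.sum_comm, h2, neg_smul]
  have h4 : ∀ k i, (h.unitary.curvatureEnd x (e k x) (e i x)).rTensor (E x) (φ x)
          + (hA.curvatureEnd x (e k x) (e i x)).lTensor (W x) (φ x) = Θ k i - Θ i k := fun k i ↦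
    (secondTensorCov_sub hX hW hA hφ (he k) (he i) x).symm
  simp only [h4, map_sub, Finset.sum_sub_distrib]
  change ∑ i, Θ i i = - (μ ^ 2) • φ x
    + (1 / 2 : ℝ) • (∑ k, ∑ i, r k (r i (Θ k i)) - ∑ k, ∑ i, r k (r i (Θ i k)))
  rw [h3]
  have h2' : ∑ k, ∑ i, r k (r i (Θ k i)) = (μ ^ 2) • φ x := h2
  rw [h2']
  module

end Weitzenbock

/-! ### The differential inequality -/

section Subharmonic

variable {X : Type*} [TopologicalSpace X] [ChartedSpace R4 X] [IsManifold (𝓡 4) ∞ X] [T2Space X]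
  [RiemannianBundle (fun x : X ↦ TangentSpace (𝓡 4) x)]
  [IsContMDiffRiemannianBundle (𝓡 4) ∞ R4 (fun x : X ↦ TangentSpace (𝓡 4) x)]
  {FW : Type*} [NormedAddCommGroup FW] [NormedSpace ℂ FW] [FiniteDimensional ℂ FW]
  {W : X → Type*} [∀ x, NormedAddCommGroup (W x)] [∀ x, InnerProductSpace ℂ (W x)]
  [TopologicalSpace (TotalSpace FW W)] [FiberBundle FW W] [VectorBundle ℂ FW W]
  [VectorBundle ℝ FW W] [ContMDiffVectorBundle ∞ FW W (𝓡 4)] [IsSmoothHermitianBundle FW W]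
  {FL : Type*} [NormedAddCommGroup FL] [NormedSpace ℂ FL] [FiniteDimensional ℂ FL]
  {L : X → Type*} [∀ x, NormedAddCommGroup (L x)] [∀ x, InnerProductSpace ℂ (L x)]
  [TopologicalSpace (TotalSpace FL L)] [FiberBundle FL L] [VectorBundle ℂ FL L]
  [VectorBundle ℝ FL L] [ContMDiffVectorBundle ∞ FL L (𝓡 4)] [IsSmoothHermitianBundle FL L]
  {FE : Type*} [NormedAddCommGroup FE] [NormedSpace ℂ FE] [FiniteDimensional ℂ FE]
  {E : X → Type*} [∀ x, NormedAddCommGroup (E x)] [∀ x, InnerProductSpace ℂ (E x)]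
  [TopologicalSpace (TotalSpace FE E)] [FiberBundle FE E] [VectorBundle ℂ FE E]
  [VectorBundle ℝ FE E] [ContMDiffVectorBundle ∞ FE E (𝓡 4)] [IsSmoothHermitianBundle FE E]
  {S : SpincStructure FW W} {δ : DeterminantLine FL L S}
  {covX : CovariantDerivative (𝓡 4) R4 (fun x : X ↦ TangentSpace (𝓡 4) x)}
  {Ad : CovariantDerivative (𝓡 4) FL L} {covW : CovariantDerivative (𝓡 4) FW W}
  {A : CovariantDerivative (𝓡 4) FE E}

theorem IsLeviCivita.bianchi (hX : IsLeviCivita covX) (x : X) (u v w : TangentSpace (𝓡 4) x) :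
    curvatureAt covX x u v w + curvatureAt covX x v w u + curvatureAt covX x w u v = 0 := by
  obtain ⟨U, hU, rfl⟩ := exists_smoothSec_eq (F := R4) u
  obtain ⟨V, hV, rfl⟩ := exists_smoothSec_eq (F := R4) v
  obtain ⟨Z, hZ, rfl⟩ := exists_smoothSec_eq (F := R4) w
  have h := hX.isCompatibleWith
  exact (congrArg₂ (· + ·) (congrArg₂ (· + ·) (h.curvatureAt_eq hZ hU hV x)
    (h.curvatureAt_eq hU hV hZ x)) (h.curvatureAt_eq hV hZ hU x)).trans
    (hX.bianchi_sectionCurvature hU hV hZ x)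

/-- The curvature term of the Weitzenböck formula is bounded below: the Riemann tensor contributes the
scalar curvature, and the remaining terms are bounded by `|F_A|` and `|F_{A_d}|`. -/
theorem IsSpinConnection.le_re_inner_curvature (h : IsSpinConnection δ covX Ad covW)
    (hX : IsLeviCivita covX) (hd : IsUnitaryConnection Ad) (hA : IsUnitaryConnection A) (x : X)
    (b : OrthonormalBasis (Fin 4) ℝ (TangentSpace (𝓡 4) x)) (p : W x ⊗[ℂ] E x) :
    - (|scalarCurvature covX x| / 4 + 8 * (curvatureNorm A x + curvatureNorm Ad x)) * ‖p‖ ^ 2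
      ≤ (inner ℂ ((1 / 2 : ℝ) • ∑ k, ∑ i, S.tensorρ E x (b k) (S.tensorρ E x (b i)
        ((h.unitary.curvatureEnd x (b k) (b i)).rTensor (E x) p
          + (hA.curvatureEnd x (b k) (b i)).lTensor (W x) p))) p).re := by
  have hfin : FiniteDimensional ℂ (W x) := finiteDimensional_fiber FW W x
  have hcl := S.isCliffordFamily_tensorρ (E := E) x b
  choose t ht hT using h.rTensor_curvature hX hd x b (E := E)
  set R : Fin 4 → Fin 4 → Fin 4 → Fin 4 → ℝ := fun k i a c ↦
    inner ℝ (curvatureAt covX x (b k) (b i) (b a)) (b c) with hR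
  set r : Fin 4 → W x ⊗[ℂ] E x →ₗ[ℂ] W x ⊗[ℂ] E x := fun i ↦ S.tensorρ E x (b i) with hr
  set G : Fin 4 → Fin 4 → W x ⊗[ℂ] E x := fun k i ↦
    t k i • p + (hA.curvatureEnd x (b k) (b i)).lTensor (W x) p with hG
  have hGn : ∀ k i, ‖G k i‖ ≤ (curvatureNorm A x + curvatureNorm Ad x) * ‖p‖ := fun k i ↦ by
    have h1 : ‖(hA.curvatureEnd x (b k) (b i)).lTensor (W x) p‖ ≤ curvatureNorm A x * ‖p‖ :=
      norm_lTensor_apply_le _ (Real.sqrt_nonneg _)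
        (fun v ↦ hA.norm_curvatureAt_le x b k i v) p
    have h2 : ‖t k i • p‖ ≤ curvatureNorm Ad x * ‖p‖ := by
      rw [norm_smul]
      exact mul_le_mul_of_nonneg_right (ht k i) (norm_nonneg _)
    calc ‖G k i‖ ≤ _ := norm_add_le _ _
      _ ≤ curvatureNorm Ad x * ‖p‖ + curvatureNorm A x * ‖p‖ := add_le_add h2 h1
      _ = _ := by ring
  have e : (1 / 2 : ℝ) • ∑ k, ∑ i, S.tensorρ E x (b k) (S.tensorρ E x (b i)
        ((h.unitary.curvatureEnd x (b k) (b i)).rTensor (E x) p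
          + (hA.curvatureEnd x (b k) (b i)).lTensor (W x) p))
      = (1 / 8 : ℝ) • (∑ k, ∑ i, ∑ a, ∑ c, R k i a c • r k (r i (r a (r c p))))
        + (1 / 2 : ℝ) • ∑ k, ∑ i, r k (r i (G k i)) := by
    have e1 : ∀ k i, S.tensorρ E x (b k) (S.tensorρ E x (b i)
        ((h.unitary.curvatureEnd x (b k) (b i)).rTensor (E x) p
          + (hA.curvatureEnd x (b k) (b i)).lTensor (W x) p))
        = (1 / 4 : ℝ) • (∑ a, ∑ c, R k i a c • r k (r i (r a (r c p)))) + r k (r i (G k i)) := by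
      intro k i
      rw [hT, add_assoc]
      change r k (r i (_ + G k i)) = _
      simp only [map_add, LinearMap.map_smul_of_tower, map_sum]
      rfl
    simp only [e1, Finset.sum_add_distrib, ← Finset.smul_sum]
    module
  have h1 := hcl.re_inner_sum_curvature R
    (fun k i a c ↦ by
      simp only [hR]
      rw [hX.isCompatibleWith.curvatureAt_swap, inner_neg_left])
    (fun k i a c ↦ by
      simp only [hR]
      rw [← inner_add_left, ← inner_add_left, hX.bianchi, inner_zero_left]) p
  rw [← hX.scalarCurvature_eq x b] at h1
  have h1' : (inner ℂ (∑ k, ∑ i, ∑ a, ∑ c, R k i a c • r k (r i (r a (r c p)))) p).re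
      = 2 * scalarCurvature covX x * ‖p‖ ^ 2 := h1
  -- the `16` terms have norm at most `|F_A| + |F_{A_d}|` each; with the factor `1/2` this gives `8`
  have h2 : ‖∑ k, ∑ i, r k (r i (G k i))‖
      ≤ 16 * ((curvatureNorm A x + curvatureNorm Ad x) * ‖p‖) := by
    refine (norm_sum_le _ _).trans ?_
    calc ∑ k, ‖∑ i, r k (r i (G k i))‖ ≤ ∑ k : Fin 4, ∑ i : Fin 4, ‖r k (r i (G k i))‖ :=
          Finset.sum_le_sum fun k _ ↦ norm_sum_le _ _
      _ ≤ ∑ k : Fin 4, ∑ i : Fin 4, (curvatureNorm A x + curvatureNorm Ad x) * ‖p‖ :=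
          Finset.sum_le_sum fun k _ ↦ Finset.sum_le_sum fun i _ ↦ by
            have := hcl.norm_apply k (r i (G k i))
            have h' := hcl.norm_apply i (G k i)
            exact (this.trans h').le.trans (hGn k i)
      _ = _ := by
        simp only [Finset.sum_const, Finset.card_univ, Fintype.card_fin, nsmul_eq_mul]
        ring
  have h3 : -(‖∑ k, ∑ i, r k (r i (G k i))‖ * ‖p‖)
      ≤ (inner ℂ (∑ k, ∑ i, r k (r i (G k i))) p).re :=
    (abs_le.1 ((Complex.abs_re_le_norm _).trans (norm_inner_le_norm (𝕜 := ℂ) _ p))).1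
  have hre : ∀ (c : ℝ) (a : W x ⊗[ℂ] E x), (inner ℂ (c • a) p).re = c * (inner ℂ a p).re :=
    fun c a ↦ congrArg (fun f ↦ f p) (map_smul (reInner (W x ⊗[ℂ] E x)) c a)
  rw [e, inner_add_left, Complex.add_re, hre, hre, h1']
  have h4 := mul_le_mul_of_nonneg_right h2 (norm_nonneg p)
  have h5 : - |scalarCurvature covX x| * ‖p‖ ^ 2 ≤ scalarCurvature covX x * ‖p‖ ^ 2 :=
    mul_le_mul_of_nonneg_right (neg_abs_le _) (by positivity)
  nlinarith

variable (covX Ad A) in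
/-- The potential `μ² + |κ_g| + |F_A| + |F_{A_d}|`. -/
noncomputable def curvaturePotential (μ : ℝ) (x : X) : ℝ :=
  μ ^ 2 + |scalarCurvature covX x| + curvatureNorm A x + curvatureNorm Ad x

theorem curvaturePotential_nonneg (μ : ℝ) (x : X) : 0 ≤ curvaturePotential covX Ad A μ x := by
  have h1 : 0 ≤ curvatureNorm A x := Real.sqrt_nonneg _
  have h2 : 0 ≤ curvatureNorm Ad x := Real.sqrt_nonneg _
  unfold curvaturePotential
  positivity

variable {φ : Π x, W x ⊗[ℂ] E x} {μ : ℝ}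

/-- The Bochner inequality for `|φ|²`. The Weitzenböck formula enters through its curvature term, whose
lower bound is `IsSpinConnection.le_re_inner_curvature`. -/
theorem IsSpinConnection.laplacian_norm_sq_le (h : IsSpinConnection δ covX Ad covW)
    (hX : IsLeviCivita covX) (hd : IsUnitaryConnection Ad) (hA : IsUnitaryConnection A)
    (hφ : IsSmoothTensorSection FW FE φ) (hD : ∀ x, dirac S covW A φ x = (μ : ℂ) • φ x) (x : X) :
    laplacian covX (fun y ↦ ‖φ y‖ ^ 2) x ≤ 16 * curvaturePotential covX Ad A μ x * ‖φ x‖ ^ 2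
      - 2 * ∑ i, ‖tensorCov covW A φ x (tangentFrame x i)‖ ^ 2 := by
  obtain ⟨e, he, heo, hex⟩ := exists_tangent_frame (tangentFrame x)
  have hwb := h.weitzenbock hX hA hφ hD he heo
  have hl : laplacian covX (fun y ↦ ‖φ y‖ ^ 2) x
      = - (2 * (inner ℂ (∑ i, secondTensorCov covX covW A φ (e i) (e i) x) (φ x)).re
        + 2 * ∑ i, ‖tensorCov covW A φ x (tangentFrame x i)‖ ^ 2) := by
    rw [laplacian, sum_inner, Complex.re_sum, Finset.mul_sum, Finset.mul_sum,
      ← Finset.sum_add_distrib]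
    congr 1
    refine Finset.sum_congr rfl fun i _ ↦ ?_
    rw [← hex i]
    exact hessianAt_norm_sq h.unitary hA hφ (he i) x
  have hc := h.le_re_inner_curvature hX hd hA x (tangentFrame x) (φ x)
  simp only [hex] at hwb
  have hre : ∀ (c : ℝ) (a p : W x ⊗[ℂ] E x), (inner ℂ (c • a) p).re = c * (inner ℂ a p).re :=
    fun c a p ↦ congrArg (fun f ↦ f p) (map_smul (reInner (W x ⊗[ℂ] E x)) c a)
  have h3 : (inner ℂ (φ x) (φ x) : ℂ).re = ‖φ x‖ ^ 2 := inner_self_eq_norm_sq (𝕜 := ℂ) (φ x)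
  rw [hl, hwb, inner_add_left, Complex.add_re, hre, h3]
  unfold curvaturePotential
  have h4 : 0 ≤ curvatureNorm A x := Real.sqrt_nonneg _
  have h5 : 0 ≤ curvatureNorm Ad x := Real.sqrt_nonneg _
  have h6 : 0 ≤ μ ^ 2 * ‖φ x‖ ^ 2 := by positivity
  have h7 : 0 ≤ |scalarCurvature covX x| * ‖φ x‖ ^ 2 := by positivity
  linarith

/-- The refined Kato inequality for `|φ|²`: the Dirac equation improves the constant `4` of the
Cauchy-Schwarz inequality to `3`. -/
theorem IsSpinConnection.sum_mvfderiv_sq_le (h : IsSpinConnection δ covX Ad covW)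
    (hA : IsUnitaryConnection A)
    (hφ : IsSmoothTensorSection FW FE φ) (hD : ∀ x, dirac S covW A φ x = (μ : ℂ) • φ x) (x : X) :
    ∑ i, mvfderiv (𝓡 4) (fun y ↦ ‖φ y‖ ^ 2) x (tangentFrame x i) ^ 2
      ≤ 3 * ‖φ x‖ ^ 2 * ∑ i, ‖tensorCov covW A φ x (tangentFrame x i)‖ ^ 2 := by
  have hk := (S.isCliffordFamily_tensorρ (E := E) x (tangentFrame x)).kato
    (fun i ↦ tensorCov covW A φ x (tangentFrame x i)) (φ x) μ (hD x)
  have e : ∀ i, mvfderiv (𝓡 4) (fun y ↦ ‖φ y‖ ^ 2) x (tangentFrame x i) ^ 2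
      = 4 * (inner ℂ (tensorCov covW A φ x (tangentFrame x i)) (φ x)).re ^ 2 := fun i ↦ by
    rw [mvfderiv_norm_sq h.unitary hA hφ]
    ring
  simp only [e]
  rw [← Finset.mul_sum]
  linarith

/-- The differential inequality for the regularized power `(|φ|² + s)^{1/3}`. The exponent is
such that the gradient terms cancel. -/
theorem IsSpinConnection.laplacian_rpow_le (h : IsSpinConnection δ covX Ad covW)
    (hX : IsLeviCivita covX) (hd : IsUnitaryConnection Ad) (hA : IsUnitaryConnection A)
    (hφ : IsSmoothTensorSection FW FE φ) (hD : ∀ x, dirac S covW A φ x = (μ : ℂ) • φ x) {s : ℝ}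
    (hs : 0 ≤ s) {x : X} (hpos : 0 < ‖φ x‖ ^ 2 + s) :
    laplacian covX (fun y ↦ (‖φ y‖ ^ 2 + s) ^ (1 / 3 : ℝ)) x
      ≤ 6 * curvaturePotential covX Ad A μ x * (‖φ x‖ ^ 2 + s) ^ (1 / 3 : ℝ) := by
  set u : X → ℝ := fun y ↦ ‖φ y‖ ^ 2 with hu
  set v := u x + s with hv
  have hg : ∀ t : ℝ, 0 < t + s →
      HasDerivAt (fun t ↦ (t + s) ^ (1 / 3 : ℝ)) (1 / 3 * (t + s) ^ (-(2 / 3) : ℝ)) t := fun t ht ↦ by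
    have := ((hasDerivAt_id t).add_const s).rpow_const (p := (1 / 3 : ℝ)) (Or.inl ht.ne')
    rw [show (1 / 3 - 1 : ℝ) = -(2 / 3) by norm_num, one_mul] at this
    exact this
  have hg' : HasDerivAt (fun t ↦ 1 / 3 * (t + s) ^ (-(2 / 3) : ℝ))
      (-(2 / 9) * v ^ (-(5 / 3) : ℝ)) (u x) := by
    have := (((hasDerivAt_id (u x)).add_const s).rpow_const (p := (-(2 / 3) : ℝ))
      (Or.inl hpos.ne')).const_mul (1 / 3)
    rw [show (-(2 / 3) - 1 : ℝ) = -(5 / 3) by norm_num] at this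
    refine this.congr_deriv ?_
    change 1 / 3 * (1 * -(2 / 3) * v ^ (-(5 / 3) : ℝ)) = _
    ring
  have hev : ∀ᶠ t in 𝓝 (u x), HasDerivAt (fun t ↦ (t + s) ^ (1 / 3 : ℝ))
      (1 / 3 * (t + s) ^ (-(2 / 3) : ℝ)) t := by
    have : ∀ᶠ t in 𝓝 (u x), 0 < t + s :=
      (continuous_id.add continuous_const).continuousAt.eventually (lt_mem_nhds hpos)
    exact this.mono hg
  have hl : laplacian covX (fun y ↦ (u y + s) ^ (1 / 3 : ℝ)) x
      = 1 / 3 * v ^ (-(2 / 3) : ℝ) * laplacian covX u x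
        + 2 / 9 * v ^ (-(5 / 3) : ℝ) * ∑ i, mvfderiv (𝓡 4) u x (tangentFrame x i) ^ 2 := by
    have e : ∀ i, hessianAt covX (fun y ↦ (u y + s) ^ (1 / 3 : ℝ)) x (tangentFrame x i)
        (tangentFrame x i) = 1 / 3 * v ^ (-(2 / 3) : ℝ) * hessianAt covX u x (tangentFrame x i)
          (tangentFrame x i) + -(2 / 9) * v ^ (-(5 / 3) : ℝ) *
            (mvfderiv (𝓡 4) u x (tangentFrame x i) * mvfderiv (𝓡 4) u x (tangentFrame x i)) :=
      fun i ↦ hessianAt_comp hφ.contMDiff_norm_sq hev hg' _ _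
    simp only [laplacian, e, Finset.sum_add_distrib, ← Finset.mul_sum, sq]
    ring
  have h1 := h.laplacian_norm_sq_le hX hd hA hφ hD x
  have h2 := h.sum_mvfderiv_sq_le hA hφ hD x
  set P := ∑ i, ‖tensorCov covW A φ x (tangentFrame x i)‖ ^ 2 with hP
  set q := curvaturePotential covX Ad A μ x with hq
  have hP0 : 0 ≤ P := by positivity
  have hq0 : 0 ≤ q := curvaturePotential_nonneg μ x
  have hu0 : 0 ≤ u x := by positivity
  set w := v ^ (-(2 / 3) : ℝ) with hw
  have hw0 : 0 < w := Real.rpow_pos_of_pos hpos _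
  have e1 : v ^ (-(5 / 3) : ℝ) * v = w := by
    rw [hw, ← Real.rpow_add_one hpos.ne']
    norm_num
  have e2 : v ^ (1 / 3 : ℝ) = w * v := by
    rw [hw, ← Real.rpow_add_one hpos.ne']
    norm_num
  have h5 : 0 ≤ v ^ (-(5 / 3) : ℝ) := (Real.rpow_pos_of_pos hpos _).le
  have huv : u x ≤ v := by linarith
  change laplacian covX (fun y ↦ (u y + s) ^ (1 / 3 : ℝ)) x ≤ 6 * q * v ^ (1 / 3 : ℝ)
  rw [hl, e2]
  -- the gradient contributes `-2/3 w P` from the Laplacian of `u` and at most `2/3 w P` from `|du|²`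
  have t1 : 1 / 3 * w * laplacian covX u x ≤ 1 / 3 * w * (16 * q * u x - 2 * P) :=
    mul_le_mul_of_nonneg_left h1 (by positivity)
  have t2 : 2 / 9 * v ^ (-(5 / 3) : ℝ) * ∑ i, mvfderiv (𝓡 4) u x (tangentFrame x i) ^ 2
      ≤ 2 / 9 * v ^ (-(5 / 3) : ℝ) * (3 * v * P) := by
    refine mul_le_mul_of_nonneg_left (h2.trans ?_) (by positivity)
    exact mul_le_mul_of_nonneg_right (mul_le_mul_of_nonneg_left huv (by norm_num)) hP0
  have t3 : 2 / 9 * v ^ (-(5 / 3) : ℝ) * (3 * v * P) = 2 / 3 * w * P := by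
    rw [← e1]
    ring
  have t4 : w * q * u x ≤ w * q * v := mul_le_mul_of_nonneg_left huv (by positivity)
  have t5 : 0 ≤ w * q * v := mul_nonneg (by positivity) hpos.le
  nlinarith

end Subharmonic

/-! ### Derivatives of determinants and coordinate fields -/

theorem differentiable_det {n : Type*} [Fintype n] [DecidableEq n] :
    Differentiable ℝ (fun A : n → n → ℝ ↦ (Matrix.of A).det) := by
  simp only [Matrix.det_apply, Matrix.of_apply]
  fun_prop

theorem contDiff_det {n : Type*} [Fintype n] [DecidableEq n] {k : ℕ∞ω} :
    ContDiff ℝ k (fun A : n → n → ℝ ↦ (Matrix.of A).det) := by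
  simp only [Matrix.det_apply, Matrix.of_apply]
  fun_prop

/-- Jacobi's formula for the determinant of a quadratic form whose derivative is `M G + G Mᵀ`. -/
theorem hasDerivAt_det_of_lie {n : Type*} [Fintype n] [DecidableEq n] {G : ℝ → n → n → ℝ}
    {M : Matrix n n ℝ} {t : ℝ}
    (hG : ∀ i j, HasDerivAt (fun s ↦ G s i j)
      ((M * Matrix.of (G t) + Matrix.of (G t) * M.transpose) i j) t) :
    HasDerivAt (fun s ↦ (Matrix.of (G s)).det) (2 * M.trace * (Matrix.of (G t)).det) t := by
  have hd := (differentiable_det (n := n) (G t)).hasFDerivAt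
  have h1 := hd.comp_hasDerivAt t (hasDerivAt_pi.2 fun i ↦ hasDerivAt_pi.2 fun j ↦ hG i j)
  -- the curve `(1 + s M) G (1 + s Mᵀ)` has the same velocity, and its determinant is explicit
  let γ : ℝ → n → n → ℝ := fun s i j ↦
    ((1 + s • M) * Matrix.of (G t) * (1 + s • M.transpose) : Matrix n n ℝ) i j
  have hγ : ∀ i j, HasDerivAt (fun s ↦ γ s i j)
      ((M * Matrix.of (G t) + Matrix.of (G t) * M.transpose) i j) 0 := by
    intro i j
    have e : (fun s ↦ γ s i j) = fun s ↦ G t i j +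
        s * (M * Matrix.of (G t) + Matrix.of (G t) * M.transpose) i j +
        s ^ 2 * (M * Matrix.of (G t) * M.transpose) i j := by
      funext s
      have : (1 + s • M) * Matrix.of (G t) * (1 + s • M.transpose) = Matrix.of (G t) +
        s • (M * Matrix.of (G t) + Matrix.of (G t) * M.transpose) +
        s ^ 2 • (M * Matrix.of (G t) * M.transpose) := by
        simp only [add_mul, mul_add, one_mul, mul_one, Matrix.smul_mul, Matrix.mul_smul]
        module
      exact congrFun (congrFun this i) j
    rw [e]
    refine ((((hasDerivAt_id (0 : ℝ)).mul_const _).const_add _).add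
      (((hasDerivAt_id (0 : ℝ)).pow 2).mul_const _)).congr_deriv ?_
    simp
  have h0 : γ 0 = G t := by
    funext i j
    simp [γ]
  have hd' := (differentiable_det (n := n) (γ 0)).hasFDerivAt
  have h2 := hd'.comp_hasDerivAt (0 : ℝ) (hasDerivAt_pi.2 fun i ↦ hasDerivAt_pi.2 fun j ↦ hγ i j)
  rw [h0] at h2
  have h3 : HasDerivAt (fun s : ℝ ↦ (1 + s • M).det) M.trace 0 := by
    have e : (fun s : ℝ ↦ (1 + s • M).det) = fun s ↦ 
        (Matrix.det (1 + (Polynomial.X : Polynomial ℝ) • M.map Polynomial.C)).eval s := by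
      funext s
      rw [← Polynomial.coe_evalRingHom, RingHom.map_det]
      congr 1
      ext i j
      simp [Matrix.one_apply, apply_ite]
      exact mul_comm _ _
    rw [e]
    have := (Matrix.det (1 + (Polynomial.X : Polynomial ℝ) • M.map Polynomial.C)).hasDerivAt 0
    rwa [Matrix.derivative_det_one_add_X_smul] at this
  have h4 : (fun s ↦ (Matrix.of (γ s)).det)
      = fun s ↦ (1 + s • M).det * (Matrix.of (G t)).det * (1 + s • M).det := by
    funext s
    change ((1 + s • M) * Matrix.of (G t) * (1 + s • M.transpose)).det = _
    rw [Matrix.det_mul, Matrix.det_mul, ← Matrix.det_transpose (1 + s • M.transpose)]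
    simp
  have h5 := (h3.mul_const (Matrix.of (G t)).det).mul h3
  refine h1.congr_deriv (h2.unique ((h5.congr_of_eventuallyEq
    (Filter.Eventually.of_forall fun s ↦ congrFun h4 s)).congr_deriv ?_))
  simp
  ring

section Divergence

variable {X : Type*} [TopologicalSpace X] [T2Space X] [ChartedSpace R4 X] [IsManifold (𝓡 4) ∞ X]
/-- The coordinate vector fields of a chart extend, from a neighbourhood of any point of the chart, to
smooth vector fields on the manifold. -/
theorem exists_coordinate_field (x₀ : X) (i : Fin 4) {y₀ : R4}
    (hy₀ : y₀ ∈ (extChartAt (𝓡 4) x₀).target) :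
    ∃ σ : Π x : X, TangentSpace (𝓡 4) x, SmoothSec R4 σ ∧
      ∀ᶠ y in 𝓝 y₀, σ ((extChartAt (𝓡 4) x₀).symm y) = coordVector x₀ y i := by
  let t := trivializationAt R4 (TangentSpace (𝓡 4) : X → Type _) x₀
  let b := (EuclideanSpace.basisFun (Fin 4) ℝ).toBasis
  have hmem : ∀ {y}, y ∈ (extChartAt (𝓡 4) x₀).target →
      (extChartAt (𝓡 4) x₀).symm y ∈ (chartAt R4 x₀).source := fun hy ↦ by
    simpa using (extChartAt (𝓡 4) x₀).map_target hy
  have hs : (extChartAt (𝓡 4) x₀).symm y₀ ∈ t.baseSet := by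
    simpa [t] using hmem hy₀
  have hsm : ∀ᶠ x in 𝓝 ((extChartAt (𝓡 4) x₀).symm y₀), SmoothSectionAt R4 (t.localFrame b i) x := by
    filter_upwards [t.open_baseSet.mem_nhds hs] with x hx
    exact contMDiffAt_localFrame_of_mem _ _ b i hx
  obtain ⟨σ, hσ, hσ'⟩ := exists_smoothSec_eventuallyEq hsm
  refine ⟨σ, hσ, ?_⟩
  have hc : ContinuousAt (extChartAt (𝓡 4) x₀).symm y₀ :=
    (continuousOn_extChartAt_symm x₀).continuousAt ((isOpen_extChartAt_target x₀).mem_nhds hy₀)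
  filter_upwards [hc.eventually hσ', (isOpen_extChartAt_target x₀).mem_nhds hy₀] with y hy hyt
  have hb : (extChartAt (𝓡 4) x₀).symm y ∈ t.baseSet := by simpa [t] using hmem hyt
  rw [hy, t.localFrame_apply_of_mem_baseSet b hb]
  have h := TangentBundle.symmL_trivializationAt (I := 𝓡 4) (hmem hyt)
  rw [(extChartAt (𝓡 4) x₀).right_inv hyt, show Set.range (𝓡 4) = Set.univ from Set.range_id,
    mfderivWithin_univ] at h
  rw [coordVector, ← h]
  have hb' : b i = (EuclideanSpace.single i (1 : ℝ) : R4) := by simp [b]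
  rw [← hb', Bundle.Trivialization.basisAt, Module.Basis.map_apply]
  exact (t.symmL_apply hb (b i)).symm

/-- The coordinate functions of a chart extend, from a neighbourhood of any point of the chart, to
smooth functions on the manifold. -/
theorem exists_coordinate_function (x₀ : X) (k : Fin 4) {y₀ : R4}
    (hy₀ : y₀ ∈ (extChartAt (𝓡 4) x₀).target) :
    ∃ g : X → ℝ, ContMDiff (𝓡 4) 𝓘(ℝ, ℝ) ∞ g ∧
      ∀ᶠ y in 𝓝 y₀, ∀ v : TangentSpace (𝓡 4) ((extChartAt (𝓡 4) x₀).symm y),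
        mvfderiv (𝓡 4) g ((extChartAt (𝓡 4) x₀).symm y) v = chartCoords x₀ y v k := by
  have hx : (extChartAt (𝓡 4) x₀).symm y₀ ∈ (chartAt R4 x₀).source := by
    simpa using (extChartAt (𝓡 4) x₀).map_target hy₀
  obtain ⟨f, hf⟩ := ((SmoothBumpFunction.nhds_basis_tsupport (I := 𝓡 4)
    ((extChartAt (𝓡 4) x₀).symm y₀)).mem_iff).1 ((chartAt R4 x₀).open_source.mem_nhds hx)
  have hsm : ContMDiffOn (𝓡 4) 𝓘(ℝ, ℝ) ∞ (fun x ↦ (extChartAt (𝓡 4) x₀ x) k)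
      (chartAt R4 x₀).source :=
    (EuclideanSpace.proj (𝕜 := ℝ) k).contMDiff.comp_contMDiffOn (contMDiffOn_extChartAt (n := ∞))
  have hg : ContMDiff (𝓡 4) 𝓘(ℝ, ℝ) ∞ (fun x ↦ f x • (extChartAt (𝓡 4) x₀ x) k) := by
    refine contMDiff_of_tsupport fun x hx ↦ ?_
    have hx' := hf.2 (tsupport_smul_subset_left _ _ hx)
    exact f.contMDiffAt.smul ((hsm x hx').contMDiffAt ((chartAt R4 x₀).open_source.mem_nhds hx'))
  refine ⟨_, hg, ?_⟩
  have hc : ContinuousAt (extChartAt (𝓡 4) x₀).symm y₀ :=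
    (continuousOn_extChartAt_symm x₀).continuousAt ((isOpen_extChartAt_target x₀).mem_nhds hy₀)
  have h1 : ∀ᶠ y in 𝓝 y₀, f ((extChartAt (𝓡 4) x₀).symm y) • (extChartAt (𝓡 4) x₀
      ((extChartAt (𝓡 4) x₀).symm y)) k = y k := by
    filter_upwards [hc.eventually f.eventuallyEq_one, (isOpen_extChartAt_target x₀).mem_nhds hy₀]
      with y hy hyt
    rw [hy, (extChartAt (𝓡 4) x₀).right_inv hyt]
    simp
  filter_upwards [eventually_eventually_nhds.2 h1, (isOpen_extChartAt_target x₀).mem_nhds hy₀]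
    with y hy hyt v
  rw [← fderiv_chartCoords x₀ hyt (hg.contMDiffAt.mdifferentiableAt (by simp)) v,
    Filter.EventuallyEq.fderiv_eq hy]
  exact congrArg (fun L ↦ L (chartCoords x₀ y v)) (EuclideanSpace.proj (𝕜 := ℝ) k).fderiv

theorem sum_chartCoords_smul_coordVector (x₀ : X) {y : R4}
    (hy : y ∈ (extChartAt (𝓡 4) x₀).target)
    (v : TangentSpace (𝓡 4) ((extChartAt (𝓡 4) x₀).symm y)) :
    ∑ k, chartCoords x₀ y v k • coordVector x₀ y k = v := by
  conv_rhs => rw [← mfderiv_symm_chartCoords x₀ hy v]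
  have h : ∑ k, chartCoords x₀ y v k • (EuclideanSpace.single k (1 : ℝ) : R4)
      = chartCoords x₀ y v := by
    simpa using (EuclideanSpace.basisFun (Fin 4) ℝ).sum_repr (chartCoords x₀ y v)
  refine Eq.trans ?_ (congrArg (mfderiv (𝓡 4) (𝓡 4) (extChartAt (𝓡 4) x₀).symm y) h)
  refine Eq.trans ?_ (map_sum _ _ _).symm
  exact Finset.sum_congr rfl fun k _ ↦ (ContinuousLinearMap.map_smul _ _ _).symm

theorem chartCoords_coordVector (x₀ : X) {y : R4}
    (hy : y ∈ (extChartAt (𝓡 4) x₀).target) (i k : Fin 4) :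
    chartCoords x₀ y (coordVector x₀ y i) k = if k = i then 1 else 0 := by
  have h := chartCoords_mfderiv_symm x₀ hy (EuclideanSpace.single i (1 : ℝ))
  refine (congrArg (fun w : R4 ↦ w k) h).trans ?_
  simp

end Divergence

/-! ### The divergence in a chart -/

section DivergenceInCharts

variable {X : Type*} [TopologicalSpace X] [ChartedSpace R4 X] [IsManifold (𝓡 4) ∞ X]

/-- The coordinate vectors of a chart form a basis of the tangent space. -/
theorem exists_basis_coordVector (x₀ : X) {y : R4} (hy : y ∈ (extChartAt (𝓡 4) x₀).target) :
    ∃ b : Module.Basis (Fin 4) ℝ (TangentSpace (𝓡 4) ((extChartAt (𝓡 4) x₀).symm y)),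
      (∀ i, b i = coordVector x₀ y i) ∧ ∀ v k, b.repr v k = chartCoords x₀ y v k := by
  let e : R4 ≃ₗ[ℝ] TangentSpace (𝓡 4) ((extChartAt (𝓡 4) x₀).symm y) :=
    { toFun := fun w ↦ mfderiv (𝓡 4) (𝓡 4) (extChartAt (𝓡 4) x₀).symm y w
      map_add' := fun a b ↦ map_add (mfderiv (𝓡 4) (𝓡 4) (extChartAt (𝓡 4) x₀).symm y) a b
      map_smul' := fun c a ↦
        (mfderiv (𝓡 4) (𝓡 4) (extChartAt (𝓡 4) x₀).symm y).map_smul c a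
      invFun := fun v ↦ chartCoords x₀ y v
      left_inv := chartCoords_mfderiv_symm x₀ hy
      right_inv := mfderiv_symm_chartCoords x₀ hy }
  have hb : ∀ i, (EuclideanSpace.basisFun (Fin 4) ℝ).toBasis i
    = (EuclideanSpace.single i (1 : ℝ) : R4) := fun i ↦ by simp
  refine ⟨(EuclideanSpace.basisFun (Fin 4) ℝ).toBasis.map e, fun i ↦ ?_, fun v k ↦ rfl⟩
  rw [Module.Basis.map_apply, hb]
  rfl

/-- The divergence of a vector field, the trace of its covariant derivative. -/
noncomputable def divergence
    (cov : CovariantDerivative (𝓡 4) R4 (fun x : X ↦ TangentSpace (𝓡 4) x))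
    (Z : Π x : X, TangentSpace (𝓡 4) x) (x : X) : ℝ :=
  LinearMap.trace ℝ (TangentSpace (𝓡 4) x) (cov Z x).toLinearMap

theorem divergence_eq_sum_chartCoords
    (cov : CovariantDerivative (𝓡 4) R4 (fun x : X ↦ TangentSpace (𝓡 4) x))
    (Z : Π x : X, TangentSpace (𝓡 4) x) (x₀ : X) {y : R4}
    (hy : y ∈ (extChartAt (𝓡 4) x₀).target) :
    divergence cov Z ((extChartAt (𝓡 4) x₀).symm y)
      = ∑ k, chartCoords x₀ y (cov Z ((extChartAt (𝓡 4) x₀).symm y) (coordVector x₀ y k)) k := by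
  obtain ⟨b, hb, hr⟩ := exists_basis_coordVector x₀ hy
  rw [divergence, LinearMap.trace_eq_matrix_trace ℝ b, Matrix.trace]
  refine Finset.sum_congr rfl fun k _ ↦ ?_
  rw [Matrix.diag_apply, LinearMap.toMatrix_apply, hr, hb]
  rfl

variable [RiemannianBundle (fun x : X ↦ TangentSpace (𝓡 4) x)]

/-- The density `√(det g_ij)` of the Riemannian measure in the chart around `x₀`. -/
noncomputable def chartDensity (x₀ : X) (y : R4) : ℝ :=
  √(Matrix.det (Matrix.of fun i j ↦ inner ℝ (coordVector x₀ y i) (coordVector x₀ y j)))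

theorem det_metric_pos (x₀ : X) {y : R4} (hy : y ∈ (extChartAt (𝓡 4) x₀).target) :
    0 < Matrix.det (Matrix.of fun i j ↦ inner ℝ (coordVector x₀ y i) (coordVector x₀ y j)) := by
  obtain ⟨b, hb, -⟩ := exists_basis_coordVector x₀ hy
  have h := (Matrix.posDef_gram_of_linearIndependent (𝕜 := ℝ) b.linearIndependent).det_pos
  simpa only [Matrix.gram, hb] using h

variable [IsContMDiffRiemannianBundle (𝓡 4) ∞ R4 (fun x : X ↦ TangentSpace (𝓡 4) x)] [T2Space X]

theorem contDiffAt_comp_symm {x₀ : X} {y : R4} (hy : y ∈ (extChartAt (𝓡 4) x₀).target)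
    {f : X → ℝ} (hf : ContMDiff (𝓡 4) 𝓘(ℝ, ℝ) ∞ f) :
    ContDiffAt ℝ ∞ (fun z ↦ f ((extChartAt (𝓡 4) x₀).symm z)) y := by
  have h := hf.contMDiffAt.comp y ((contMDiffOn_extChartAt_symm (I := 𝓡 4) (n := ∞) x₀).contMDiffAt
      ((isOpen_extChartAt_target x₀).mem_nhds hy))
  exact h.contDiffAt

theorem contDiffAt_chartDensity (x₀ : X) {y₀ : R4} (hy₀ : y₀ ∈ (extChartAt (𝓡 4) x₀).target) :
    ContDiffAt ℝ ∞ (chartDensity x₀) y₀ := by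
  choose σ hσ hσ' using fun i ↦ exists_coordinate_field x₀ i hy₀
  have hG : ContDiffAt ℝ ∞ (fun y (i j : Fin 4) ↦ inner ℝ (coordVector x₀ y i)
      (coordVector x₀ y j)) y₀ := by
    refine contDiffAt_pi.2 fun i ↦ contDiffAt_pi.2 fun j ↦ ?_
    refine (contDiffAt_comp_symm hy₀ ((hσ i).contMDiff_inner (hσ j))).congr_of_eventuallyEq ?_
    filter_upwards [hσ' i, hσ' j] with y h1 h2
    rw [h1, h2]
  exact (contDiff_det.contDiffAt.comp y₀ hG).sqrt (det_metric_pos x₀ hy₀).ne'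

theorem contDiffAt_chartCoords (x₀ : X) {y₀ : R4} (hy₀ : y₀ ∈ (extChartAt (𝓡 4) x₀).target)
    {Z : Π x : X, TangentSpace (𝓡 4) x} (hZ : SmoothSec R4 Z) (k : Fin 4) :
    ContDiffAt ℝ ∞ (fun y ↦ chartCoords x₀ y (Z ((extChartAt (𝓡 4) x₀).symm y)) k) y₀ := by
  obtain ⟨g, hg, hg'⟩ := exists_coordinate_function x₀ k hy₀
  refine (contDiffAt_comp_symm hy₀ (contMDiff_mvfderiv hg hZ)).congr_of_eventuallyEq ?_
  filter_upwards [hg'] with y h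
  rw [h]

/-- The logarithmic derivative of `√(det g)` is the trace of the Christoffel symbols. -/
theorem fderiv_chartDensity {cov : CovariantDerivative (𝓡 4) R4 (fun x : X ↦ TangentSpace (𝓡 4) x)}
    (h : IsLeviCivita cov) (x₀ : X) {y₀ : R4} (hy₀ : y₀ ∈ (extChartAt (𝓡 4) x₀).target)
    {σ : Fin 4 → Π x : X, TangentSpace (𝓡 4) x} (hσ : ∀ i, SmoothSec R4 (σ i))
    (hσ' : ∀ i, ∀ᶠ y in 𝓝 y₀, σ i ((extChartAt (𝓡 4) x₀).symm y) = coordVector x₀ y i) (w : R4) :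
    fderiv ℝ (chartDensity x₀) y₀ w = chartDensity x₀ y₀ *
      ∑ i, chartCoords x₀ y₀ (cov (σ i) ((extChartAt (𝓡 4) x₀).symm y₀)
        (mfderiv (𝓡 4) (𝓡 4) (extChartAt (𝓡 4) x₀).symm y₀ w)) i := by
  let s := (extChartAt (𝓡 4) x₀).symm
  let v : TangentSpace (𝓡 4) (s y₀) := mfderiv (𝓡 4) (𝓡 4) s y₀ w
  let M : Matrix (Fin 4) (Fin 4) ℝ := Matrix.of fun i l ↦ chartCoords x₀ y₀ (cov (σ i) (s y₀) v) l
  let G : R4 → Fin 4 → Fin 4 → ℝ := fun y i j ↦ inner ℝ (σ i (s y)) (σ j (s y))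
  have hM : ∀ i, cov (σ i) (s y₀) v = ∑ l, M i l • σ l (s y₀) := fun i ↦ by
    refine (sum_chartCoords_smul_coordVector x₀ hy₀ _).symm.trans
      (Finset.sum_congr rfl fun l _ ↦ ?_)
    rw [← (hσ' l).self_of_nhds]
    rfl
  have hin : ∀ i j, ContMDiff (𝓡 4) 𝓘(ℝ, ℝ) ∞ (fun x ↦ inner ℝ (σ i x) (σ j x)) := fun i j ↦
    (hσ i).contMDiff_inner (hσ j)
  have hG : ∀ i j, HasDerivAt (fun t : ℝ ↦ G (y₀ + t • w) i j)
      ((M * Matrix.of (G (y₀ + (0 : ℝ) • w)) + Matrix.of (G (y₀ + (0 : ℝ) • w)) * M.transpose) i j)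
      0 := fun i j ↦ by
    have h1 := ((contDiffAt_comp_symm hy₀ (hin i j)).differentiableAt
      (by simp)).hasFDerivAt.hasLineDerivAt w
    refine HasDerivAt.congr_deriv h1 ?_
    rw [fderiv_comp_extChartAt_symm x₀ hy₀ ((hin i j).contMDiffAt.mdifferentiableAt (by simp))]
    refine (h.isCompatibleWith.metric _ _ (hσ i) (hσ j) _ v).trans ?_
    rw [hM, hM]
    simp only [zero_smul, add_zero, Matrix.add_apply, Matrix.mul_apply, Matrix.transpose_apply]
    simp only [map_sum, map_smul, LinearMap.sum_apply, LinearMap.smul_apply]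
    congr 1
    exact Finset.sum_congr rfl fun l _ ↦ mul_comm _ _
  have hdet := hasDerivAt_det_of_lie hG
  have hpos : 0 < (Matrix.of (G (y₀ + (0 : ℝ) • w))).det := by
    have := det_metric_pos x₀ hy₀
    simpa only [zero_smul, add_zero, G, (hσ' _).self_of_nhds, s] using this
  have hsq := hdet.sqrt hpos.ne'
  have hev : chartDensity x₀ =ᶠ[𝓝 y₀] fun y ↦ √(Matrix.of (G y)).det := by
    filter_upwards [Filter.eventually_all.2 hσ'] with y hy
    simp only [chartDensity, G, s, hy]
  have hd : DifferentiableAt ℝ (fun y ↦ √(Matrix.of (G y)).det) y₀ :=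
    ((contDiffAt_chartDensity x₀ hy₀).differentiableAt (by simp)).congr_of_eventuallyEq hev.symm
  have hu := HasDerivAt.unique (hd.hasFDerivAt.hasLineDerivAt w) hsq
  rw [hev.fderiv_eq, hu, hev.self_of_nhds]
  simp only [zero_smul, add_zero] at hpos ⊢
  have htr : M.trace = ∑ i, chartCoords x₀ y₀ (cov (σ i) (s y₀) v) i := rfl
  rw [← htr]
  have hsqrt := Real.mul_self_sqrt hpos.le
  have hne : √(Matrix.of (G y₀)).det ≠ 0 := (Real.sqrt_pos.2 hpos).ne'
  field_simp
  rw [Real.sq_sqrt hpos.le]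

/-- The divergence in a chart: `√g div Z = ∑ ∂_k (√g Z^k)`. -/
theorem sum_fderiv_chartDensity_mul
    {cov : CovariantDerivative (𝓡 4) R4 (fun x : X ↦ TangentSpace (𝓡 4) x)}
    (h : IsLeviCivita cov) (x₀ : X) {y₀ : R4} (hy₀ : y₀ ∈ (extChartAt (𝓡 4) x₀).target)
    {Z : Π x : X, TangentSpace (𝓡 4) x} (hZ : SmoothSec R4 Z) :
    ∑ k, fderiv ℝ (fun y ↦ chartDensity x₀ y *
        chartCoords x₀ y (Z ((extChartAt (𝓡 4) x₀).symm y)) k) y₀ (EuclideanSpace.single k 1)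
      = divergence cov Z ((extChartAt (𝓡 4) x₀).symm y₀) * chartDensity x₀ y₀ := by
  choose σ hσ hσ' using fun i ↦ exists_coordinate_field x₀ i hy₀
  choose g hg hg' using fun k ↦ exists_coordinate_function x₀ k hy₀
  let x := (extChartAt (𝓡 4) x₀).symm y₀
  have hx : ∀ i, σ i x = coordVector x₀ y₀ i := fun i ↦ (hσ' i).self_of_nhds
  have hgx : ∀ k (v : TangentSpace (𝓡 4) x), mvfderiv (𝓡 4) (g k) x v = chartCoords x₀ y₀ v k :=
    fun k ↦ (hg' k).self_of_nhds
  have hz : ∀ k, (fun y ↦ chartCoords x₀ y (Z ((extChartAt (𝓡 4) x₀).symm y)) k) =ᶠ[𝓝 y₀]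
      fun y ↦ mvfderiv (𝓡 4) (g k) ((extChartAt (𝓡 4) x₀).symm y)
        (Z ((extChartAt (𝓡 4) x₀).symm y)) := fun k ↦ by
    filter_upwards [hg' k] with y hy
    rw [hy]
  -- the bracket of `∂_k` and `Z` has `k`-th coordinate `∂_k Z^k`
  have hbr : ∀ k, fderiv ℝ (fun y ↦ chartCoords x₀ y (Z ((extChartAt (𝓡 4) x₀).symm y)) k) y₀
      (EuclideanSpace.single k 1)
      = chartCoords x₀ y₀ (cov Z x (coordVector x₀ y₀ k)) k
        - chartCoords x₀ y₀ (cov (σ k) x (Z x)) k := fun k ↦ by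
    have h1 := mvfderiv_mlieBracket (hg k) (hσ k x).diffSectionAt (hZ x).diffSectionAt
    have h2 : mvfderiv (𝓡 4) (fun y ↦ mvfderiv (𝓡 4) (g k) y (σ k y)) x (Z x) = 0 := by
      rw [← fderiv_chartCoords x₀ hy₀ (mdifferentiableAt_mvfderiv (hg k) (hσ k x).diffSectionAt)]
      have : (fun z ↦ mvfderiv (𝓡 4) (g k) ((extChartAt (𝓡 4) x₀).symm z)
          (σ k ((extChartAt (𝓡 4) x₀).symm z))) =ᶠ[𝓝 y₀] fun _ ↦ (1 : ℝ) := by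
        filter_upwards [hg' k, hσ' k, (isOpen_extChartAt_target x₀).mem_nhds hy₀] with y h1 h2 h3
        rw [h1, h2, chartCoords_coordVector x₀ h3, if_pos rfl]
      rw [this.fderiv_eq]
      simp
    rw [h2, sub_zero, h.mlieBracket_eq (hσ k x).diffSectionAt (hZ x).diffSectionAt, map_sub, hgx,
      hgx, hx] at h1
    rw [(hz k).fderiv_eq, fderiv_comp_extChartAt_symm x₀ hy₀
      (mdifferentiableAt_mvfderiv (hg k) (hZ x).diffSectionAt)]
    exact h1.symm
  have hprod : ∀ k, fderiv ℝ (fun y ↦ chartDensity x₀ y *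
      chartCoords x₀ y (Z ((extChartAt (𝓡 4) x₀).symm y)) k) y₀ (EuclideanSpace.single k 1)
      = chartDensity x₀ y₀ * (chartCoords x₀ y₀ (cov Z x (coordVector x₀ y₀ k)) k
        - chartCoords x₀ y₀ (cov (σ k) x (Z x)) k)
        + chartCoords x₀ y₀ (Z x) k * (chartDensity x₀ y₀ *
          ∑ i, chartCoords x₀ y₀ (cov (σ i) x (coordVector x₀ y₀ k)) i) := fun k ↦ by
    rw [fderiv_fun_mul ((contDiffAt_chartDensity x₀ hy₀).differentiableAt (by simp))
      ((contDiffAt_chartCoords x₀ hy₀ hZ k).differentiableAt (by simp)), ← hbr]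
    simp only [_root_.add_apply, _root_.smul_apply, smul_eq_mul]
    rw [fderiv_chartDensity h x₀ hy₀ hσ hσ']
    rfl
  have hsum : ∑ k, chartCoords x₀ y₀ (Z x) k *
      ∑ i, chartCoords x₀ y₀ (cov (σ i) x (coordVector x₀ y₀ k)) i
      = ∑ i, chartCoords x₀ y₀ (cov (σ i) x (Z x)) i := by
    simp only [Finset.mul_sum]
    rw [Finset.sum_comm]
    refine Finset.sum_congr rfl fun i _ ↦ ?_
    conv_rhs => rw [← sum_chartCoords_smul_coordVector x₀ hy₀ (Z x)]
    rw [← hgx]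
    simp only [map_sum, map_smul, hgx, WithLp.ofLp_sum, WithLp.ofLp_smul,
      Finset.sum_apply, Pi.smul_apply, smul_eq_mul]
  rw [divergence_eq_sum_chartCoords cov Z x₀ hy₀]
  simp only [hprod]
  rw [Finset.sum_add_distrib, ← Finset.mul_sum, Finset.sum_sub_distrib, ← hsum]
  simp only [mul_left_comm _ (chartDensity x₀ y₀), ← Finset.mul_sum]
  ring

end DivergenceInCharts

/-! ### Gradient fields -/

section GradientFields

variable {X : Type*} [TopologicalSpace X] [ChartedSpace R4 X] [IsManifold (𝓡 4) ∞ X]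
  [RiemannianBundle (fun x : X ↦ TangentSpace (𝓡 4) x)]

/-- The gradient of a function. -/
noncomputable def gradientField (f : X → ℝ) (x : X) : TangentSpace (𝓡 4) x :=
  ∑ a, mvfderiv (𝓡 4) f x (tangentFrame x a) • tangentFrame x a

theorem gradientField_eq (f : X → ℝ) (x : X)
    (e : OrthonormalBasis (Fin 4) ℝ (TangentSpace (𝓡 4) x)) :
    gradientField f x = ∑ a, mvfderiv (𝓡 4) f x (e a) • e a :=
  sum_bilin_orthonormalBasis
    (((LinearMap.lsmul ℝ (TangentSpace (𝓡 4) x)).comp (mvfderiv (𝓡 4) f x).toLinearMap))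
    (tangentFrame x) e

theorem inner_gradientField (f : X → ℝ) (x : X) (v : TangentSpace (𝓡 4) x) :
    inner ℝ (gradientField f x) v = mvfderiv (𝓡 4) f x v := by
  conv_rhs => rw [← (tangentFrame x).sum_repr' v]
  rw [gradientField, sum_inner, map_sum]
  refine Finset.sum_congr rfl fun a _ ↦ ?_
  rw [real_inner_smul_left, map_smul, smul_eq_mul, mul_comm]

theorem gradientField_eq_zero {f : X → ℝ} {x : X} (h : x ∉ tsupport f) : gradientField f x = 0 := by
  have h0 : mvfderiv (𝓡 4) f x = 0 := by
    refine (mvfderiv_congr (G := ℝ) (g := fun _ ↦ 0)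
      (notMem_tsupport_iff_eventuallyEq.1 h)).trans ?_
    rw [mvfderiv_const]
  rw [gradientField]
  exact Finset.sum_eq_zero fun a _ ↦ by rw [h0]; exact zero_smul ℝ _

variable {cov : CovariantDerivative (𝓡 4) R4 (fun x : X ↦ TangentSpace (𝓡 4) x)}

theorem divergence_eq_sum_inner (Z : Π x : X, TangentSpace (𝓡 4) x) (x : X)
    (e : OrthonormalBasis (Fin 4) ℝ (TangentSpace (𝓡 4) x)) :
    divergence cov Z x = ∑ a, inner ℝ (e a) (cov Z x (e a)) :=
  LinearMap.trace_eq_sum_inner _ e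

theorem divergence_sub {Z Y : Π x : X, TangentSpace (𝓡 4) x} (hZ : SmoothSec R4 Z)
    (hY : SmoothSec R4 Y) (x : X) :
    divergence cov (fun y ↦ Z y - Y y) x = divergence cov Z x - divergence cov Y x := by
  simp only [divergence_eq_sum_inner _ x (tangentFrame x)]
  rw [← Finset.sum_sub_distrib]
  refine Finset.sum_congr rfl fun a _ ↦ ?_
  rw [cov_sub (hZ x).diffSectionAt (hY x).diffSectionAt, inner_sub_right]

theorem divergence_smul {f : X → ℝ} (hf : ContMDiff (𝓡 4) 𝓘(ℝ, ℝ) ∞ f)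
    {Z : Π x : X, TangentSpace (𝓡 4) x} (hZ : SmoothSec R4 Z) (x : X) :
    divergence cov (fun y ↦ f y • Z y) x = f x * divergence cov Z x + mvfderiv (𝓡 4) f x (Z x) := by
  simp only [divergence_eq_sum_inner _ x (tangentFrame x)]
  conv_rhs => rw [← (tangentFrame x).sum_repr' (Z x)]
  rw [map_sum, Finset.mul_sum, ← Finset.sum_add_distrib]
  refine Finset.sum_congr rfl fun a _ ↦ ?_
  rw [cov_smul (hf.contMDiffAt.mdifferentiableAt (by simp)) (hZ x).diffSectionAt, inner_add_right,
    real_inner_smul_right, real_inner_smul_right, map_smul, smul_eq_mul]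
  ring

variable [IsContMDiffRiemannianBundle (𝓡 4) ∞ R4 (fun x : X ↦ TangentSpace (𝓡 4) x)] [T2Space X]

theorem smoothSec_gradientField {f : X → ℝ} (hf : ContMDiff (𝓡 4) 𝓘(ℝ, ℝ) ∞ f) :
    SmoothSec R4 (gradientField f) := fun x ↦ by
  obtain ⟨e, he, hex, -⟩ := exists_tangent_frame (tangentFrame x)
  have h : SmoothSec R4 (fun y ↦ ∑ a, mvfderiv (𝓡 4) f y (e a y) • e a y) :=
    SmoothSec.sum fun a _ ↦ SmoothSec.smul (contMDiff_mvfderiv hf (he a)) (he a)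
  refine ContMDiffAt.congr_of_eventuallyEq (h x) ?_
  filter_upwards [hex] with y ⟨b, hb⟩
  rw [gradientField_eq f y b]
  simp only [hb]

theorem continuous_divergence (h : IsLeviCivita cov) {Z : Π x : X, TangentSpace (𝓡 4) x}
    (hZ : SmoothSec R4 Z) : Continuous (divergence cov Z) := by
  refine continuous_iff_continuousAt.2 fun x ↦ ?_
  obtain ⟨e, he, hex, -⟩ := exists_tangent_frame (tangentFrame x)
  have hc : Continuous (fun y ↦ ∑ a, inner ℝ (e a y) (cov Z y (e a y))) :=
    continuous_finsetSum _ fun a _ ↦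
      ((he a).contMDiff_inner (hZ.covDeriv h.smooth (he a))).continuous
  refine hc.continuousAt.congr ?_
  filter_upwards [hex] with y ⟨b, hb⟩
  rw [divergence_eq_sum_inner Z y b]
  simp only [hb]

theorem hessianAt_eq_inner (h : IsLeviCivita cov) {f : X → ℝ} (hf : ContMDiff (𝓡 4) 𝓘(ℝ, ℝ) ∞ f)
    (x : X) (u v : TangentSpace (𝓡 4) x) :
    hessianAt cov f x u v = inner ℝ (cov (gradientField f) x u) v := by
  obtain ⟨Y, hY, rfl⟩ := exists_smoothSec_eq (F := R4) v
  have hg := smoothSec_gradientField hf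
  have h1 : mvfderiv (𝓡 4) (fun y ↦ inner ℝ (gradientField f y) (Y y)) x u
      = inner ℝ (cov (gradientField f) x u) (Y x) + inner ℝ (gradientField f x) (cov Y x u) :=
    h.isCompatibleWith.metric _ _ hg hY x u
  simp only [inner_gradientField] at h1
  rw [hessianAt_eq hf (hY x).diffSectionAt, h1]
  ring

theorem divergence_gradientField (h : IsLeviCivita cov) {f : X → ℝ}
    (hf : ContMDiff (𝓡 4) 𝓘(ℝ, ℝ) ∞ f) (x : X) :
    divergence cov (gradientField f) x = - laplacian cov f x := by
  rw [divergence_eq_sum_inner _ x (tangentFrame x), laplacian, neg_neg]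
  refine Finset.sum_congr rfl fun a _ ↦ ?_
  rw [hessianAt_eq_inner h hf, real_inner_comm]

theorem continuous_laplacian (h : IsLeviCivita cov) {f : X → ℝ}
    (hf : ContMDiff (𝓡 4) 𝓘(ℝ, ℝ) ∞ f) : Continuous (laplacian cov f) := by
  have e : laplacian cov f = fun x ↦ - divergence cov (gradientField f) x := by
    funext x
    rw [divergence_gradientField h hf, neg_neg]
  rw [e]
  exact (continuous_divergence h (smoothSec_gradientField hf)).neg

theorem laplacian_eq_zero (h : IsLeviCivita cov) {f : X → ℝ} (hf : ContMDiff (𝓡 4) 𝓘(ℝ, ℝ) ∞ f)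
    {x : X} (hx : x ∉ tsupport f) : laplacian cov f x = 0 := by
  have h0 : cov (gradientField f) x = cov (fun y ↦ (0 : TangentSpace (𝓡 4) y)) x := by
    refine cov_congr (smoothSec_gradientField hf x).diffSectionAt
      (SmoothSec.zero (V := fun y : X ↦ TangentSpace (𝓡 4) y) x).diffSectionAt ?_
    filter_upwards [(isClosed_tsupport f).isOpen_compl.mem_nhds hx] with y hy
    exact gradientField_eq_zero hy
  have h1 : cov (fun y ↦ (0 : TangentSpace (𝓡 4) y)) x = 0 := by
    ext v
    have := cov_const_smul (cov := cov) (0 : ℝ)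
      (SmoothSec.zero (V := fun y : X ↦ TangentSpace (𝓡 4) y) x).diffSectionAt v
    simpa using this
  rw [← neg_neg (laplacian cov f x), ← divergence_gradientField h hf,
    divergence_eq_sum_inner _ x (tangentFrame x), h0, h1]
  simp

end GradientFields

/-! ### Green's formula in a chart -/

section Green

open MeasureTheory

variable {X : Type*} [TopologicalSpace X] [T2Space X] [ChartedSpace R4 X] [IsManifold (𝓡 4) ∞ X]
  [RiemannianBundle (fun x : X ↦ TangentSpace (𝓡 4) x)]
  [IsContMDiffRiemannianBundle (𝓡 4) ∞ R4 (fun x : X ↦ TangentSpace (𝓡 4) x)]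

theorem chartIntegral_eq (x₀ : X) (f : X → ℝ) : chartIntegral x₀ f
    = ∫ y in (extChartAt (𝓡 4) x₀).target, f ((extChartAt (𝓡 4) x₀).symm y) * chartDensity x₀ y :=
  rfl

theorem isCompact_chart_image {x₀ : X} {K : Set X} (hK : IsCompact K)
    (hKs : K ⊆ (chartAt R4 x₀).source) : IsCompact (extChartAt (𝓡 4) x₀ '' K) :=
  hK.image_of_continuousOn ((continuousOn_extChartAt x₀).mono (by simpa using hKs))

theorem chart_image_subset_target {x₀ : X} {K : Set X} (hKs : K ⊆ (chartAt R4 x₀).source) :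
    extChartAt (𝓡 4) x₀ '' K ⊆ (extChartAt (𝓡 4) x₀).target := by
  rintro _ ⟨x, hx, rfl⟩
  exact (extChartAt (𝓡 4) x₀).map_source (by simpa using hKs hx)

theorem symm_notMem_of_notMem_image {x₀ : X} {K : Set X} {y : R4}
    (hy : y ∈ (extChartAt (𝓡 4) x₀).target) (hyK : y ∉ extChartAt (𝓡 4) x₀ '' K) :
    (extChartAt (𝓡 4) x₀).symm y ∉ K := fun h ↦
  hyK ⟨_, h, (extChartAt (𝓡 4) x₀).right_inv hy⟩

/-- A continuous function with compact support in a chart is integrable there. -/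
theorem integrableOn_chart {x₀ : X} {K : Set X} (hK : IsCompact K)
    (hKs : K ⊆ (chartAt R4 x₀).source) {f : X → ℝ} (hf : Continuous f) (h0 : ∀ x ∉ K, f x = 0) :
    IntegrableOn (fun y ↦ f ((extChartAt (𝓡 4) x₀).symm y) * chartDensity x₀ y)
      (extChartAt (𝓡 4) x₀).target := by
  have hc : ContinuousOn (fun y ↦ f ((extChartAt (𝓡 4) x₀).symm y) * chartDensity x₀ y)
      (extChartAt (𝓡 4) x₀).target :=
    (hf.comp_continuousOn (continuousOn_extChartAt_symm x₀)).mul fun y hy ↦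
      (contDiffAt_chartDensity x₀ hy).continuousAt.continuousWithinAt
  refine ((hc.mono (chart_image_subset_target hKs)).integrableOn_compact
    (isCompact_chart_image hK hKs)).of_forall_sdiff_eq_zero
    (isOpen_extChartAt_target x₀).measurableSet fun y hy ↦ ?_
  rw [h0 _ (symm_notMem_of_notMem_image hy.1 hy.2), zero_mul]

theorem integral_fderiv_apply_eq_zero {f : R4 → ℝ} (hf : ContDiff ℝ 1 f)
    (hc : HasCompactSupport f) (v : R4) : ∫ y, fderiv ℝ f y v = 0 := by
  have hi : Integrable (fun y ↦ fderiv ℝ f y v) :=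
    ((hf.continuous_fderiv (by simp)).clm_apply continuous_const).integrable_of_hasCompactSupport
      (hc.fderiv_apply ℝ v)
  have hfi : Integrable f := hf.continuous.integrable_of_hasCompactSupport hc
  have := integral_mul_fderiv_eq_neg_fderiv_mul_of_integrable (μ := volume) (𝕜 := ℝ)
    (f := fun _ : R4 ↦ (1 : ℝ)) (g := f) (v := v) (by simp) (by simpa using hi)
    (by simpa using hfi) (by fun_prop) (fun y _ ↦ (hf.differentiable (by simp)) y)
  simpa using this

variable {cov : CovariantDerivative (𝓡 4) R4 (fun x : X ↦ TangentSpace (𝓡 4) x)}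

/-- The divergence theorem for a vector field with compact support in a chart. -/
theorem chartIntegral_divergence (h : IsLeviCivita cov) {x₀ : X} {K : Set X} (hK : IsCompact K)
    (hKs : K ⊆ (chartAt R4 x₀).source) {Z : Π x : X, TangentSpace (𝓡 4) x} (hZ : SmoothSec R4 Z)
    (h0 : ∀ x ∉ K, Z x = 0) : chartIntegral x₀ (divergence cov Z) = 0 := by
  let T := (extChartAt (𝓡 4) x₀).target
  have hT : IsOpen T := isOpen_extChartAt_target x₀
  have hK' := isCompact_chart_image hK hKs
  have hKT := chart_image_subset_target hKs
  let p : Fin 4 → R4 → ℝ := fun k y ↦ chartDensity x₀ y *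
    chartCoords x₀ y (Z ((extChartAt (𝓡 4) x₀).symm y)) k
  let w : Fin 4 → R4 → ℝ := fun k ↦ T.indicator (p k)
  have hpw : ∀ k, ∀ y ∈ T, w k =ᶠ[𝓝 y] p k := fun k y hy ↦ by
    filter_upwards [hT.mem_nhds hy] with z hz
    exact Set.indicator_of_mem hz _
  have hw0 : ∀ k, ∀ y ∉ extChartAt (𝓡 4) x₀ '' K, w k y = 0 := fun k y hy ↦ by
    by_cases hyT : y ∈ T
    · have : w k y = p k y := Set.indicator_of_mem hyT _
      rw [this]
      simp only [p]
      rw [h0 _ (symm_notMem_of_notMem_image hyT hy), map_zero]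
      exact mul_zero _
    · exact Set.indicator_of_notMem hyT _
  have hev0 : ∀ k, ∀ y ∉ T, w k =ᶠ[𝓝 y] fun _ ↦ 0 := fun k y hy ↦ by
    filter_upwards [hK'.isClosed.isOpen_compl.mem_nhds fun h' ↦ hy (hKT h')] with z hz
    exact hw0 k z hz
  have hwc : ∀ k, HasCompactSupport (w k) := fun k ↦ HasCompactSupport.intro hK' (hw0 k)
  have hwd : ∀ k, ContDiff ℝ 1 (w k) := fun k ↦ contDiff_iff_contDiffAt.2 fun y ↦ by
    by_cases hy : y ∈ T
    · exact (((contDiffAt_chartDensity x₀ hy).mul (contDiffAt_chartCoords x₀ hy hZ k)).of_le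
        (by simp)).congr_of_eventuallyEq (hpw k y hy)
    · exact contDiffAt_const.congr_of_eventuallyEq (hev0 k y hy)
  have hint : ∀ k, Integrable (fun y ↦ fderiv ℝ (w k) y (EuclideanSpace.single k 1)) := fun k ↦
    (((hwd k).continuous_fderiv (by simp)).clm_apply
      continuous_const).integrable_of_hasCompactSupport ((hwc k).fderiv_apply ℝ _)
  calc chartIntegral x₀ (divergence cov Z)
      = ∫ y in T, ∑ k, fderiv ℝ (w k) y (EuclideanSpace.single k 1) := by
        rw [chartIntegral_eq]
        refine setIntegral_congr_fun hT.measurableSet fun y hy ↦ ?_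
        refine (sum_fderiv_chartDensity_mul h x₀ hy hZ).symm.trans
          (Finset.sum_congr rfl fun k _ ↦ ?_)
        rw [(hpw k y hy).fderiv_eq]
    _ = ∫ y, ∑ k, fderiv ℝ (w k) y (EuclideanSpace.single k 1) := by
        refine setIntegral_eq_integral_of_forall_compl_eq_zero fun y hy ↦ ?_
        refine Finset.sum_eq_zero fun k _ ↦ ?_
        rw [(hev0 k y hy).fderiv_eq]
        simp
    _ = 0 := by
        rw [integral_finsetSum _ fun k _ ↦ hint k]
        exact Finset.sum_eq_zero fun k _ ↦ integral_fderiv_apply_eq_zero (hwd k) (hwc k) _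

/-- Green's second identity in a chart. -/
theorem chartIntegral_mul_laplacian (h : IsLeviCivita cov) {x₀ : X} {f η : X → ℝ}
    (hf : ContMDiff (𝓡 4) 𝓘(ℝ, ℝ) ∞ f) (hη : ContMDiff (𝓡 4) 𝓘(ℝ, ℝ) ∞ η)
    (hηc : HasCompactSupport η) (hηs : tsupport η ⊆ (chartAt R4 x₀).source) :
    chartIntegral x₀ (fun x ↦ f x * laplacian cov η x)
      = chartIntegral x₀ (fun x ↦ laplacian cov f x * η x) := by
  have h1 := SmoothSec.smul hf (smoothSec_gradientField hη)
  have h2 := SmoothSec.smul hη (smoothSec_gradientField hf)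
  have hη0 : ∀ x ∉ tsupport η, η x = 0 := fun x hx ↦ image_eq_zero_of_notMem_tsupport hx
  have hdiv := chartIntegral_divergence h hηc hηs (h1.sub h2) fun x hx ↦ by
    rw [gradientField_eq_zero hx, hη0 x hx]
    simp
  have e : divergence cov (fun y ↦ f y • gradientField η y - η y • gradientField f y)
      = fun x ↦ laplacian cov f x * η x - f x * laplacian cov η x := by
    funext x
    rw [divergence_sub h1 h2, divergence_smul hf (smoothSec_gradientField hη),
      divergence_smul hη (smoothSec_gradientField hf), divergence_gradientField h hf,
      divergence_gradientField h hη, ← inner_gradientField f, ← inner_gradientField η,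
      real_inner_comm]
    ring
  have i1 := integrableOn_chart (f := fun x ↦ laplacian cov f x * η x) hηc hηs
    ((continuous_laplacian h hf).mul hη.continuous) fun x hx ↦ by rw [hη0 x hx, mul_zero]
  have i2 := integrableOn_chart (f := fun x ↦ f x * laplacian cov η x) hηc hηs
    (hf.continuous.mul (continuous_laplacian h hη))
    fun x hx ↦ by rw [laplacian_eq_zero h hη hx, mul_zero]
  rw [e, chartIntegral_eq] at hdiv
  simp only [sub_mul] at hdiv
  rw [integral_sub i1 i2] at hdiv
  exact (sub_eq_zero.1 hdiv).symm

/-- A continuous function is a weak subsolution if it is a uniform limit of smooth subsolutions. -/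
theorem WeakLaplacianLE.of_uniform_limit (h : IsLeviCivita cov) {u q : X → ℝ} (hu : Continuous u)
    (hq : Continuous q) (hq0 : ∀ x, 0 ≤ q x)
    (happrox : ∀ δ > 0, ∃ f : X → ℝ, ContMDiff (𝓡 4) 𝓘(ℝ, ℝ) ∞ f ∧ (∀ x, |f x - u x| ≤ δ) ∧
      ∀ x, laplacian cov f x ≤ q x * f x) :
    WeakLaplacianLE cov u (fun x ↦ q x * u x) := by
  intro x₀ η hη hηc hηs hηpos
  have hη0 : ∀ x ∉ tsupport η, η x = 0 := fun x hx ↦ image_eq_zero_of_notMem_tsupport hx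
  have hL0 : ∀ x ∉ tsupport η, laplacian cov η x = 0 := fun x hx ↦ laplacian_eq_zero h hη hx
  have hLc := continuous_laplacian h hη
  have hmono : ∀ f g : X → ℝ, Continuous f → Continuous g → (∀ x ∉ tsupport η, f x = 0) →
      (∀ x ∉ tsupport η, g x = 0) → (∀ x, f x ≤ g x) → chartIntegral x₀ f ≤ chartIntegral x₀ g :=
    fun f g hf hg hf0 hg0 hfg ↦ setIntegral_mono (integrableOn_chart hηc hηs hf hf0)
      (integrableOn_chart hηc hηs hg hg0)
      fun y ↦ mul_le_mul_of_nonneg_right (hfg _) (Real.sqrt_nonneg _)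
  have hadd : ∀ (f g : X → ℝ) (c : ℝ), Continuous f → Continuous g → (∀ x ∉ tsupport η, f x = 0) →
      (∀ x ∉ tsupport η, g x = 0) → chartIntegral x₀ (fun x ↦ f x + c * g x)
        = chartIntegral x₀ f + c * chartIntegral x₀ g := by
    intro f g c hf hg hf0 hg0
    simp only [chartIntegral_eq, add_mul, mul_assoc]
    rw [integral_add (integrableOn_chart hηc hηs hf hf0)
      ((integrableOn_chart hηc hηs hg hg0).const_mul c), integral_const_mul]
  let B : X → ℝ := fun x ↦ |laplacian cov η x| + q x * η x
  have hBc : Continuous B := hLc.abs.add (hq.mul hη.continuous)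
  have hB0 : ∀ x ∉ tsupport η, B x = 0 := fun x hx ↦ by simp [B, hη0 x hx, hL0 x hx]
  have huc : Continuous (fun x ↦ q x * u x * η x) := (hq.mul hu).mul hη.continuous
  have hu0 : ∀ x ∉ tsupport η, q x * u x * η x = 0 := fun x hx ↦ by simp [hη0 x hx]
  have key : ∀ δ > 0, chartIntegral x₀ (fun x ↦ u x * laplacian cov η x)
      ≤ chartIntegral x₀ (fun x ↦ q x * u x * η x) + δ * chartIntegral x₀ B := by
    intro δ hδ
    obtain ⟨f, hf, hfu, hfL⟩ := happrox δ hδ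
    let b : X → ℝ := fun x ↦ |laplacian cov η x|
    let d : X → ℝ := fun x ↦ q x * η x
    have hbc : Continuous b := hLc.abs
    have hb0 : ∀ x ∉ tsupport η, b x = 0 := fun x hx ↦ by simp [b, hL0 x hx]
    have hdc : Continuous d := hq.mul hη.continuous
    have hd0 : ∀ x ∉ tsupport η, d x = 0 := fun x hx ↦ by simp [d, hη0 x hx]
    have hfc : Continuous (fun x ↦ f x * laplacian cov η x) := hf.continuous.mul hLc
    have hf0 : ∀ x ∉ tsupport η, f x * laplacian cov η x = 0 := fun x hx ↦ by simp [hL0 x hx]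
    have s1 : chartIntegral x₀ (fun x ↦ u x * laplacian cov η x)
        ≤ chartIntegral x₀ (fun x ↦ f x * laplacian cov η x) + δ * chartIntegral x₀ b := by
      rw [← hadd _ _ δ hfc hbc hf0 hb0]
      refine hmono _ _ (hu.mul hLc) (hfc.add (continuous_const.mul hbc))
        (fun x hx ↦ by simp [hL0 x hx]) (fun x hx ↦ by simp [hb0 x hx, hL0 x hx]) fun x ↦ ?_
      have h1 : |(u x - f x) * laplacian cov η x| ≤ δ * b x := by
        rw [abs_mul, abs_sub_comm]
        exact mul_le_mul_of_nonneg_right (hfu x) (abs_nonneg _)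
      linarith [le_abs_self ((u x - f x) * laplacian cov η x),
        sub_mul (u x) (f x) (laplacian cov η x)]
    have s2 : chartIntegral x₀ (fun x ↦ laplacian cov f x * η x)
        ≤ chartIntegral x₀ (fun x ↦ q x * u x * η x) + δ * chartIntegral x₀ d := by
      rw [← hadd _ _ δ huc hdc hu0 hd0]
      refine hmono _ _ ((continuous_laplacian h hf).mul hη.continuous)
        (huc.add (continuous_const.mul hdc))
        (fun x hx ↦ by simp [hη0 x hx]) (fun x hx ↦ by simp [hd0 x hx, hη0 x hx]) fun x ↦ ?_
      have h1 := mul_le_mul_of_nonneg_right (hfL x) (hηpos x)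
      have h2 := mul_le_mul_of_nonneg_left ((le_abs_self _).trans (hfu x))
        (mul_nonneg (hq0 x) (hηpos x))
      simp only [d]
      nlinarith
    have s3 : chartIntegral x₀ B = chartIntegral x₀ b + chartIntegral x₀ d := by
      have := hadd b d 1 hbc hdc hb0 hd0
      simpa [B, b, d] using this
    rw [chartIntegral_mul_laplacian h hf hη hηc hηs] at s1
    rw [s3]
    linarith
  have hlim : Filter.Tendsto (fun δ : ℝ ↦ chartIntegral x₀ (fun x ↦ q x * u x * η x)
      + δ * chartIntegral x₀ B) (𝓝[>] 0) (𝓝 (chartIntegral x₀ (fun x ↦ q x * u x * η x))) := by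
    have : Continuous (fun δ : ℝ ↦ chartIntegral x₀ (fun x ↦ q x * u x * η x)
      + δ * chartIntegral x₀ B) := by fun_prop
    simpa using (this.tendsto 0).mono_left nhdsWithin_le_nhds
  exact ge_of_tendsto hlim (by filter_upwards [self_mem_nhdsWithin] with δ hδ using key δ hδ)

end Green

/-! ### The inequality for Dirac eigensections -/

theorem lemma4p1 :
    ∃ c : ℝ, 0 < c ∧
      ∀ (X : Type*) [TopologicalSpace X] [T2Space X] [ChartedSpace R4 X] [IsManifold (𝓡 4) ∞ X]
        -- the Riemannian metric `g` and its Levi-Civita connection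
        [RiemannianBundle (fun x : X ↦ TangentSpace (𝓡 4) x)]
        [IsContMDiffRiemannianBundle (𝓡 4) ∞ R4 (fun x : X ↦ TangentSpace (𝓡 4) x)]
        (covX : CovariantDerivative (𝓡 4) R4 (fun x : X ↦ TangentSpace (𝓡 4) x))
        -- the Hermitian bundle `W`
        (FW : Type*) [NormedAddCommGroup FW] [NormedSpace ℂ FW] [FiniteDimensional ℂ FW]
        (W : X → Type*) [∀ x, NormedAddCommGroup (W x)] [∀ x, InnerProductSpace ℂ (W x)]
        [TopologicalSpace (TotalSpace FW W)] [FiberBundle FW W]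
        [VectorBundle ℂ FW W] [VectorBundle ℝ FW W] [ContMDiffVectorBundle ∞ FW W (𝓡 4)]
        [IsSmoothHermitianBundle FW W]
        -- the Hermitian line bundle `L = det(W⁺)`
        (FL : Type*) [NormedAddCommGroup FL] [NormedSpace ℂ FL] [FiniteDimensional ℂ FL]
        (L : X → Type*) [∀ x, NormedAddCommGroup (L x)] [∀ x, InnerProductSpace ℂ (L x)]
        [TopologicalSpace (TotalSpace FL L)] [FiberBundle FL L]
        [VectorBundle ℂ FL L] [VectorBundle ℝ FL L] [ContMDiffVectorBundle ∞ FL L (𝓡 4)]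
        [IsSmoothHermitianBundle FL L]
        -- the Hermitian bundle `E`
        (FE : Type*) [NormedAddCommGroup FE] [NormedSpace ℂ FE] [FiniteDimensional ℂ FE]
        (E : X → Type*) [∀ x, NormedAddCommGroup (E x)] [∀ x, InnerProductSpace ℂ (E x)]
        [TopologicalSpace (TotalSpace FE E)] [FiberBundle FE E]
        [VectorBundle ℂ FE E] [VectorBundle ℝ FE E] [ContMDiffVectorBundle ∞ FE E (𝓡 4)]
        [IsSmoothHermitianBundle FE E]
        -- the spin^c structure and the connections
        (S : SpincStructure FW W) (δ : DeterminantLine FL L S)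
        (Ad : CovariantDerivative (𝓡 4) FL L) (covW : CovariantDerivative (𝓡 4) FW W)
        (A : CovariantDerivative (𝓡 4) FE E),
        IsLeviCivita covX → IsUnitaryConnection Ad → IsSpinConnection δ covX Ad covW →
        IsUnitaryConnection A →
        ∀ (φ : Π x, W x ⊗[ℂ] E x) (μ : ℝ), IsSmoothTensorSection FW FE φ →
          (∀ x, dirac S covW A φ x = (μ : ℂ) • φ x) →
          (∀ x, φ x ≠ 0 →
            laplacian covX (fun y ↦ ‖φ y‖ ^ (2 / 3 : ℝ)) x ≤
              c * (μ ^ 2 + |scalarCurvature covX x| + curvatureNorm A x + curvatureNorm Ad x)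
                * ‖φ x‖ ^ (2 / 3 : ℝ)) ∧
          WeakLaplacianLE covX (fun y ↦ ‖φ y‖ ^ (2 / 3 : ℝ))
            (fun x ↦ c * (μ ^ 2 + |scalarCurvature covX x| + curvatureNorm A x + curvatureNorm Ad x)
                * ‖φ x‖ ^ (2 / 3 : ℝ)) := by
  refine ⟨6, by norm_num, ?_⟩
  intro X _ _ _ _ _ _ covX FW _ _ _ W _ _ _ _ _ _ _ _ FL _ _ _ L _ _ _ _ _ _ _ _ FE _ _ _ E _ _
    _ _ _ _ _ _ S δ Ad covW A hX hd h hA φ μ hφ hD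
  have hpow : ∀ y, ‖φ y‖ ^ (2 / 3 : ℝ) = (‖φ y‖ ^ 2) ^ (1 / 3 : ℝ) := fun y ↦ by
    rw [← Real.rpow_natCast, ← Real.rpow_mul (norm_nonneg _)]
    norm_num
  have hq : Continuous (curvaturePotential covX Ad A μ) :=
    ((continuous_const.add hX.continuous_scalarCurvature.abs).add
      (hA.continuous_curvatureNorm hX)).add (hd.continuous_curvatureNorm hX)
  have hu := hφ.contMDiff_norm_sq
  refine ⟨fun x hx ↦ ?_, ?_⟩
  · have hpos : 0 < ‖φ x‖ ^ 2 + 0 := by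
      have := norm_pos_iff.2 hx
      positivity
    have := h.laplacian_rpow_le hX hd hA hφ hD le_rfl hpos
    simp only [add_zero] at this
    simp only [hpow]
    exact this
  · refine WeakLaplacianLE.of_uniform_limit hX (q := fun x ↦ 6 * curvaturePotential covX Ad A μ x)
      ?_ (continuous_const.mul hq)
      (fun x ↦ mul_nonneg (by norm_num) (curvaturePotential_nonneg μ x)) fun t ht ↦ ?_
    · simp only [hpow]
      exact hu.continuous.rpow_const fun _ ↦ Or.inr (by norm_num)
    · -- with `s = t³` the regularization `(|φ|² + s)^{1/3}` is within `t` of `|φ|^{2/3}`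
      have hs : 0 < t ^ 3 := by positivity
      have hpos : ∀ x, 0 < ‖φ x‖ ^ 2 + t ^ 3 := fun x ↦ by positivity
      have hroot : (t ^ 3) ^ (1 / 3 : ℝ) = t := by
        rw [← Real.rpow_natCast, ← Real.rpow_mul ht.le]
        norm_num
      refine ⟨fun y ↦ (‖φ y‖ ^ 2 + t ^ 3) ^ (1 / 3 : ℝ), fun x ↦ ?_, fun x ↦ ?_, fun x ↦
        h.laplacian_rpow_le hX hd hA hφ hD hs.le (hpos x)⟩
      · have hg : ContDiffAt ℝ ∞ (fun r : ℝ ↦ (r + t ^ 3) ^ (1 / 3 : ℝ)) (‖φ x‖ ^ 2) :=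
          (contDiffAt_id.add contDiffAt_const).rpow_const_of_ne (hpos x).ne'
        exact ContMDiffAt.comp (g := fun r : ℝ ↦ (r + t ^ 3) ^ (1 / 3 : ℝ)) x hg.contMDiffAt (hu x)
      · rw [hpow, abs_le]
        have h1 := Real.rpow_le_rpow (sq_nonneg ‖φ x‖) (le_add_of_nonneg_right hs.le)
          (show (0 : ℝ) ≤ 1 / 3 by norm_num)
        have h2 := Real.rpow_add_le_add_rpow (sq_nonneg ‖φ x‖) hs.le
          (show (0 : ℝ) ≤ 1 / 3 by norm_num) (by norm_num)
        rw [hroot] at h2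
        constructor <;> linarith
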